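/- **Setting.** Let $G=(V,E,w)$ be an edge-capacitated directed graph on $n\ge 2$ vertices with vertex weights $\pi:V\to\mathbb R_{>0}$. For $\emptyset\ne S\subsetneq V$ put $\vec\phi_\pi(S)=\min\{w(\delta^+(S)),w(\delta^+(\overline S))\}/\min\{\pi(S),\pi(\overline S)\}$ and $\vec\phi_\pi(G)=\min_{\emptyset\neq S\subsetneq V}\vec\phi_\pi(S)$. For a weighted directed graph $D$ on $V$, let $L_{\rm sym}(D)$ be the Laplacian of the undirected graph with edge weights $\frac12(D(i,j)+D(j,i))$, and let $\Pi=\mathrm{diag}(\pi)$. $D$ is Eulerian if its weights are nonnegative and every vertex has equal in- and outdegree. **Algorithm.** Given $\kappa>0$, play $T=\lceil C\log^2 n\rceil$ rounds. In a round with earlier demand graphs $D_1,\dots,D_{t-1}$: 1. *Cut player.* If some vertex $i$ has $\pi(i)\ge\frac14\pi(V)$, let $L=\{i\}$ for such a vertex. Otherwise let $X$ be $\exp\big(-\frac{\eta}{\rho}\sum_{k<t}\Pi^{-1/2}L_{\rm sym}(D_k)\Pi^{-1/2}\big)$ with $\eta=\frac14$, $\rho=4$, projected onto the orthogonal complement of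 $\Pi^{1/2}\mathbf 1$ and scaled to trace $1$. Let $v_1,\dots,v_n$ be a Gram decomposition of $\Pi^{-1/2}X\Pi^{-1/2}$, let $u\sim\mathcal N(0,I)$ be fresh, and let $L=\{i:\langle u,v_i\rangle\le y\}$, where $y$ is the (lower) $\pi$-weighted median of the values $\langle u,v_i\rangle$. Let $R=V\setminus L$. 2. *Flows.* Add vertices $s,t$ and arcs $s\to i$ of capacity $\pi(i)\pi(R)/\pi(L)$ for $i\in L$ and $j\to t$ of capacity $\pi(j)$ for $j\in R$, and multiply the capacities of $G$ by $\kappa$. Compute a maximum $s$-$t$ flow, and a maximum $t$-$s$ flow in the network in which the arcs at $s$ and $t$ are reversed. If one of them has value less than $\pi(R)$, output the associated minimum cut (the vertices of $G$ reachable from the source in the residual network) and stop. Otherwise decompose both flows into paths, giving demand graphs $\vec D$ and $\overleftarrow D$, and let $D_t=\frac12(\vec D+\overleftarrow D)$. If no cut is found, output $D=\frac1T\sum_{t=1}^T D_t$. **Corollary.** There are absolute constants $C,c_1,c_2,c_3>0$ such that the following holds for all $G$, $\pi$ as above and for every choice of the maximum flows, path decompositions and Gram decompositions. (Probabilities refer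 to the Gaussian vectors.) * Each round computes at most two single-commodity flows, so for every $\kappa>0$ a run computes at most $2T=O(\log^2 n)$ of them. * For every $\kappa>0$, if the algorithm outputs a cut $S$, then $\emptyset\ne S\subsetneq V$ and $\vec\phi_\pi(S)\le c_2/\kappa$. If it outputs a demand graph $D$, then $D$ is Eulerian and it is the demand graph of a path flow in $G$ whose arc loads form a circulation $F$ with $F(e)\le\kappa\,w(e)$ for all $e\in E$. * For every $\kappa>0$, with probability at least $2/3$ the algorithm outputs a cut, or it outputs a $D$ with $\lambda_2\big(\Pi^{-1/2}L_{\rm sym}(D)\Pi^{-1/2}\big)\ge c_1/\log n$ and $\vec\phi_\pi(D)\ge c_1/\log n$, and then $\vec\phi_\pi(G)\ge \frac{c_1}{\kappa\log n}$. * ($O(\log n)$-approximation.) Let $0<a\le\vec\phi_\pi(G)\le b$ and $K=\lceil\log_2(b/a)\rceil+1$. Run the algorithm for $\kappa=2^k\cdot\frac{c_1}{2b\log n}$, $k=0,\dots,K-1$, with the same Gaussian vectors in all $K$ runs, and return the best cut $S$ found. This computes at most $2TK$ single-commodity flows, and with probability at least $2/3$ a cut is found and $\vec\phi_\pi(S)\le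 c_3\log n\cdot\vec\phi_\pi(G)$. -/

import Mathlib

universe u v w

/-! ### Edge-capacitated directed graphs and weighted edge expansion -/

/-- An edge-capacitated directed graph on `V`: the edges are the pairs `i j` with `0 < cap i j`,
and `cap i j` is the capacity of the edge. -/
structure CapDigraph (V : Type u) where
  cap : V → V → ℝ
  cap_nonneg : ∀ i j, 0 ≤ cap i j

section Expansion

variable {V : Type u} [Fintype V] [DecidableEq V]

/-- The total weight `c(δ⁺(S))` of the arcs going out of `S`. -/
noncomputable def outWeight (c : V → V → ℝ) (S : Finset V) : ℝ :=
  ∑ i ∈ S, ∑ j ∈ Sᶜ, c i j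

/-- The vertex weight `π(S)`. -/
noncomputable def vertexWeight (π : V → ℝ) (S : Finset V) : ℝ :=
  ∑ i ∈ S, π i

/-- The `π`-weighted directed edge expansion of a set `S`, with respect to arc weights `c`. -/
noncomputable def setExpansion (c : V → V → ℝ) (π : V → ℝ) (S : Finset V) : ℝ :=
  min (outWeight c S) (outWeight c Sᶜ) / min (vertexWeight π S) (vertexWeight π Sᶜ)

/-- The `π`-weighted directed edge expansion: the minimum over all nonempty proper subsets. -/
noncomputable def expansion (c : V → V → ℝ) (π : V → ℝ) : ℝ :=
  ⨅ S : {S : Finset V // S.Nonempty ∧ S ≠ Finset.univ}, setExpansion c π S.1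

/-- Weighted directed graphs in which every vertex has equal in- and out-degree. For the arc loads
of a flow this says that the flow is a circulation. -/
def IsEulerian (D : V → V → ℝ) : Prop :=
  (∀ i j, 0 ≤ D i j) ∧ ∀ i, ∑ j, D i j = ∑ j, D j i

/-- The symmetric Laplacian of a weighted directed graph `D`, i.e. the Laplacian of the undirected
graph with weights `(D i j + D j i) / 2`. -/
noncomputable def symLaplacian (D : V → V → ℝ) : Matrix V V ℝ :=
  Matrix.diagonal (fun i => ∑ j, (D i j + D j i) / 2) - Matrix.of fun i j => (D i j + D j i) / 2

/-- The second smallest eigenvalue of `Π^{-1/2} L_sym(D) Π^{-1/2}` is at least `lam`, written as the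
Rayleigh quotient bound on the orthogonal complement of the trivial eigenvector. -/
def SpectralGapGE (D : V → V → ℝ) (π : V → ℝ) (lam : ℝ) : Prop :=
  ∀ x : V → ℝ, ∑ i, π i * x i = 0 →
    lam * ∑ i, π i * x i ^ 2 ≤ dotProduct x ((symLaplacian D).mulVec x)

end Expansion

/-! ### Path flows -/

section Paths

variable {α : Type u}

/-- `l` lists the vertices of a simple directed path from `a` to `b` using arcs of `E`. -/
def IsDirPath (E : α → α → Prop) (a b : α) (l : List α) : Prop :=
  l.IsChain E ∧ l.Nodup ∧ l.head? = some a ∧ l.getLast? = some b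

/-- The amount of flow which a path flow sends through the arc `a b`. -/
noncomputable def pathLoad [DecidableEq α] (f : List α →₀ ℝ) (a b : α) : ℝ :=
  f.sum fun l x => if (a, b) ∈ l.zip l.tail then x else 0

/-- The total amount of flow which a path flow sends from `a` to `b`. -/
noncomputable def pathDemand [DecidableEq α] (f : List α →₀ ℝ) (a b : α) : ℝ :=
  f.sum fun l x => if l.head? = some a ∧ l.getLast? = some b then x else 0

end Paths

/-- `f` is a multicommodity flow along paths of `G` with congestion at most `κ`, with demand graph
`D`. -/
def Routes {V : Type u} [DecidableEq V] (G : CapDigraph V) (κ : ℝ) (f : List V →₀ ℝ)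
    (D : V → V → ℝ) : Prop :=
  (∀ l, 0 ≤ f l) ∧
  (∀ l ∈ f.support, ∃ i j, IsDirPath (fun a b => 0 < G.cap a b) i j l) ∧
  (∀ a b, pathLoad f a b ≤ κ * G.cap a b) ∧
  ∀ i j, pathDemand f i j = D i j

/-! ### Single-commodity flow problems -/

structure FlowNetwork (α : Type u) where
  cap : α → α → ℝ
  source : α
  sink : α

namespace FlowNetwork

variable {α : Type u} [Fintype α] [DecidableEq α]

def IsFlow (N : FlowNetwork α) (f : α → α → ℝ) : Prop :=
  (∀ a b, 0 ≤ f a b ∧ f a b ≤ N.cap a b) ∧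
  ∀ a, a ≠ N.source → a ≠ N.sink → ∑ b, f a b = ∑ b, f b a

noncomputable def value (N : FlowNetwork α) (f : α → α → ℝ) : ℝ :=
  ∑ b, f N.source b - ∑ b, f b N.source

def IsMaxFlow (N : FlowNetwork α) (f : α → α → ℝ) : Prop :=
  N.IsFlow f ∧ ∀ g, N.IsFlow g → N.value g ≤ N.value f

/-- The arcs of the residual network of `f`. -/
def Residual (N : FlowNetwork α) (f : α → α → ℝ) (a b : α) : Prop :=
  f a b < N.cap a b ∨ 0 < f b a

/-- `p` is a path decomposition of the flow `f` (circular parts of `f` are discarded). -/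
def IsPathDecomposition (N : FlowNetwork α) (f : α → α → ℝ) (p : List α →₀ ℝ) : Prop :=
  (∀ l, 0 ≤ p l) ∧
  (∀ l ∈ p.support, IsDirPath (fun a b => 0 < N.cap a b) N.source N.sink l) ∧
  (∀ a b, pathLoad p a b ≤ f a b) ∧
  (p.sum fun _ x => x) = N.value f

end FlowNetwork

/-- The vertices of `G` together with two additional vertices `s` and `t`. -/
abbrev NetNode (V : Type u) : Type u := V ⊕ Bool

namespace NetNode

abbrev s {V : Type u} : NetNode V := Sum.inr false
abbrev t {V : Type u} : NetNode V := Sum.inr true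

end NetNode

section Programs

variable {V : Type u}

/-- Programs that may call a single-commodity maximum flow routine: a program either returns a
value, or asks for a maximum flow of one network and continues with the answer. -/
inductive FlowProg (V : Type u) (β : Type v) : Type (max u v) where
  | ret (x : β) : FlowProg V β
  | maxFlow (N : FlowNetwork (NetNode V)) (k : (NetNode V → NetNode V → ℝ) → FlowProg V β) :
      FlowProg V β

namespace FlowProg

def bind {β : Type v} {γ : Type w} : FlowProg V β → (β → FlowProg V γ) → FlowProg V γ
  | ret x, g => g x
  | maxFlow N k, g => maxFlow N fun f => (k f).bind g

/-- The value returned by a program, if its flow problems are solved by `solve`. -/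
def eval {β : Type v} (solve : FlowNetwork (NetNode V) → NetNode V → NetNode V → ℝ) :
    FlowProg V β → β
  | ret x => x
  | maxFlow N k => (k (solve N)).eval solve

/-- The number of single-commodity flows computed by a program. -/
def flowCount {β : Type v} (solve : FlowNetwork (NetNode V) → NetNode V → NetNode V → ℝ) :
    FlowProg V β → ℕ
  | ret _ => 0
  | maxFlow N k => (k (solve N)).flowCount solve + 1

end FlowProg

end Programs

section Algorithm

variable {V : Type u} [Fintype V] [DecidableEq V]

/-- `x` is a Gram decomposition of `Y`. -/
def IsGram (Y : Matrix V V ℝ) (x : V → V → ℝ) : Prop :=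
  ∀ i j, dotProduct (x i) (x j) = Y i j

/-- The choices that an implementation of the algorithm makes: which maximum flow, which path
decomposition and which Gram decomposition it uses. The specifications only say that an output is
correct on every input which has a correct output, so they hide no existence theorem. -/
structure Subroutines (V : Type u) [Fintype V] [DecidableEq V] where
  solve : FlowNetwork (NetNode V) → NetNode V → NetNode V → ℝ
  solve_spec : ∀ (N : FlowNetwork (NetNode V)) f, N.IsMaxFlow f → N.IsMaxFlow (solve N)
  decompose : FlowNetwork (NetNode V) → (NetNode V → NetNode V → ℝ) → List (NetNode V) →₀ ℝ
  decompose_spec : ∀ (N : FlowNetwork (NetNode V)) f p,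
    N.IsPathDecomposition f p → N.IsPathDecomposition f (decompose N f)
  gram : Matrix V V ℝ → V → V → ℝ
  gram_spec : ∀ Y x, IsGram Y x → IsGram Y (gram Y)

open Classical in
instance : Nonempty (Subroutines V) :=
  ⟨{ solve := fun N => if h : ∃ f, N.IsMaxFlow f then h.choose else 0
     solve_spec := fun N f hf => by
       have h : ∃ f, N.IsMaxFlow f := ⟨f, hf⟩
       rw [dif_pos h]; exact h.choose_spec
     decompose := fun N f => if h : ∃ p, N.IsPathDecomposition f p then h.choose else 0
     decompose_spec := fun N f p hp => by
       have h : ∃ p, N.IsPathDecomposition f p := ⟨p, hp⟩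
       rw [dif_pos h]; exact h.choose_spec
     gram := fun Y => if h : ∃ x, IsGram Y x then h.choose else 0
     gram_spec := fun Y x hx => by
       have h : ∃ x, IsGram Y x := ⟨x, hx⟩
       rw [dif_pos h]; exact h.choose_spec }⟩

/-! #### The bidirectional maximum flow -/

/-- The network with arcs `s → i` of capacity `(π(R)/π(L)) * β * π i` for `i ∈ L`, arcs `j → t` of
capacity `β * π j` for `j ∈ R`, and the edges of `G` with capacities multiplied by `κ`. -/
noncomputable def forwardNetwork (G : CapDigraph V) (π : V → ℝ) (L R : Finset V) (β κ : ℝ) :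
    FlowNetwork (NetNode V) where
  cap
    | Sum.inl i, Sum.inl j => κ * G.cap i j
    | Sum.inr false, Sum.inl i =>
        if i ∈ L then vertexWeight π R / vertexWeight π L * β * π i else 0
    | Sum.inl j, Sum.inr true => if j ∈ R then β * π j else 0
    | _, _ => 0
  source := NetNode.s
  sink := NetNode.t

/-- The same network with the arcs at `s` and `t` reversed, for flows from `t` to `s`. -/
noncomputable def backwardNetwork (G : CapDigraph V) (π : V → ℝ) (L R : Finset V) (β κ : ℝ) :
    FlowNetwork (NetNode V) where
  cap
    | Sum.inl i, Sum.inl j => κ * G.cap i j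
    | Sum.inl i, Sum.inr false =>
        if i ∈ L then vertexWeight π R / vertexWeight π L * β * π i else 0
    | Sum.inr true, Sum.inl j => if j ∈ R then β * π j else 0
    | _, _ => 0
  source := NetNode.t
  sink := NetNode.s

open Classical in
/-- The minimum cut associated with a maximum flow `f`: the vertices of `G` reachable from the
source in the residual network. -/
noncomputable def minCut (N : FlowNetwork (NetNode V)) (f : NetNode V → NetNode V → ℝ) :
    Finset V :=
  Finset.univ.filter fun i => Relation.ReflTransGen (N.Residual f) N.source (Sum.inl i)

/-- Bidirectional max-flow: the cut of a non-saturating flow if there is one, otherwise the two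
saturating flows. -/
noncomputable def bidirectionalMaxFlow (G : CapDigraph V) (π : V → ℝ) (L R : Finset V) (β κ : ℝ) :
    FlowProg V
      (Finset V ⊕ (NetNode V → NetNode V → ℝ) × (NetNode V → NetNode V → ℝ)) :=
  .maxFlow (forwardNetwork G π L R β κ) fun f =>
  .maxFlow (backwardNetwork G π L R β κ) fun g =>
  .ret <|
    if (forwardNetwork G π L R β κ).value f < β * vertexWeight π R then
      .inl (minCut (forwardNetwork G π L R β κ) f)
    else if (backwardNetwork G π L R β κ).value g < β * vertexWeight π R then
      .inl (minCut (backwardNetwork G π L R β κ) g)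
    else .inr (f, g)

/-- The demand graph of a flow decomposed into paths between `s` and `t`: each path contributes to
the pair formed by its first and its last vertex in `G`. -/
noncomputable def netDemand (p : List (NetNode V) →₀ ℝ) (i j : V) : ℝ :=
  p.sum fun l x =>
    if l.tail.head? = some (Sum.inl i) ∧ l.dropLast.getLast? = some (Sum.inl j) then x else 0

/-! #### The cut player -/

/-- The diagonal matrix `Π^{-1/2}`. -/
noncomputable def invSqrtDiag (π : V → ℝ) : Matrix V V ℝ :=
  Matrix.diagonal fun i => (√(π i))⁻¹

/-- The feedback matrix `Π^{-1/2} L_sym(D) Π^{-1/2}`. -/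
noncomputable def feedback (π : V → ℝ) (D : V → V → ℝ) : Matrix V V ℝ :=
  invSqrtDiag π * symLaplacian D * invSqrtDiag π

/-- The orthogonal projection onto the complement of the vector `Π^{1/2} 1`. -/
noncomputable def proj (π : V → ℝ) : Matrix V V ℝ :=
  1 - (vertexWeight π Finset.univ)⁻¹ •
    Matrix.vecMulVec (fun i => √(π i)) (fun i => √(π i))

/-- The matrix multiplicative weight update with step size `η` and width bound `ρ`: the exponential
of `-(η/ρ)` times the sum of the feedback matrices so far, projected onto the complement of
`Π^{1/2} 1` and scaled to trace one. -/
noncomputable def density (π : V → ℝ) (η ρ : ℝ) (hist : List (V → V → ℝ)) : Matrix V V ℝ :=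
  let X := proj π * NormedSpace.exp (-((η / ρ) • (hist.map (feedback π)).sum)) * proj π
  X.trace⁻¹ • X

/-- The (lower) median of the values `x i` with respect to the weights `π i`. -/
noncomputable def weightedMedian (π : V → ℝ) (x : V → ℝ) : ℝ :=
  sInf {y | (∃ i, x i = y) ∧
    vertexWeight π Finset.univ / 2 ≤ vertexWeight π (Finset.univ.filter fun j => x j ≤ y)}

open Classical in
/-- The cut player. It sees the vertex weights and the demand graphs played so far, but not the
graph, and it uses a Gaussian vector `u`. It returns one side `L` of the bipartition: a single heavy
vertex if there is one, and otherwise the vertices whose projection onto `u` is at most the weighted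
median. -/
noncomputable def cutPlayer (π : V → ℝ) (η ρ : ℝ) (gram : Matrix V V ℝ → V → V → ℝ)
    (hist : List (V → V → ℝ)) (u : V → ℝ) : Finset V :=
  if h : ∃ i, vertexWeight π Finset.univ / 4 ≤ π i then {h.choose}
  else
    let Y := invSqrtDiag π * density π η ρ hist * invSqrtDiag π
    let x : V → ℝ := fun i => dotProduct u (gram Y i)
    Finset.univ.filter fun i => x i ≤ weightedMedian π x

/-! #### The approximation algorithm -/

inductive CMOutput (V : Type u) : Type u where
  | cut (S : Finset V)
  | demand (D : V → V → ℝ)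

/-- One round: ask the cut player for a bipartition, and either obtain a cut or the demand graph
played by the matching player. The step size is `1/4` and the width bound is `4`. -/
noncomputable def cmRound (sub : Subroutines V) (G : CapDigraph V) (π : V → ℝ) (κ : ℝ)
    (hist : List (V → V → ℝ)) (u : V → ℝ) : FlowProg V (CMOutput V) :=
  let L := cutPlayer π (1 / 4) 4 sub.gram hist u
  let R := Lᶜ
  (bidirectionalMaxFlow G π L R 1 κ).bind fun
    | .inl S => .ret (.cut S)
    | .inr (f, g) => .ret <| .demand fun i j =>
        (netDemand (sub.decompose (forwardNetwork G π L R 1 κ) f) i j +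
          netDemand (sub.decompose (backwardNetwork G π L R 1 κ) g) i j) / 2

/-- Play one round for each vector of the list `us`, starting from the history `hist`. Stop with the
first cut that is found; if none is found, return the average of the demand graphs. -/
noncomputable def cmLoop (sub : Subroutines V) (G : CapDigraph V) (π : V → ℝ) (κ : ℝ) :
    List (V → ℝ) → List (V → V → ℝ) → FlowProg V (CMOutput V)
  | [], hist => .ret (.demand ((hist.length : ℝ)⁻¹ • hist.sum))
  | u :: us, hist => (cmRound sub G π κ hist u).bind fun
      | .cut S => .ret (.cut S)
      | .demand D => cmLoop sub G π κ us (hist ++ [D])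

/-- The cut-matching-game algorithm with congestion parameter `κ` and `T` rounds, where `u k` is
the Gaussian vector of round `k`. -/
noncomputable def cutMatching (sub : Subroutines V) (G : CapDigraph V) (π : V → ℝ) (κ : ℝ)
    {T : ℕ} (u : Fin T → V → ℝ) : FlowProg V (CMOutput V) :=
  cmLoop sub G π κ (List.ofFn u) []

/-- Of two possible cuts keep the one of smaller expansion. -/
noncomputable def betterCut (G : CapDigraph V) (π : V → ℝ) :
    CMOutput V → Option (Finset V) → Option (Finset V)
  | .demand _, b => b
  | .cut S, none => some S
  | .cut S, some S' => if setExpansion G.cap π S ≤ setExpansion G.cap π S' then some S else some S'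

/-- Run the cut-matching-game algorithm for the parameters `κ₀, 2 κ₀, 4 κ₀, …` (`K` of them) and
return the best cut found. -/
noncomputable def cutMatchingSearch (sub : Subroutines V) (G : CapDigraph V) (π : V → ℝ)
    {T : ℕ} (u : Fin T → V → ℝ) : ℝ → ℕ → FlowProg V (Option (Finset V))
  | _, 0 => .ret none
  | κ₀, K + 1 => (cutMatching sub G π κ₀ u).bind fun o =>
      (cutMatchingSearch sub G π u (2 * κ₀) K).bind fun b => .ret (betterCut G π o b)

/-- The law of `T` independent standard Gaussian vectors indexed by `V`. -/
noncomputable def gaussianSeeds (V : Type u) [Fintype V] (T : ℕ) :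
    MeasureTheory.Measure (Fin T → V → ℝ) :=
  MeasureTheory.Measure.pi fun _ => MeasureTheory.Measure.pi fun _ =>
    ProbabilityTheory.gaussianReal 0 1

end Algorithm

/-!
The matching player is analysed through maximum flows, the cut player through a matrix potential.

*Flows.* The cut player always returns a nonempty `L` with `π(V \ L) ≤ 3 π(L)`, so every arc at a
terminal has capacity at most three times the weight of its vertex. If a maximum flow does not
saturate these arcs, then the set of vertices reachable in the residual network is a cut whose
capacity is the value of the flow (`FlowNetwork.IsMaxFlow.value_eq_cut`), and comparing the two
gives a set of expansion at most `3 / κ` (`IsTwoTerminal.cut_of_value_lt`). If both flows saturate,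
their path decompositions give an Eulerian demand graph with prescribed degrees all of whose arcs
cross the bipartition (`IsMatchingDemand`), and the paths route it in `G` with congestion `κ`
(`IsTwoTerminal.routes_netDemand`). Averages of such graphs are again Eulerian and routable.

*Potential.* Let `S` be the scaled sum of the feedback matrices and let `P` be the projection onto
the complement of `Π^{1/2} 1`. The potential is `Tr (P exp(-S) P)`. It is at most `n` initially,
and a demand graph `D` multiplies it by at most `1 - gain D / 64` (`potential_concat_le`), where
`gain D` is the trace of the feedback against the density matrix. The Golden-Thompson inequality is
not needed: in the joint eigenbasis of `A` and `A + N`, the traces of `exp(-A)`, `exp(-(A + N))`,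
`N exp(-A)`, … are sums over pairs of eigenvalues with common weights, and a trapezoidal estimate
for the scalar exponential suffices (`trace_exp_neg_add_le`).

*One round.* The gain is `½ ∑ D i j ‖v i - v j‖²` for the Gram vectors `v i` (`gain_eq`), which
have weighted mean zero, weighted square norm one and are distinct. If the bipartition isolates a
heavy vertex, then the gain is at least `1 / 2` (`gain_ge_of_singleton`). Otherwise let
`x i = ⟨u, v i⟩`. Almost surely these values are distinct, so that both sides of the median cut
have at least a quarter of the weight and every degree in `D` is at least a constant times the
weight of the vertex. Every arc of `D` crosses the weighted median, so `∑ D i j (x i - x j)²` is at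
least a constant times the variance `∑ π i (x i)²`. Up to the factor `stretch`, which is `O(log n)`
in expectation and bounds all the ratios `(x i - x j)² / ‖v i - v j‖²` simultaneously, it is a
lower bound for the gain (`variance_le_stretch_mul`). Thus
`gain ≥ c spread² / stretch ≥ c (2 s spread - s² stretch)` for all `s`, where `spread` is a bounded
lower bound for the standard deviation; this is linear in two quantities with easily estimated
expectations, and `s ≈ 1 / log n` gives an expected gain of order `1 / log n`
(`lintegral_round_le`).

*The game.* By induction over the rounds, the expected potential of the runs without a cut is at
most `n (1 - c / log n) ^ T` (`lintegral_outputPotential_le`), which is at most `n⁻³` for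
`T = ⌈C log² n⌉`. By Markov's inequality the potential is below `1 / n` with probability at least
`2 / 3`, and Jensen's inequality turns this into a spectral gap of order `1 / log n` for the
averaged demand graph (`spectralGapGE_of_potential_lt`). The easy direction of Cheeger's inequality
gives its expansion, and the routing transfers it to `G`.

*The search.* Some scale `κ` of the doubling search satisfies
`c₁ / (2 log n φ(G)) ≤ κ < c₁ / (log n φ(G))` (`exists_scale`). There a demand graph would certify
more expansion than `G` has, so with probability at least `2 / 3` the run outputs a cut, of
expansion at most `3 / κ = O(log n) φ(G)`.
-/

set_option linter.unusedSectionVars false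

/-! ### Maximum flows and residual reachability -/

namespace FlowNetwork

variable {α : Type u} [Fintype α] [DecidableEq α]

/-- The net amount of flow leaving the vertex `v`. -/
def netOut (f : α → α → ℝ) (v : α) : ℝ := ∑ b, f v b - ∑ b, f b v

theorem netOut_add_mul (f g : α → α → ℝ) (c : ℝ) (v : α) :
    netOut (fun a b => f a b + c * g a b) v = netOut f v + c * netOut g v := by
  simp only [netOut, Finset.sum_add_distrib, ← Finset.mul_sum]
  ring

/-- The unit flow on the single arc `a b`. -/
def unitArc (a b : α) : α → α → ℝ := fun x y => if x = a ∧ y = b then 1 else 0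

theorem netOut_unitArc (a b v : α) :
    netOut (unitArc a b) v = (if v = a then 1 else 0) - (if v = b then 1 else 0) := by
  simp only [netOut, unitArc]
  congr 1
  · by_cases h : v = a <;> simp [h]
  · by_cases h : v = b <;> simp [h]

theorem sum_netOut (f : α → α → ℝ) (A : Finset α) :
    ∑ v ∈ A, netOut f v = ∑ a ∈ A, ∑ b ∈ Aᶜ, f a b - ∑ a ∈ A, ∑ b ∈ Aᶜ, f b a := by
  simp only [netOut, Finset.sum_sub_distrib]
  have h1 : ∀ g : α → α → ℝ, ∑ a ∈ A, ∑ b, g a b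
      = ∑ a ∈ A, ∑ b ∈ A, g a b + ∑ a ∈ A, ∑ b ∈ Aᶜ, g a b := fun g => by
    rw [← Finset.sum_add_distrib]
    exact Finset.sum_congr rfl fun a _ => (Finset.sum_add_sum_compl A _).symm
  rw [h1 f, h1 fun a b => f b a, Finset.sum_comm (s := A) (t := A) (f := fun a b => f b a)]
  ring

variable (N : FlowNetwork α)

theorem value_eq_netOut (f : α → α → ℝ) : N.value f = netOut f N.source := rfl

theorem exists_isMaxFlow (hcap : ∀ a b, 0 ≤ N.cap a b) : ∃ f, N.IsMaxFlow f := by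
  have hcont : ∀ a b : α, Continuous fun f : α → α → ℝ => f a b := fun a b =>
    (continuous_apply b).comp (continuous_apply a)
  have hclosed : IsClosed {f | N.IsFlow f} := by
    simp only [IsFlow, Set.ofPred_and, Set.ofPred_forall]
    refine IsClosed.inter ?_ ?_
    · exact isClosed_iInter fun a => isClosed_iInter fun b =>
        (isClosed_le continuous_const (hcont a b)).inter (isClosed_le (hcont a b) continuous_const)
    · exact isClosed_iInter fun a => isClosed_iInter fun _ => isClosed_iInter fun _ =>
        isClosed_eq (continuous_finsetSum _ fun b _ => hcont a b)
          (continuous_finsetSum _ fun b _ => hcont b a)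
  have hcomp : IsCompact {f | N.IsFlow f} := by
    refine IsCompact.of_isClosed_subset (isCompact_univ_pi fun a =>
      isCompact_univ_pi fun b => isCompact_Icc (a := 0) (b := N.cap a b)) hclosed ?_
    intro f hf a _ b _
    exact hf.1 a b
  have hv : Continuous N.value :=
    (continuous_finsetSum _ fun b _ => hcont _ b).sub
      (continuous_finsetSum _ fun b _ => hcont b _)
  obtain ⟨f, hf, hmax⟩ := hcomp.exists_isMaxOn
    ⟨0, fun a b => ⟨le_rfl, hcap a b⟩, fun a _ _ => by simp⟩ hv.continuousOn
  exact ⟨f, hf, fun g hg => hmax hg⟩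

theorem IsMaxFlow.value_nonneg {N : FlowNetwork α} {f : α → α → ℝ} (hf : N.IsMaxFlow f) :
    0 ≤ N.value f := by
  have h := hf.2 0 ⟨fun a b => ⟨le_rfl, (hf.1.1 a b).1.trans (hf.1.1 a b).2⟩, fun a _ _ => by simp⟩
  simpa [value] using h

/-- If `a` is reachable in the residual network of `f`, then a small amount `ε` of additional flow
can be sent from the source to `a`. The path itself is not needed: the slack of the next residual
arc survives in a convex combination of `f` with the flow that reaches the previous vertex. -/
theorem exists_augmentation {f : α → α → ℝ} (hf : ∀ a b, 0 ≤ f a b ∧ f a b ≤ N.cap a b) {a : α}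
    (h : Relation.ReflTransGen (N.Residual f) N.source a) :
    ∃ (g : α → α → ℝ) (ε : ℝ), 0 < ε ∧ (∀ a b, 0 ≤ g a b ∧ g a b ≤ N.cap a b) ∧
      ∀ v, netOut g v = netOut f v +
        ε * ((if v = N.source then 1 else 0) - (if v = a then 1 else 0)) := by
  induction h with
  | refl => exact ⟨f, 1, one_pos, hf, fun v => by ring⟩
  | @tail a b _ hab ih =>
    obtain ⟨g, ε, hε, hg, hnet⟩ := ih
    -- `θ` balances the amount `θ ε` that is forwarded against the remaining slack `(1 - θ) s`
    have key : ∀ s : ℝ, 0 < s → ∃ θ : ℝ, 0 < θ ∧ θ ≤ 1 ∧ θ * ε = (1 - θ) * s := fun s hs =>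
      ⟨s / (s + ε), by positivity, by rw [div_le_one (by positivity)]; linarith, by
        field_simp; ring⟩
    have hmid : ∀ θ : ℝ, 0 < θ → θ ≤ 1 → ∀ x y,
        (1 - θ) * f x y ≤ f x y + θ * (g x y - f x y) ∧
        f x y + θ * (g x y - f x y) ≤ N.cap x y - (1 - θ) * (N.cap x y - f x y) := by
      intro θ h0 h1 x y
      have := mul_nonneg h0.le (hg x y).1
      have := mul_nonneg h0.le (sub_nonneg.2 (hg x y).2)
      constructor <;> nlinarith
    have hnet' : ∀ θ v, netOut (fun x y => f x y + θ * (g x y - f x y)) v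
        = netOut f v + θ * (netOut g v - netOut f v) := by
      intro θ v
      rw [netOut_add_mul f (fun x y => g x y - f x y) θ v]
      congr 2
      have := netOut_add_mul g f (-1) v
      simp only [neg_mul, one_mul, ← sub_eq_add_neg] at this
      exact this
    rcases hab with hab | hab
    · obtain ⟨θ, h0, h1, hθ⟩ := key (N.cap a b - f a b) (sub_pos.2 hab)
      refine ⟨fun x y => (f x y + θ * (g x y - f x y)) + θ * ε * unitArc a b x y, θ * ε,
        by positivity, fun x y => ?_, fun v => ?_⟩
      · have h2 := hmid θ h0 h1 x y
        have h3 : 0 ≤ (1 - θ) * f x y := mul_nonneg (by linarith) (hf x y).1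
        have h4 : 0 ≤ (1 - θ) * (N.cap x y - f x y) :=
          mul_nonneg (by linarith) (sub_nonneg.2 (hf x y).2)
        have h5 : 0 < θ * ε := by positivity
        unfold unitArc
        beta_reduce
        split_ifs with hxy
        · obtain ⟨rfl, rfl⟩ := hxy
          constructor <;> linarith
        · constructor <;> linarith
      · rw [netOut_add_mul (fun x y => f x y + θ * (g x y - f x y)), hnet', hnet, netOut_unitArc]
        ring
    · obtain ⟨θ, h0, h1, hθ⟩ := key (f b a) hab
      refine ⟨fun x y => (f x y + θ * (g x y - f x y)) + -(θ * ε) * unitArc b a x y, θ * ε,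
        by positivity, fun x y => ?_, fun v => ?_⟩
      · have h2 := hmid θ h0 h1 x y
        have h3 : 0 ≤ (1 - θ) * f x y := mul_nonneg (by linarith) (hf x y).1
        have h4 : 0 ≤ (1 - θ) * (N.cap x y - f x y) :=
          mul_nonneg (by linarith) (sub_nonneg.2 (hf x y).2)
        have h5 : 0 < θ * ε := by positivity
        unfold unitArc
        beta_reduce
        split_ifs with hxy
        · obtain ⟨rfl, rfl⟩ := hxy
          constructor <;> linarith
        · constructor <;> linarith
      · rw [netOut_add_mul (fun x y => f x y + θ * (g x y - f x y)), hnet', hnet, netOut_unitArc]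
        ring

theorem IsMaxFlow.not_reachable_sink {N : FlowNetwork α} {f : α → α → ℝ} (hf : N.IsMaxFlow f)
    (hst : N.source ≠ N.sink) :
    ¬ Relation.ReflTransGen (N.Residual f) N.source N.sink := by
  intro h
  obtain ⟨g, ε, hε, hg, hnet⟩ := N.exists_augmentation hf.1.1 h
  have hgf : N.IsFlow g := by
    refine ⟨hg, fun a h1 h2 => ?_⟩
    have h3 := hnet a
    have h4 := hf.1.2 a h1 h2
    simp only [netOut, h1, h2, if_false] at h3
    linarith
  have h1 := hf.2 g hgf
  have h2 := hnet N.source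
  simp only [if_true, if_neg hst] at h2
  rw [value_eq_netOut, value_eq_netOut] at h1
  linarith

/-- Max-flow min-cut for the cut formed by the vertices reachable in the residual network. -/
theorem IsMaxFlow.value_eq_cut {N : FlowNetwork α} {f : α → α → ℝ} (hf : N.IsMaxFlow f)
    (hst : N.source ≠ N.sink) (A : Finset α)
    (hA : ∀ a, a ∈ A ↔ Relation.ReflTransGen (N.Residual f) N.source a) :
    N.value f = ∑ a ∈ A, ∑ b ∈ Aᶜ, N.cap a b := by
  have hs : N.source ∈ A := (hA _).2 .refl
  have ht : N.sink ∉ A := fun h => hf.not_reachable_sink hst ((hA _).1 h)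
  have hres : ∀ a ∈ A, ∀ b ∈ Aᶜ, f a b = N.cap a b ∧ f b a = 0 := by
    intro a ha b hb
    have hr : ¬ N.Residual f a b := fun h =>
      (Finset.mem_compl.1 hb) ((hA b).2 (((hA a).1 ha).tail h))
    simp only [Residual, not_or, not_lt] at hr
    exact ⟨le_antisymm (hf.1.1 a b).2 hr.1, le_antisymm hr.2 (hf.1.1 b a).1⟩
  have h1 : ∑ v ∈ A, netOut f v = netOut f N.source := by
    refine Finset.sum_eq_single_of_mem _ hs fun v hv hne => ?_
    have := hf.1.2 v hne (fun h => ht (h ▸ hv))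
    simp only [netOut]
    linarith
  rw [value_eq_netOut, ← h1, sum_netOut]
  rw [Finset.sum_congr rfl fun a ha => Finset.sum_congr rfl fun b hb => (hres a ha b hb).1,
    Finset.sum_congr (g := fun _ => (0 : ℝ)) rfl
      fun a ha => Finset.sum_eq_zero fun b hb => (hres a ha b hb).2]
  simp

end FlowNetwork

/-! ### Directed paths and path decompositions -/

section Paths

variable {α : Type u}

theorem exists_isDirPath_of_reflTransGen {E : α → α → Prop} {a b : α}
    (h : Relation.ReflTransGen E a b) : ∃ l, IsDirPath E a b l := by
  classical
  induction h using Relation.ReflTransGen.head_induction_on with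
  | refl => exact ⟨[b], by simp [IsDirPath]⟩
  | @head a c hac _ ih =>
    obtain ⟨l, hl, hnd, hh, ht⟩ := ih
    by_cases ha : a ∈ l
    · obtain ⟨l₁, l₂, rfl⟩ := List.append_of_mem ha
      refine ⟨a :: l₂, (List.isChain_append.1 hl).2.1, (List.nodup_append.1 hnd).2.1, rfl, ?_⟩
      rw [← ht, List.getLast?_append_of_ne_nil _ (by simp)]
    · cases l with
      | nil => simp at hh
      | cons x l =>
        simp only [List.head?_cons, Option.some.injEq] at hh
        subst hh
        exact ⟨a :: x :: l, List.isChain_cons_cons.2 ⟨hac, hl⟩, List.nodup_cons.2 ⟨ha, hnd⟩,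
          rfl, by rw [List.getLast?_cons_cons, ht]⟩

variable [DecidableEq α]

/-- The unit flow along the arcs of a list of vertices. -/
def arcLoad (l : List α) (a b : α) : ℝ := if (a, b) ∈ l.zip l.tail then 1 else 0

theorem arcLoad_nonneg (l : List α) (a b : α) : 0 ≤ arcLoad l a b := by
  unfold arcLoad; split_ifs <;> norm_num

theorem arcLoad_cons_cons {x y : α} {l : List α} (hx : x ∉ y :: l) (a b : α) :
    arcLoad (x :: y :: l) a b = FlowNetwork.unitArc x y a b + arcLoad (y :: l) a b := by
  simp only [arcLoad, FlowNetwork.unitArc, List.tail_cons, List.zip_cons_cons, List.mem_cons,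
    Prod.mk.injEq]
  by_cases h : a = x ∧ b = y
  · have : (a, b) ∉ (y :: l).zip l := fun h' => hx (h.1 ▸ (List.of_mem_zip h').1)
    simp [h.1, h.2] at this ⊢
    simp [this]
  · by_cases h' : (a, b) ∈ (y :: l).zip l <;> simp [h, h']

theorem pathLoad_eq_sum (p : List α →₀ ℝ) (a b : α) :
    pathLoad p a b = p.sum fun l x => x * arcLoad l a b := by
  simp only [pathLoad, arcLoad, mul_ite, mul_one, mul_zero]

theorem pathLoad_add (p q : List α →₀ ℝ) (a b : α) :
    pathLoad (p + q) a b = pathLoad p a b + pathLoad q a b := by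
  simp only [pathLoad_eq_sum]
  exact Finsupp.sum_add_index' (by simp) (by intros; ring)

theorem pathLoad_single (l : List α) (x : ℝ) (a b : α) :
    pathLoad (Finsupp.single l x) a b = x * arcLoad l a b := by
  rw [pathLoad_eq_sum, Finsupp.sum_single_index (by simp)]

theorem mem_zip_tail_of_isChain {E : α → α → Prop} {l : List α} (h : l.IsChain E) {a b : α}
    (hab : (a, b) ∈ l.zip l.tail) : E a b := by
  induction l with
  | nil => simp at hab
  | cons x l ih =>
    cases l with
    | nil => simp at hab
    | cons y l =>
      rw [List.isChain_cons_cons] at h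
      simp only [List.tail_cons, List.zip_cons_cons, List.mem_cons, Prod.mk.injEq] at hab ih
      rcases hab with ⟨rfl, rfl⟩ | hab
      · exact h.1
      · exact ih h.2 hab

/-- A path from `a` to `b` conserves flow except at its end points. -/
theorem IsDirPath.netOut_arcLoad [Fintype α] {E : α → α → Prop} {a b : α} {l : List α}
    (h : IsDirPath E a b l) (v : α) :
    FlowNetwork.netOut (arcLoad l) v = (if v = a then 1 else 0) - (if v = b then 1 else 0) := by
  induction l generalizing a with
  | nil => simp [IsDirPath] at h
  | cons x l ih =>
    obtain ⟨hc, hnd, hh, ht⟩ := h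
    simp only [List.head?_cons, Option.some.injEq] at hh
    subst hh
    cases l with
    | nil =>
      simp only [List.getLast?_singleton, Option.some.injEq] at ht
      subst ht
      simp [FlowNetwork.netOut, arcLoad]
    | cons y l =>
      have hx := (List.nodup_cons.1 hnd).1
      have h1 := ih (a := y) ⟨(List.isChain_cons_cons.1 hc).2, (List.nodup_cons.1 hnd).2, rfl,
        by rw [← ht, List.getLast?_cons_cons]⟩
      have h2 : arcLoad (x :: y :: l)
          = fun a b => FlowNetwork.unitArc x y a b + 1 * arcLoad (y :: l) a b := by
        funext a b
        rw [arcLoad_cons_cons hx, one_mul]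
      rw [h2, FlowNetwork.netOut_add_mul, h1, FlowNetwork.netOut_unitArc]
      ring

end Paths

namespace FlowNetwork

variable {α : Type u} [Fintype α] [DecidableEq α]

theorem netOut_sub_mul (f g : α → α → ℝ) (c : ℝ) (v : α) :
    netOut (fun a b => f a b - c * g a b) v = netOut f v - c * netOut g v := by
  have := netOut_add_mul f g (-c) v
  simpa [sub_eq_add_neg] using this

/-- A nonnegative conservative flow of positive value has a path from `s` to `t` along arcs that
carry flow. -/
theorem exists_isDirPath_of_pos {f : α → α → ℝ} {s t : α} (hf : ∀ a b, 0 ≤ f a b)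
    (hcons : ∀ a, a ≠ s → a ≠ t → netOut f a = 0) (hpos : 0 < netOut f s) :
    ∃ l, IsDirPath (fun a b => 0 < f a b) s t l := by
  classical
  refine exists_isDirPath_of_reflTransGen ?_
  by_contra hr
  let A : Finset α := Finset.univ.filter fun a =>
    Relation.ReflTransGen (fun a b => 0 < f a b) s a
  have hA : ∀ a, a ∈ A ↔ Relation.ReflTransGen (fun a b => 0 < f a b) s a := by simp [A]
  have h1 : ∑ v ∈ A, netOut f v = netOut f s := by
    refine Finset.sum_eq_single_of_mem _ ((hA s).2 .refl) fun v hv hne => ?_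
    exact hcons v hne fun h => hr ((hA t).1 (h ▸ hv))
  have h2 : ∑ a ∈ A, ∑ b ∈ Aᶜ, f a b = 0 :=
    Finset.sum_eq_zero fun a ha => Finset.sum_eq_zero fun b hb => by
      by_contra hne
      exact Finset.mem_compl.1 hb ((hA b).2 (((hA a).1 ha).tail
        (lt_of_le_of_ne (hf a b) (Ne.symm hne))))
  have h3 : 0 ≤ ∑ a ∈ A, ∑ b ∈ Aᶜ, f b a :=
    Finset.sum_nonneg fun a _ => Finset.sum_nonneg fun b _ => hf b a
  rw [sum_netOut, h2] at h1
  linarith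

/-- Path decomposition by induction on the number of arcs that carry flow: subtracting the
bottleneck of a path empties at least one arc. -/
theorem exists_pathDecomposition_aux {s t : α} (hst : s ≠ t) (n : ℕ) :
    ∀ f : α → α → ℝ, (∀ a b, 0 ≤ f a b) → (∀ a, a ≠ s → a ≠ t → netOut f a = 0) →
    0 ≤ netOut f s → (Finset.univ.filter fun e : α × α => 0 < f e.1 e.2).card ≤ n →
    ∃ p : List α →₀ ℝ, (∀ l, 0 ≤ p l) ∧
      (∀ l ∈ p.support, IsDirPath (fun a b => 0 < f a b) s t l) ∧
      (∀ a b, pathLoad p a b ≤ f a b) ∧ (p.sum fun _ x => x) = netOut f s := by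
  induction n with
  | zero =>
    intro f hf _ _ hcard
    have h0 : ∀ a b, f a b = 0 := fun a b => by
      by_contra hne
      have : (a, b) ∈ (Finset.univ.filter fun e : α × α => 0 < f e.1 e.2) := by
        simpa using lt_of_le_of_ne (hf a b) (Ne.symm hne)
      rw [Finset.card_eq_zero.1 (Nat.le_zero.1 hcard)] at this
      simp at this
    exact ⟨0, by simp, by simp, by simp [pathLoad, h0], by simp [netOut, h0]⟩
  | succ n ih =>
    intro f hf hcons hv hcard
    rcases hv.eq_or_lt with hv0 | hvpos
    · exact ⟨0, by simp, by simp, by simp [pathLoad, hf], by simp [← hv0]⟩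
    obtain ⟨l, hl⟩ := exists_isDirPath_of_pos hf hcons hvpos
    have hlpos : ∀ a b, (a, b) ∈ l.zip l.tail → 0 < f a b := fun a b =>
      mem_zip_tail_of_isChain hl.1
    -- the arcs of the path; the path has at least one, since `s ≠ t`
    have hne : (l.zip l.tail).toFinset.Nonempty := by
      obtain ⟨_, _, hh, ht⟩ := hl
      match l with
      | [] => simp at hh
      | [x] => simp at hh ht; exact absurd (hh.symm.trans ht) hst
      | x :: y :: l => exact ⟨(x, y), by simp⟩
    obtain ⟨e, he, hmin⟩ := Finset.exists_min_image _ (fun e : α × α => f e.1 e.2) hne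
    rw [List.mem_toFinset] at he
    have hle : ∀ m, m ≤ f e.1 e.2 → ∀ a b, m * arcLoad l a b ≤ f a b := by
      intro m hm a b
      unfold arcLoad
      split_ifs with hab
      · have := hmin (a, b) (List.mem_toFinset.2 hab)
        simp only at this
        linarith
      · simpa using hf a b
    by_cases hm : netOut f s ≤ f e.1 e.2
    · refine ⟨Finsupp.single l (netOut f s), fun l' => ?_, fun l' hl' => ?_, fun a b => ?_, ?_⟩
      · rw [Finsupp.single_apply]; split_ifs <;> simp [hv]
      · rwa [Finset.mem_singleton.1 (Finsupp.support_single_subset hl')]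
      · rw [pathLoad_single]; exact hle _ hm a b
      · simp
    · push Not at hm
      set m := f e.1 e.2 with hmdef
      have hmpos : 0 < m := hlpos _ _ he
      have hnet : ∀ v, netOut (fun a b => f a b - m * arcLoad l a b) v
          = netOut f v - m * ((if v = s then 1 else 0) - (if v = t then 1 else 0)) := fun v => by
        rw [netOut_sub_mul, hl.netOut_arcLoad]
      have hpos' : ∀ a b, 0 < f a b - m * arcLoad l a b → 0 < f a b := fun a b h => by
        have := mul_nonneg hmpos.le (arcLoad_nonneg l a b)
        linarith
      obtain ⟨p, hp0, hp1, hp2, hp3⟩ := ih (fun a b => f a b - m * arcLoad l a b)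
        (fun a b => sub_nonneg.2 (hle m le_rfl a b))
        (fun a h1 h2 => by rw [hnet, hcons a h1 h2]; simp [h1, h2])
        (by rw [hnet]; simp [hst]; linarith)
        (by
          refine Nat.le_of_lt_succ (lt_of_lt_of_le (Finset.card_lt_card ?_) hcard)
          refine Finset.ssubset_iff_subset_ne.2 ⟨fun x hx => ?_, fun heq => ?_⟩
          · simp only [Finset.mem_filter, Finset.mem_univ, true_and] at hx ⊢
            exact hpos' _ _ hx
          · have h1 : e ∈ (Finset.univ.filter fun e : α × α => 0 < f e.1 e.2) := by
              simpa using hmpos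
            rw [← heq] at h1
            simp [arcLoad, he, ← hmdef] at h1)
      refine ⟨p + Finsupp.single l m, fun l' => ?_, fun l' hl' => ?_, fun a b => ?_, ?_⟩
      · rw [Finsupp.add_apply, Finsupp.single_apply]
        have := hp0 l'
        split_ifs <;> linarith
      · rcases Finset.mem_union.1 (Finsupp.support_add hl') with h | h
        · obtain ⟨h1, h2⟩ := hp1 l' h
          exact ⟨h1.imp fun a b => hpos' a b, h2⟩
        · rwa [Finset.mem_singleton.1 (Finsupp.support_single_subset h)]
      · rw [pathLoad_add, pathLoad_single]
        linarith [hp2 a b]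
      · rw [Finsupp.sum_add_index' (by simp) (by simp), hp3, hnet]
        simp [hst]

theorem IsMaxFlow.exists_isPathDecomposition {N : FlowNetwork α} {f : α → α → ℝ}
    (hf : N.IsMaxFlow f) (hst : N.source ≠ N.sink) : ∃ p, N.IsPathDecomposition f p := by
  obtain ⟨p, h0, h1, h2, h3⟩ := exists_pathDecomposition_aux hst _ f (fun a b => (hf.1.1 a b).1)
    (fun a h1 h2 => sub_eq_zero.2 (hf.1.2 a h1 h2)) hf.value_nonneg le_rfl
  refine ⟨p, h0, fun l hl => ?_, h2, h3⟩
  obtain ⟨h4, h5⟩ := h1 l hl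
  exact ⟨h4.imp fun a b h => h.trans_le (hf.1.1 a b).2, h5⟩

end FlowNetwork

/-! ### Two-terminal networks -/

section TwoTerminal

variable {V : Type u} [Fintype V] [DecidableEq V]

/-- The common shape of the forward and the backward network: the scaled graph `G`, a source
`Sum.inr σ` with arcs of capacity `cs i` into `G`, and a sink `Sum.inr !σ` with arcs of capacity
`ct i` out of `G`. -/
structure IsTwoTerminal (N : FlowNetwork (NetNode V)) (G : CapDigraph V) (κ : ℝ) (σ : Bool)
    (cs ct : V → ℝ) : Prop where
  source_eq : N.source = Sum.inr σ
  sink_eq : N.sink = Sum.inr !σ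
  cap_inner : ∀ i j, N.cap (Sum.inl i) (Sum.inl j) = κ * G.cap i j
  cap_source : ∀ i, N.cap (Sum.inr σ) (Sum.inl i) = cs i
  cap_sink : ∀ i, N.cap (Sum.inl i) (Sum.inr !σ) = ct i
  cap_into_source : ∀ i, N.cap (Sum.inl i) (Sum.inr σ) = 0
  cap_from_sink : ∀ i, N.cap (Sum.inr !σ) (Sum.inl i) = 0
  cap_terminals : ∀ τ τ', N.cap (Sum.inr τ) (Sum.inr τ') = 0

theorem isTwoTerminal_forward (G : CapDigraph V) (π : V → ℝ) (L R : Finset V) (β κ : ℝ) :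
    IsTwoTerminal (forwardNetwork G π L R β κ) G κ false
      (fun i => if i ∈ L then vertexWeight π R / vertexWeight π L * β * π i else 0)
      (fun j => if j ∈ R then β * π j else 0) := by
  constructor <;> simp [forwardNetwork]

theorem isTwoTerminal_backward (G : CapDigraph V) (π : V → ℝ) (L R : Finset V) (β κ : ℝ) :
    IsTwoTerminal (backwardNetwork G π L R β κ) G κ true
      (fun j => if j ∈ R then β * π j else 0)
      (fun i => if i ∈ L then vertexWeight π R / vertexWeight π L * β * π i else 0) := by
  constructor <;> simp [backwardNetwork]

namespace IsTwoTerminal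

variable {N : FlowNetwork (NetNode V)} {G : CapDigraph V} {κ : ℝ} {σ : Bool} {cs ct : V → ℝ}

theorem source_ne_sink (h : IsTwoTerminal N G κ σ cs ct) : N.source ≠ N.sink := by
  rw [h.source_eq, h.sink_eq]
  cases σ <;> simp

theorem cap_nonneg (h : IsTwoTerminal N G κ σ cs ct) (hκ : 0 ≤ κ) (hs : ∀ i, 0 ≤ cs i)
    (ht : ∀ i, 0 ≤ ct i) (a b : NetNode V) : 0 ≤ N.cap a b := by
  rcases a with i | τ <;> rcases b with j | τ'
  · rw [h.cap_inner]; exact mul_nonneg hκ (G.cap_nonneg i j)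
  · by_cases hτ : τ' = σ
    · rw [hτ, h.cap_into_source]
    · rw [Bool.eq_not_of_ne hτ, h.cap_sink]; exact ht i
  · by_cases hτ : τ = σ
    · rw [hτ, h.cap_source]; exact hs j
    · rw [Bool.eq_not_of_ne hτ, h.cap_from_sink]
  · rw [h.cap_terminals]

theorem value_eq_minCut (h : IsTwoTerminal N G κ σ cs ct) {f : NetNode V → NetNode V → ℝ}
    (hf : N.IsMaxFlow f) :
    N.value f = κ * outWeight G.cap (minCut N f) + ∑ i ∈ minCut N f, ct i
      + ∑ i ∈ (minCut N f)ᶜ, cs i := by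
  set S := minCut N f with hS
  have hmem : ∀ i, i ∈ S ↔ Relation.ReflTransGen (N.Residual f) N.source (Sum.inl i) := by
    simp [hS, minCut]
  have hsink := hf.not_reachable_sink h.source_ne_sink
  have hA : ∀ a, a ∈ S.disjSum {σ} ↔ Relation.ReflTransGen (N.Residual f) N.source a := by
    rintro (i | τ)
    · simp [hmem]
    · by_cases hτ : τ = σ
      · rw [hτ, h.source_eq]
        simp [Relation.ReflTransGen.refl]
      · rw [h.sink_eq, ← Bool.eq_not_of_ne hτ] at hsink
        simp [hτ, hsink]
  have hAc : (S.disjSum {σ})ᶜ = Sᶜ.disjSum {!σ} := by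
    ext (i | τ)
    · simp
    · cases τ <;> cases σ <;> simp
  rw [hf.value_eq_cut h.source_ne_sink _ hA, hAc]
  simp only [Finset.sum_disjSum, Finset.sum_singleton, h.cap_inner, h.cap_source, h.cap_sink,
    h.cap_terminals, Finset.sum_add_distrib, outWeight, Finset.mul_sum]
  ring

/-- A non-saturating maximum flow yields a cut of small expansion: the terminal arcs in the cut
formula have capacity `W` in total on each side, so the arcs of `G` in the cut have capacity less
than the terminal arcs that are not cut. -/
theorem cut_of_value_lt (h : IsTwoTerminal N G κ σ cs ct) {f : NetNode V → NetNode V → ℝ}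
    (hf : N.IsMaxFlow f) (hκ : 0 < κ) {π : V → ℝ} (hπ : ∀ i, 0 < π i) (hs : ∀ i, 0 ≤ cs i)
    (ht : ∀ i, 0 ≤ ct i) {c : ℝ} (hsc : ∀ i, cs i ≤ c * π i) (htc : ∀ i, ct i ≤ c * π i) {W : ℝ}
    (hsW : ∑ i, cs i = W) (htW : ∑ i, ct i = W) (hlt : N.value f < W) :
    (minCut N f).Nonempty ∧ minCut N f ≠ Finset.univ ∧
      setExpansion G.cap π (minCut N f) ≤ c / κ := by
  have hv := h.value_eq_minCut hf
  set S := minCut N f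
  have h1 := Finset.sum_add_sum_compl S cs
  have h2 := Finset.sum_add_sum_compl S ct
  have h3 : 0 ≤ ∑ i ∈ S, ct i := Finset.sum_nonneg fun i _ => ht i
  have h4 : 0 ≤ ∑ i ∈ Sᶜ, cs i := Finset.sum_nonneg fun i _ => hs i
  have h5 : 0 ≤ κ * outWeight G.cap S := mul_nonneg hκ.le
    (Finset.sum_nonneg fun i _ => Finset.sum_nonneg fun j _ => G.cap_nonneg i j)
  have h6 : ∑ i ∈ S, cs i ≤ c * vertexWeight π S := by
    rw [vertexWeight, Finset.mul_sum]; exact Finset.sum_le_sum fun i _ => hsc i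
  have h7 : ∑ i ∈ Sᶜ, ct i ≤ c * vertexWeight π Sᶜ := by
    rw [vertexWeight, Finset.mul_sum]; exact Finset.sum_le_sum fun i _ => htc i
  have hne : S.Nonempty := by
    by_contra hcon
    rw [Finset.not_nonempty_iff_eq_empty] at hcon
    rw [hcon] at hv h1 h3 h5
    simp only [Finset.sum_empty] at h1 hv
    linarith
  have hnu : S ≠ Finset.univ := by
    intro hcon
    rw [hcon, Finset.compl_univ, Finset.sum_empty] at h2
    rw [hcon] at hv h5
    simp only [Finset.compl_univ, Finset.sum_empty] at hv
    linarith
  have hnc : Sᶜ.Nonempty := by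
    rwa [Finset.nonempty_iff_ne_empty, Ne, Finset.compl_eq_empty_iff]
  refine ⟨hne, hnu, ?_⟩
  have hp1 : 0 < vertexWeight π S := Finset.sum_pos (fun i _ => hπ i) hne
  have hp2 : 0 < vertexWeight π Sᶜ := Finset.sum_pos (fun i _ => hπ i) hnc
  rw [setExpansion, div_le_div_iff₀ (lt_min hp1 hp2) hκ]
  refine (mul_le_mul_of_nonneg_right (min_le_left _ _) hκ.le).trans ?_
  rcases min_cases (vertexWeight π S) (vertexWeight π Sᶜ) with ⟨he, _⟩ | ⟨he, _⟩ <;> rw [he] <;>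
    linarith

/-! ### Demand graphs of saturating flows -/

/-- A source-sink path passes through a nonempty list of vertices of `G`. -/
theorem exists_inner (h : IsTwoTerminal N G κ σ cs ct) {l : List (NetNode V)}
    (hl : IsDirPath (fun a b => 0 < N.cap a b) N.source N.sink l) :
    ∃ m : List V, m ≠ [] ∧ l = Sum.inr σ :: (m.map Sum.inl ++ [Sum.inr !σ]) := by
  obtain ⟨hc, hnd, hh, ht⟩ := hl
  rw [h.source_eq] at hh
  rw [h.sink_eq] at ht
  cases l with
  | nil => simp at hh
  | cons x l =>
    simp only [List.head?_cons, Option.some.injEq] at hh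
    subst hh
    rcases List.eq_nil_or_concat l with rfl | ⟨l, y, rfl⟩
    · simp at ht
    · rw [List.concat_eq_append] at *
      rw [← List.cons_append, List.getLast?_append_of_ne_nil _ (by simp)] at ht
      simp only [List.getLast?_singleton, Option.some.injEq] at ht
      subst ht
      have hl : ∀ x ∈ l, ∃ i : V, Sum.inl i = x := by
        rintro (i | τ) hx
        · exact ⟨i, rfl⟩
        · exfalso
          by_cases hτ : τ = σ
          · subst hτ
            exact (List.nodup_cons.1 hnd).1 (List.mem_append_left _ hx)
          · rw [Bool.eq_not_of_ne hτ] at hx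
            exact (List.nodup_append.1 (List.nodup_cons.1 hnd).2).2.2 _ hx _ (by simp) rfl
      have hrange : l ∈ Set.range (List.map (Sum.inl : V → NetNode V)) := by
        rw [Set.range_list_map]
        exact fun x hx => hl x hx
      obtain ⟨m, rfl⟩ := hrange
      refine ⟨m, ?_, rfl⟩
      rintro rfl
      have := (List.isChain_cons_cons.1 hc).1
      rw [h.cap_terminals] at this
      exact lt_irrefl _ this

end IsTwoTerminal

/-- The vertices of `G` on a path in a network. -/
def innerPath (l : List (NetNode V)) : List V := l.filterMap Sum.getLeft?

theorem innerPath_eq (σ τ : Bool) (m : List V) :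
    innerPath (Sum.inr σ :: (m.map Sum.inl ++ [Sum.inr τ])) = m := by
  have h : ∀ m : List V, (m.map Sum.inl ++ [Sum.inr τ]).filterMap Sum.getLeft? = m := by
    intro m
    induction m with
    | nil => rfl
    | cons x m ih => exact congrArg (x :: ·) ih
  exact h m

section ArcLoads

variable {α : Type v} [DecidableEq α] {ι : V → α} {s t : α} {m : List V}

theorem arcLoad_map_append (hι : Function.Injective ι) (ht : ∀ i, ι i ≠ t) (m : List V)
    (a b : V) : arcLoad (m.map ι ++ [t]) (ι a) (ι b) = arcLoad m a b := by
  induction m with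
  | nil => simp [arcLoad]
  | cons x m ih =>
    cases m with
    | nil => simp [arcLoad, ht]
    | cons y m =>
      simp only [arcLoad, List.map_cons, List.cons_append, List.tail_cons, List.zip_cons_cons,
        List.mem_cons, Prod.mk.injEq, hι.eq_iff] at ih ⊢
      by_cases h : a = x ∧ b = y
      · simp [h]
      · by_cases h' : (a, b) ∈ (y :: m).zip m <;> simpa [h, h'] using ih

theorem arcLoad_inner (hι : Function.Injective ι) (hs : ∀ i, ι i ≠ s) (ht : ∀ i, ι i ≠ t)
    (hm : m ≠ []) (a b : V) :
    arcLoad (s :: (m.map ι ++ [t])) (ι a) (ι b) = arcLoad m a b := by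
  rw [← arcLoad_map_append hι ht m]
  cases m with
  | nil => exact absurd rfl hm
  | cons x m => simp [arcLoad, hs]

theorem arcLoad_source (hι : Function.Injective ι) (hs : ∀ i, ι i ≠ s) (hst : s ≠ t)
    (hm : m ≠ []) (i : V) :
    arcLoad (s :: (m.map ι ++ [t])) s (ι i) = if m.head? = some i then 1 else 0 := by
  cases m with
  | nil => exact absurd rfl hm
  | cons x m =>
    have h : (s, ι i) ∉ (ι x :: (m.map ι ++ [t])).zip (m.map ι ++ [t]) := fun h => by
      have := (List.of_mem_zip h).1
      simp [hst, (hs _).symm] at this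
      obtain ⟨a, -, ha⟩ := this
      exact hs a ha
    simp only [arcLoad, List.map_cons, List.cons_append, List.tail_cons, List.zip_cons_cons,
      List.mem_cons, h, or_false, Prod.mk.injEq, true_and, hι.eq_iff, List.head?_cons,
      Option.some.injEq, eq_comm]

theorem arcLoad_map_append_sink (hι : Function.Injective ι) (ht : ∀ i, ι i ≠ t) (m : List V)
    (j : V) : arcLoad (m.map ι ++ [t]) (ι j) t = if m.getLast? = some j then 1 else 0 := by
  induction m with
  | nil => simp [arcLoad]
  | cons x m ih =>
    cases m with
    | nil => simp [arcLoad, eq_comm, hι.eq_iff]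
    | cons y m =>
      simp only [arcLoad, List.map_cons, List.cons_append, List.tail_cons, List.zip_cons_cons,
        List.mem_cons, Prod.mk.injEq, (ht _).symm, and_false, false_or,
        List.getLast?_cons_cons] at ih ⊢
      exact ih

theorem arcLoad_sink (hι : Function.Injective ι) (hs : ∀ i, ι i ≠ s) (ht : ∀ i, ι i ≠ t)
    (hm : m ≠ []) (j : V) :
    arcLoad (s :: (m.map ι ++ [t])) (ι j) t = if m.getLast? = some j then 1 else 0 := by
  rw [← arcLoad_map_append_sink hι ht m]
  cases m with
  | nil => exact absurd rfl hm
  | cons x m => simp [arcLoad, hs]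

theorem ends_of_inner (hι : Function.Injective ι) (hm : m ≠ []) (i j : V) :
    ((s :: (m.map ι ++ [t])).tail.head? = some (ι i) ∧
      (s :: (m.map ι ++ [t])).dropLast.getLast? = some (ι j)) ↔
    (m.head? = some i ∧ m.getLast? = some j) := by
  have h1 : (s :: (m.map ι ++ [t])).dropLast = s :: m.map ι := by
    rw [← List.cons_append, List.dropLast_concat]
  rw [h1]
  cases m with
  | nil => exact absurd rfl hm
  | cons x m =>
    rw [List.map_cons, List.getLast?_cons_cons, ← List.map_cons, List.getLast?_map]
    simp [hι.eq_iff]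

end ArcLoads

theorem netDemand_nonneg {p : List (NetNode V) →₀ ℝ} (hp : ∀ l, 0 ≤ p l) (i j : V) :
    0 ≤ netDemand p i j :=
  Finset.sum_nonneg fun l _ => by
    dsimp only
    split_ifs
    exacts [hp l, le_rfl]

namespace IsTwoTerminal

variable {N : FlowNetwork (NetNode V)} {G : CapDigraph V} {κ : ℝ} {σ : Bool} {cs ct : V → ℝ}

theorem netDemand_eq (h : IsTwoTerminal N G κ σ cs ct) {f : NetNode V → NetNode V → ℝ}
    {p : List (NetNode V) →₀ ℝ} (hp : N.IsPathDecomposition f p) (i j : V) :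
    netDemand p i j = p.sum fun l x =>
      if (innerPath l).head? = some i ∧ (innerPath l).getLast? = some j then x else 0 := by
  refine Finsupp.sum_congr fun l hl => ?_
  obtain ⟨m, hm, rfl⟩ := h.exists_inner (hp.2.1 l hl)
  rw [innerPath_eq]
  simp only [ends_of_inner (ι := (Sum.inl : V → NetNode V)) Sum.inl_injective hm]

theorem sum_netDemand_right (h : IsTwoTerminal N G κ σ cs ct) {f : NetNode V → NetNode V → ℝ}
    {p : List (NetNode V) →₀ ℝ} (hp : N.IsPathDecomposition f p) (i : V) :
    ∑ j, netDemand p i j = pathLoad p (Sum.inr σ) (Sum.inl i) := by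
  simp only [h.netDemand_eq hp, pathLoad_eq_sum, Finsupp.sum]
  rw [Finset.sum_comm]
  refine Finset.sum_congr rfl fun l hl => ?_
  obtain ⟨m, hm, rfl⟩ := h.exists_inner (hp.2.1 l hl)
  rw [arcLoad_source Sum.inl_injective (by simp) (by simp) hm, innerPath_eq,
    List.getLast?_eq_some_getLast hm]
  by_cases h' : m.head? = some i <;> simp [h']

theorem sum_netDemand_left (h : IsTwoTerminal N G κ σ cs ct) {f : NetNode V → NetNode V → ℝ}
    {p : List (NetNode V) →₀ ℝ} (hp : N.IsPathDecomposition f p) (j : V) :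
    ∑ i, netDemand p i j = pathLoad p (Sum.inl j) (Sum.inr !σ) := by
  simp only [h.netDemand_eq hp, pathLoad_eq_sum, Finsupp.sum]
  rw [Finset.sum_comm]
  refine Finset.sum_congr rfl fun l hl => ?_
  obtain ⟨m, hm, rfl⟩ := h.exists_inner (hp.2.1 l hl)
  rw [arcLoad_sink Sum.inl_injective (by simp) (by simp) hm, innerPath_eq,
    List.head?_eq_some_head hm]
  by_cases h' : m.getLast? = some j <;> simp [h']

theorem sum_pathLoad_source (h : IsTwoTerminal N G κ σ cs ct) {f : NetNode V → NetNode V → ℝ}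
    {p : List (NetNode V) →₀ ℝ} (hp : N.IsPathDecomposition f p) :
    ∑ i, pathLoad p (Sum.inr σ) (Sum.inl i) = N.value f := by
  rw [← hp.2.2.2]
  simp only [pathLoad_eq_sum, Finsupp.sum]
  rw [Finset.sum_comm]
  refine Finset.sum_congr rfl fun l hl => ?_
  obtain ⟨m, hm, rfl⟩ := h.exists_inner (hp.2.1 l hl)
  simp [arcLoad_source (ι := (Sum.inl : V → NetNode V)) (s := Sum.inr σ) (t := Sum.inr !σ)
    Sum.inl_injective (by simp) (by simp) hm, List.head?_eq_some_head hm]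

theorem sum_pathLoad_sink (h : IsTwoTerminal N G κ σ cs ct) {f : NetNode V → NetNode V → ℝ}
    {p : List (NetNode V) →₀ ℝ} (hp : N.IsPathDecomposition f p) :
    ∑ i, pathLoad p (Sum.inl i) (Sum.inr !σ) = N.value f := by
  rw [← hp.2.2.2]
  simp only [pathLoad_eq_sum, Finsupp.sum]
  rw [Finset.sum_comm]
  refine Finset.sum_congr rfl fun l hl => ?_
  obtain ⟨m, hm, rfl⟩ := h.exists_inner (hp.2.1 l hl)
  simp [arcLoad_sink (ι := (Sum.inl : V → NetNode V)) (s := Sum.inr σ) (t := Sum.inr !σ)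
    Sum.inl_injective (by simp) (by simp) hm, List.getLast?_eq_some_getLast hm]

/-- If the capacities at the source add up to at most the value of the flow, then the demands of a
path decomposition saturate them. -/
theorem sum_netDemand_eq_source (h : IsTwoTerminal N G κ σ cs ct)
    {f : NetNode V → NetNode V → ℝ} (hf : N.IsFlow f) {p : List (NetNode V) →₀ ℝ}
    (hp : N.IsPathDecomposition f p) (hW : ∑ i, cs i ≤ N.value f) (i : V) :
    ∑ j, netDemand p i j = cs i := by
  have hle : ∀ i ∈ Finset.univ, pathLoad p (Sum.inr σ) (Sum.inl i) ≤ cs i := fun i _ =>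
    (hp.2.2.1 _ _).trans ((hf.1 _ _).2.trans_eq (h.cap_source i))
  rw [h.sum_netDemand_right hp]
  refine (Finset.sum_eq_sum_iff_of_le hle).1 (le_antisymm (Finset.sum_le_sum hle) ?_) i
    (Finset.mem_univ i)
  rw [h.sum_pathLoad_source hp]
  exact hW

theorem sum_netDemand_eq_sink (h : IsTwoTerminal N G κ σ cs ct)
    {f : NetNode V → NetNode V → ℝ} (hf : N.IsFlow f) {p : List (NetNode V) →₀ ℝ}
    (hp : N.IsPathDecomposition f p) (hW : ∑ i, ct i ≤ N.value f) (j : V) :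
    ∑ i, netDemand p i j = ct j := by
  have hle : ∀ i ∈ Finset.univ, pathLoad p (Sum.inl i) (Sum.inr !σ) ≤ ct i := fun i _ =>
    (hp.2.2.1 _ _).trans ((hf.1 _ _).2.trans_eq (h.cap_sink i))
  rw [h.sum_netDemand_left hp]
  refine (Finset.sum_eq_sum_iff_of_le hle).1 (le_antisymm (Finset.sum_le_sum hle) ?_) j
    (Finset.mem_univ j)
  rw [h.sum_pathLoad_sink hp]
  exact hW

theorem routes_netDemand (h : IsTwoTerminal N G κ σ cs ct) (hκ : 0 < κ)
    {f : NetNode V → NetNode V → ℝ} (hf : N.IsFlow f) {p : List (NetNode V) →₀ ℝ}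
    (hp : N.IsPathDecomposition f p) :
    Routes G κ (p.mapDomain innerPath) (netDemand p) := by
  refine ⟨fun l => ?_, fun m hm => ?_, fun a b => ?_, fun i j => ?_⟩
  · rw [Finsupp.mapDomain, Finsupp.sum_apply]
    refine Finset.sum_nonneg fun l' _ => ?_
    beta_reduce
    rw [Finsupp.single_apply]
    split_ifs
    exacts [hp.1 l', le_rfl]
  · obtain ⟨l, hl, rfl⟩ := Finset.mem_image.1 (Finsupp.mapDomain_support hm)
    have hpath := hp.2.1 l hl
    obtain ⟨m, hm0, rfl⟩ := h.exists_inner hpath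
    rw [innerPath_eq]
    obtain ⟨hc, hnd, -, -⟩ := hpath
    refine ⟨m.head hm0, m.getLast hm0, ?_, ?_, List.head?_eq_some_head hm0,
      List.getLast?_eq_some_getLast hm0⟩
    · have h1 := (List.isChain_append.1 hc.tail).1
      rw [List.isChain_map] at h1
      refine h1.imp fun a b hab => ?_
      rw [h.cap_inner] at hab
      exact pos_of_mul_pos_right hab hκ.le
    · exact List.Nodup.of_map _ (List.nodup_append.1 (List.nodup_cons.1 hnd).2).1
  · have h1 : pathLoad (p.mapDomain innerPath) a b = pathLoad p (Sum.inl a) (Sum.inl b) := by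
      rw [pathLoad_eq_sum, pathLoad_eq_sum,
        Finsupp.sum_mapDomain_index (by simp) (by intros; ring)]
      refine Finsupp.sum_congr fun l hl => ?_
      obtain ⟨m, hm, rfl⟩ := h.exists_inner (hp.2.1 l hl)
      rw [arcLoad_inner Sum.inl_injective (by simp) (by simp) hm, innerPath_eq]
    rw [h1, ← h.cap_inner]
    exact (hp.2.2.1 _ _).trans (hf.1 _ _).2
  · rw [h.netDemand_eq hp, pathDemand,
      Finsupp.sum_mapDomain_index (by simp) (by intros; split_ifs <;> simp)]

end IsTwoTerminal

end TwoTerminal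

/-! ### Path flows in `G` -/

section Routes

variable {V : Type u} [DecidableEq V] {G : CapDigraph V}

theorem pathLoad_smul (c : ℝ) (f : List V →₀ ℝ) (a b : V) :
    pathLoad (c • f) a b = c * pathLoad f a b := by
  rw [pathLoad_eq_sum, pathLoad_eq_sum, Finsupp.sum_smul_index (by simp), Finsupp.mul_sum]
  simp only [mul_assoc]

theorem pathDemand_smul (c : ℝ) (f : List V →₀ ℝ) (a b : V) :
    pathDemand (c • f) a b = c * pathDemand f a b := by
  rw [pathDemand, pathDemand, Finsupp.sum_smul_index (by simp), Finsupp.mul_sum]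
  simp only [mul_ite, mul_zero]

theorem pathDemand_add (f g : List V →₀ ℝ) (a b : V) :
    pathDemand (f + g) a b = pathDemand f a b + pathDemand g a b :=
  Finsupp.sum_add_index' (by simp) (by intros; split_ifs <;> simp)

theorem Routes.add {κ κ' : ℝ} {f g : List V →₀ ℝ} {D D' : V → V → ℝ} (h : Routes G κ f D)
    (h' : Routes G κ' g D') : Routes G (κ + κ') (f + g) (D + D') := by
  refine ⟨fun l => add_nonneg (h.1 l) (h'.1 l), fun l hl => ?_, fun a b => ?_, fun i j => ?_⟩
  · rcases Finset.mem_union.1 (Finsupp.support_add hl) with hl | hl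
    exacts [h.2.1 l hl, h'.2.1 l hl]
  · rw [pathLoad_add, add_mul]
    exact add_le_add (h.2.2.1 a b) (h'.2.2.1 a b)
  · rw [pathDemand_add, h.2.2.2, h'.2.2.2]
    rfl

theorem Routes.smul {κ : ℝ} {f : List V →₀ ℝ} {D : V → V → ℝ} (h : Routes G κ f D) {c : ℝ}
    (hc : 0 ≤ c) : Routes G (c * κ) (c • f) (c • D) := by
  refine ⟨fun l => mul_nonneg hc (h.1 l), fun l hl => h.2.1 l (Finsupp.support_smul hl),
    fun a b => ?_, fun i j => ?_⟩
  · rw [pathLoad_smul, mul_assoc]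
    exact mul_le_mul_of_nonneg_left (h.2.2.1 a b) hc
  · rw [pathDemand_smul, h.2.2.2]
    rfl

theorem exists_routes_sum {κ : ℝ} (hist : List (V → V → ℝ))
    (h : ∀ D ∈ hist, ∃ f, Routes G κ f D) : ∃ f, Routes G (hist.length * κ) f hist.sum := by
  induction hist with
  | nil => exact ⟨0, by simp, by simp, by simp [pathLoad], by simp [pathDemand]⟩
  | cons D hist ih =>
    obtain ⟨f, hf⟩ := h D (by simp)
    obtain ⟨g, hg⟩ := ih fun D' hD' => h D' (by simp [hD'])
    refine ⟨f + g, ?_⟩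
    have := hf.add hg
    rw [List.sum_cons, List.length_cons]
    convert this using 1
    push_cast
    ring

variable [Fintype V]

theorem Routes.isEulerian_pathLoad {κ : ℝ} {f : List V →₀ ℝ} {D : V → V → ℝ}
    (h : Routes G κ f D) (hD : IsEulerian D) : IsEulerian (pathLoad f) := by
  refine ⟨fun a b => ?_, fun v => ?_⟩
  · rw [pathLoad_eq_sum]
    exact Finset.sum_nonneg fun l _ => mul_nonneg (h.1 l) (arcLoad_nonneg l a b)
  · have h1 : ∑ j, pathLoad f v j - ∑ j, pathLoad f j v
        = ∑ j, pathDemand f v j - ∑ j, pathDemand f j v := by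
      simp only [pathLoad_eq_sum, pathDemand, Finsupp.sum]
      rw [Finset.sum_comm, Finset.sum_comm (s := Finset.univ), Finset.sum_comm (s := Finset.univ),
        Finset.sum_comm (s := Finset.univ), ← Finset.sum_sub_distrib, ← Finset.sum_sub_distrib]
      refine Finset.sum_congr rfl fun l hl => ?_
      obtain ⟨a, b, hp⟩ := h.2.1 l hl
      have h2 := hp.netOut_arcLoad v
      rw [FlowNetwork.netOut] at h2
      rw [← Finset.mul_sum, ← Finset.mul_sum, ← mul_sub, h2, hp.2.2.1, hp.2.2.2]
      have e1 : (∑ j, if some a = some v ∧ some b = some j then f l else 0)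
          = f l * if v = a then 1 else 0 := by
        by_cases ha : v = a
        · simp [ha]
        · simp [ha, Ne.symm ha]
      have e2 : (∑ j, if some a = some j ∧ some b = some v then f l else 0)
          = f l * if v = b then 1 else 0 := by
        by_cases hb : v = b
        · simp [hb]
        · simp [hb, Ne.symm hb]
      rw [e1, e2, mul_sub]
    simp only [h.2.2.2, hD.2 v, sub_self] at h1
    linarith

end Routes

/-! ### One round of the matching player -/

section Round

variable {V : Type u} [Fintype V] [DecidableEq V]

/-- The total degree of the vertex `i` in the demand graph played for the bipartition `L`, `Lᶜ`. -/
noncomputable def matchDegree (π : V → ℝ) (L : Finset V) (i : V) : ℝ :=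
  if i ∈ L then vertexWeight π Lᶜ / vertexWeight π L * π i else π i

/-- The demand graphs that can be played for the bipartition `L`, `Lᶜ`: Eulerian graphs with
prescribed degrees all of whose arcs cross the bipartition. -/
structure IsMatchingDemand (π : V → ℝ) (L : Finset V) (D : V → V → ℝ) : Prop where
  nonneg : ∀ i j, 0 ≤ D i j
  sum_out : ∀ i, ∑ j, D i j = matchDegree π L i / 2
  sum_in : ∀ j, ∑ i, D i j = matchDegree π L j / 2
  crossing : ∀ i j, D i j ≠ 0 → (i ∈ L ↔ j ∉ L)

theorem vertexWeight_pos {π : V → ℝ} (hπ : ∀ i, 0 < π i) {S : Finset V} (hS : S.Nonempty) :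
    0 < vertexWeight π S :=
  Finset.sum_pos (fun i _ => hπ i) hS

theorem vertexWeight_nonneg {π : V → ℝ} (hπ : ∀ i, 0 < π i) (S : Finset V) :
    0 ≤ vertexWeight π S :=
  Finset.sum_nonneg fun i _ => (hπ i).le

theorem vertexWeight_add_compl (π : V → ℝ) (S : Finset V) :
    vertexWeight π S + vertexWeight π Sᶜ = vertexWeight π Finset.univ :=
  Finset.sum_add_sum_compl S π

/-- The part of a bidirectional round that does not depend on the cut player. -/
noncomputable def matchingRound (sub : Subroutines V) (G : CapDigraph V) (π : V → ℝ) (κ : ℝ)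
    (L : Finset V) : FlowProg V (CMOutput V) :=
  (bidirectionalMaxFlow G π L Lᶜ 1 κ).bind fun
    | .inl S => .ret (.cut S)
    | .inr (f, g) => .ret <| .demand fun i j =>
        (netDemand (sub.decompose (forwardNetwork G π L Lᶜ 1 κ) f) i j +
          netDemand (sub.decompose (backwardNetwork G π L Lᶜ 1 κ) g) i j) / 2

theorem cmRound_eq (sub : Subroutines V) (G : CapDigraph V) (π : V → ℝ) (κ : ℝ)
    (hist : List (V → V → ℝ)) (u : V → ℝ) :
    cmRound sub G π κ hist u
      = matchingRound sub G π κ (cutPlayer π (1 / 4) 4 sub.gram hist u) := rfl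

theorem exists_netDemand (sub : Subroutines V) {N : FlowNetwork (NetNode V)} {G : CapDigraph V}
    {κ : ℝ} {σ : Bool} {cs ct : V → ℝ} (h : IsTwoTerminal N G κ σ cs ct) (hκ : 0 < κ)
    (hN : N.IsMaxFlow (sub.solve N)) {W : ℝ} (hsW : ∑ i, cs i = W) (htW : ∑ i, ct i = W)
    (hW : W ≤ N.value (sub.solve N)) {D : V → V → ℝ}
    (hD : D = netDemand (sub.decompose N (sub.solve N))) :
    (∀ i j, 0 ≤ D i j) ∧ (∀ i, ∑ j, D i j = cs i) ∧ (∀ j, ∑ i, D i j = ct j) ∧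
      (∀ i j, D i j ≠ 0 → cs i ≠ 0 ∧ ct j ≠ 0) ∧ ∃ f, Routes G κ f D := by
  obtain ⟨p, hp⟩ := hN.exists_isPathDecomposition h.source_ne_sink
  have hp := sub.decompose_spec _ _ _ hp
  subst hD
  have h0 := netDemand_nonneg hp.1
  have h1 := h.sum_netDemand_eq_source hN.1 hp (hsW.trans_le hW)
  have h2 := h.sum_netDemand_eq_sink hN.1 hp (htW.trans_le hW)
  refine ⟨h0, h1, h2, fun i j hij => ⟨fun hc => hij ?_, fun hc => hij ?_⟩, _,
    h.routes_netDemand hκ hN.1 hp⟩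
  · have := h1 i
    rw [hc, Finset.sum_eq_zero_iff_of_nonneg fun j _ => h0 i j] at this
    exact this j (Finset.mem_univ j)
  · have := h2 j
    rw [hc, Finset.sum_eq_zero_iff_of_nonneg fun i _ => h0 i j] at this
    exact this i (Finset.mem_univ i)

variable {sub : Subroutines V} {G : CapDigraph V} {π : V → ℝ} {κ : ℝ} {L : Finset V}

theorem matchingRound_spec (hκ : 0 < κ) (hπ : ∀ i, 0 < π i) (hL : L.Nonempty)
    (hR : vertexWeight π Lᶜ ≤ 3 * vertexWeight π L) :
    (∀ S, (matchingRound sub G π κ L).eval sub.solve = .cut S →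
      S.Nonempty ∧ S ≠ Finset.univ ∧ setExpansion G.cap π S ≤ 3 / κ) ∧
    (∀ D, (matchingRound sub G π κ L).eval sub.solve = .demand D →
      IsMatchingDemand π L D ∧ ∃ f, Routes G κ f D) := by
  set W := vertexWeight π Lᶜ with hW
  set r := W / vertexWeight π L with hr
  have hLpos := vertexWeight_pos hπ hL
  have hr0 : 0 ≤ r := div_nonneg (vertexWeight_nonneg hπ _) hLpos.le
  have hr3 : r ≤ 3 := by rw [hr, div_le_iff₀ hLpos]; exact hR
  have hrL : r * vertexWeight π L = W := div_mul_cancel₀ _ hLpos.ne'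
  set a : V → ℝ := fun i => if i ∈ L then r * 1 * π i else 0 with ha
  set b : V → ℝ := fun j => if j ∈ Lᶜ then 1 * π j else 0 with hb
  have hF : IsTwoTerminal (forwardNetwork G π L Lᶜ 1 κ) G κ false a b :=
    isTwoTerminal_forward G π L Lᶜ 1 κ
  have hB : IsTwoTerminal (backwardNetwork G π L Lᶜ 1 κ) G κ true b a :=
    isTwoTerminal_backward G π L Lᶜ 1 κ
  have ha0 : ∀ i, 0 ≤ a i := fun i => by
    simp only [ha, mul_one]; split_ifs; exacts [mul_nonneg hr0 (hπ i).le, le_rfl]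
  have hb0 : ∀ i, 0 ≤ b i := fun i => by
    simp only [hb, one_mul]; split_ifs; exacts [(hπ i).le, le_rfl]
  have ha3 : ∀ i, a i ≤ 3 * π i := fun i => by
    have := hπ i
    simp only [ha, mul_one]; split_ifs
    exacts [mul_le_mul_of_nonneg_right hr3 (hπ i).le, by linarith]
  have hb3 : ∀ i, b i ≤ 3 * π i := fun i => by
    have := hπ i
    simp only [hb, one_mul]; split_ifs <;> linarith
  have haW : ∑ i, a i = W := by
    rw [← hrL]
    simp only [ha, mul_one, vertexWeight, Finset.mul_sum, Finset.sum_ite_mem, Finset.univ_inter]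
  have hbW : ∑ i, b i = W := by
    simp only [hb, one_mul, hW, vertexWeight, Finset.sum_ite_mem, Finset.univ_inter]
  have hab : ∀ i, a i + b i = matchDegree π L i := fun i => by
    by_cases hi : i ∈ L <;> simp [ha, hb, matchDegree, hi, hr, hW]
  obtain ⟨f, hf⟩ := FlowNetwork.exists_isMaxFlow _ (hF.cap_nonneg hκ.le ha0 hb0)
  have hf := sub.solve_spec _ _ hf
  obtain ⟨g, hg⟩ := FlowNetwork.exists_isMaxFlow _ (hB.cap_nonneg hκ.le hb0 ha0)
  have hg := sub.solve_spec _ _ hg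
  have heval : (matchingRound sub G π κ L).eval sub.solve =
      if (forwardNetwork G π L Lᶜ 1 κ).value (sub.solve (forwardNetwork G π L Lᶜ 1 κ)) < W then
        .cut (minCut (forwardNetwork G π L Lᶜ 1 κ) (sub.solve (forwardNetwork G π L Lᶜ 1 κ)))
      else if (backwardNetwork G π L Lᶜ 1 κ).value (sub.solve (backwardNetwork G π L Lᶜ 1 κ)) < W
        then .cut (minCut (backwardNetwork G π L Lᶜ 1 κ)
          (sub.solve (backwardNetwork G π L Lᶜ 1 κ)))
      else .demand fun i j =>
        (netDemand (sub.decompose (forwardNetwork G π L Lᶜ 1 κ)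
          (sub.solve (forwardNetwork G π L Lᶜ 1 κ))) i j +
        netDemand (sub.decompose (backwardNetwork G π L Lᶜ 1 κ)
          (sub.solve (backwardNetwork G π L Lᶜ 1 κ))) i j) / 2 := by
    simp only [matchingRound, bidirectionalMaxFlow, FlowProg.bind, FlowProg.eval, one_mul, ← hW]
    split_ifs <;> rfl
  rw [heval]
  clear heval
  split_ifs with h1 h2
  · refine ⟨fun S hS => ?_, fun D hD => by simp at hD⟩
    rw [← CMOutput.cut.inj hS]
    exact hF.cut_of_value_lt hf hκ hπ ha0 hb0 ha3 hb3 haW hbW h1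
  · refine ⟨fun S hS => ?_, fun D hD => by simp at hD⟩
    rw [← CMOutput.cut.inj hS]
    exact hB.cut_of_value_lt hg hκ hπ hb0 ha0 hb3 ha3 hbW haW h2
  · refine ⟨fun S hS => by simp at hS, fun D hD => ?_⟩
    rw [← CMOutput.demand.inj hD]
    push Not at h1 h2
    obtain ⟨p1, p2, p3, p4, f1, p5⟩ := exists_netDemand sub hF hκ hf haW hbW h1 rfl
    obtain ⟨q1, q2, q3, q4, f2, q5⟩ := exists_netDemand sub hB hκ hg hbW haW h2 rfl
    refine ⟨⟨fun i j => ?_, fun i => ?_, fun j => ?_, fun i j hij => ?_⟩, ?_⟩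
    · exact div_nonneg (add_nonneg (p1 i j) (q1 i j)) two_pos.le
    · rw [← Finset.sum_div, Finset.sum_add_distrib, p2, q2, hab]
    · rw [← Finset.sum_div, Finset.sum_add_distrib, p3, q3, add_comm, hab]
    · have hab' : ∀ k, (a k ≠ 0 → k ∈ L) ∧ (b k ≠ 0 → k ∉ L) := fun k => by
        by_cases hk : k ∈ L <;> simp [ha, hb, hk]
      have hor : netDemand (sub.decompose (forwardNetwork G π L Lᶜ 1 κ)
          (sub.solve (forwardNetwork G π L Lᶜ 1 κ))) i j ≠ 0 ∨
        netDemand (sub.decompose (backwardNetwork G π L Lᶜ 1 κ)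
          (sub.solve (backwardNetwork G π L Lᶜ 1 κ))) i j ≠ 0 := by
        by_contra hcon
        push Not at hcon
        exact hij (by simp [hcon.1, hcon.2])
      rcases hor with h | h
      · have h3 := p4 i j h
        exact iff_of_true ((hab' i).1 h3.1) ((hab' j).2 h3.2)
      · have h3 := q4 i j h
        exact iff_of_false ((hab' i).2 h3.1) (not_not.2 ((hab' j).1 h3.2))
    · refine ⟨(1 / 2 : ℝ) • (f1 + f2), ?_⟩
      have := (p5.add q5).smul (c := 1 / 2) (by norm_num)
      convert this using 1
      · ring
      · funext i j
        simp only [Pi.smul_apply, Pi.add_apply, smul_eq_mul]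
        ring

theorem IsMatchingDemand.isEulerian {D : V → V → ℝ} (h : IsMatchingDemand π L D) :
    IsEulerian D :=
  ⟨h.nonneg, fun i => by rw [h.sum_out, h.sum_in]⟩

theorem matchDegree_le (hπ : ∀ i, 0 < π i) (hL : L.Nonempty)
    (hR : vertexWeight π Lᶜ ≤ 3 * vertexWeight π L) (i : V) : matchDegree π L i ≤ 3 * π i := by
  have := hπ i
  unfold matchDegree
  split_ifs
  · refine mul_le_mul_of_nonneg_right ?_ this.le
    rwa [div_le_iff₀ (vertexWeight_pos hπ hL)]
  · linarith

/-! ### The bipartition chosen by the cut player -/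

theorem weightedMedian_mem [Nonempty V] (hπ : ∀ i, 0 < π i) (x : V → ℝ) :
    (∃ i, x i = weightedMedian π x) ∧ vertexWeight π Finset.univ / 2 ≤
      vertexWeight π (Finset.univ.filter fun j => x j ≤ weightedMedian π x) := by
  have hne : {y | (∃ i, x i = y) ∧ vertexWeight π Finset.univ / 2 ≤
      vertexWeight π (Finset.univ.filter fun j => x j ≤ y)}.Nonempty := by
    obtain ⟨i, hi⟩ := Finite.exists_max x
    refine ⟨x i, ⟨i, rfl⟩, ?_⟩
    rw [Finset.filter_true_of_mem fun j _ => hi j]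
    linarith [vertexWeight_nonneg hπ (Finset.univ : Finset V)]
  exact hne.csInf_mem ((Set.finite_range x).subset fun y hy => hy.1)

/-- The vertices strictly below the weighted median have less than half of the weight. -/
theorem vertexWeight_lt_weightedMedian [Nonempty V] (hπ : ∀ i, 0 < π i) (x : V → ℝ) :
    vertexWeight π (Finset.univ.filter fun j => x j < weightedMedian π x)
      < vertexWeight π Finset.univ / 2 := by
  by_contra hcon
  push Not at hcon
  have hpos := vertexWeight_pos hπ (Finset.univ_nonempty (α := V))
  have hne : (Finset.univ.filter fun j => x j < weightedMedian π x).Nonempty := by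
    by_contra h
    rw [Finset.not_nonempty_iff_eq_empty] at h
    have h0 : vertexWeight π (∅ : Finset V) = 0 := Finset.sum_empty
    rw [h, h0] at hcon
    linarith
  obtain ⟨i, hi, hmax⟩ := Finset.exists_max_image _ x hne
  have hlt : x i < weightedMedian π x := (Finset.mem_filter.1 hi).2
  refine absurd hlt (not_lt.2 (csInf_le
    ((Set.finite_range x).subset fun y hy => hy.1).bddBelow ⟨⟨i, rfl⟩, ?_⟩))
  refine hcon.trans (Finset.sum_le_sum_of_subset_of_nonneg (fun j hj => ?_) fun j _ _ => (hπ j).le)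
  simpa using hmax j hj

/-- The cut player's choice is one vertex of weight at least `π(V)/4`, or a lower median cut. -/
theorem cutPlayer_cases (gram : Matrix V V ℝ → V → V → ℝ) (η ρ : ℝ) (hist : List (V → V → ℝ))
    (u : V → ℝ) :
    (∃ i, vertexWeight π Finset.univ / 4 ≤ π i ∧ cutPlayer π η ρ gram hist u = {i}) ∨
    ((∀ i, π i < vertexWeight π Finset.univ / 4) ∧ ∀ x : V → ℝ, x = (fun i => dotProduct u
        (gram (invSqrtDiag π * density π η ρ hist * invSqrtDiag π) i)) →
      cutPlayer π η ρ gram hist u = Finset.univ.filter fun i => x i ≤ weightedMedian π x) := by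
  unfold cutPlayer
  split_ifs with h
  · exact Or.inl ⟨_, h.choose_spec, rfl⟩
  · push Not at h
    exact Or.inr ⟨h, fun x hx => by subst hx; rfl⟩

theorem cutPlayer_spec [Nonempty V] (hπ : ∀ i, 0 < π i) (gram : Matrix V V ℝ → V → V → ℝ)
    (η ρ : ℝ) (hist : List (V → V → ℝ)) (u : V → ℝ) :
    (cutPlayer π η ρ gram hist u).Nonempty ∧
    vertexWeight π (cutPlayer π η ρ gram hist u)ᶜ
      ≤ 3 * vertexWeight π (cutPlayer π η ρ gram hist u) := by
  have hadd := vertexWeight_add_compl π (cutPlayer π η ρ gram hist u)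
  rcases cutPlayer_cases (π := π) gram η ρ hist u with ⟨i, hi, he⟩ | ⟨-, he⟩
  · rw [he] at hadd ⊢
    refine ⟨by simp, ?_⟩
    simp only [vertexWeight, Finset.sum_singleton] at hadd hi ⊢
    linarith
  · have he := he _ rfl
    rw [he] at hadd ⊢
    obtain ⟨⟨i, hi⟩, h2⟩ := weightedMedian_mem hπ fun i => dotProduct u
      (gram (invSqrtDiag π * density π η ρ hist * invSqrtDiag π) i)
    refine ⟨⟨i, by simpa using hi.le⟩, ?_⟩
    have := vertexWeight_nonneg hπ (Finset.univ : Finset V)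
    linarith

end Round

/-! ### A trace inequality for matrix exponentials -/

section Spectral

open Matrix

variable {V : Type u} [Fintype V] [DecidableEq V]

/-- The matrix with eigenvalues `f` and the columns of `U` as eigenvectors. -/
def spectralMatrix (U : Matrix V V ℝ) (f : V → ℝ) : Matrix V V ℝ := U * diagonal f * Uᵀ

theorem exists_spectralMatrix {A : Matrix V V ℝ} (hA : A.IsHermitian) :
    ∃ U, Uᵀ * U = 1 ∧ U * Uᵀ = 1 ∧ A = spectralMatrix U hA.eigenvalues := by
  refine ⟨hA.eigenvectorUnitary, ?_, ?_, ?_⟩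
  · exact (Unitary.mem_iff.1 hA.eigenvectorUnitary.2).1
  · exact (Unitary.mem_iff.1 hA.eigenvectorUnitary.2).2
  · conv_lhs => rw [hA.spectral_theorem]
    rfl

section

variable {U W : Matrix V V ℝ}

theorem spectralMatrix_mul (hU : Uᵀ * U = 1) (f g : V → ℝ) :
    spectralMatrix U f * spectralMatrix U g = spectralMatrix U (f * g) := by
  have : U * diagonal f * Uᵀ * (U * diagonal g * Uᵀ)
      = U * diagonal f * (Uᵀ * U) * diagonal g * Uᵀ := by simp only [mul_assoc]
  rw [spectralMatrix, spectralMatrix, this, hU, mul_one, spectralMatrix, mul_assoc U,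
    diagonal_mul_diagonal]
  rfl

theorem spectralMatrix_one (hU : U * Uᵀ = 1) : spectralMatrix U 1 = 1 := by
  rw [spectralMatrix, show (1 : V → ℝ) = fun _ => 1 from rfl, diagonal_one, mul_one, hU]

theorem exp_spectralMatrix (hU : U * Uᵀ = 1) (f : V → ℝ) :
    NormedSpace.exp (spectralMatrix U f) = spectralMatrix U fun i => Real.exp (f i) := by
  have hinv : U⁻¹ = Uᵀ := inv_eq_right_inv hU
  have hunit : IsUnit U := (isUnit_iff_exists_inv).2 ⟨Uᵀ, hU⟩
  rw [spectralMatrix, ← hinv, exp_conj U _ hunit, exp_diagonal, hinv, spectralMatrix]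
  congr 3
  funext i
  rw [Pi.coe_exp, Real.exp_eq_exp_ℝ]

theorem exp_neg_spectralMatrix (hU : U * Uᵀ = 1) (f : V → ℝ) :
    NormedSpace.exp (-spectralMatrix U f) = spectralMatrix U fun i => Real.exp (-f i) := by
  have : -spectralMatrix U f = spectralMatrix U (-f) := by
    rw [spectralMatrix, spectralMatrix, show diagonal (-f) = -diagonal f from (diagonal_neg f).symm,
      mul_neg, neg_mul]
  rw [this, exp_spectralMatrix hU]
  rfl

theorem dotProduct_spectralMatrix_mulVec (f x : V → ℝ) :
    x ⬝ᵥ spectralMatrix U f *ᵥ x = ∑ i, f i * (Uᵀ *ᵥ x) i ^ 2 := by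
  rw [spectralMatrix, ← mulVec_mulVec, ← mulVec_mulVec, dotProduct_mulVec, ← mulVec_transpose]
  simp only [dotProduct, mulVec_diagonal]
  exact Finset.sum_congr rfl fun i _ => by ring

theorem sum_sq_transpose_mulVec (hU : U * Uᵀ = 1) (x : V → ℝ) :
    ∑ i, (Uᵀ *ᵥ x) i ^ 2 = x ⬝ᵥ x := by
  have := dotProduct_spectralMatrix_mulVec (U := U) 1 x
  rw [spectralMatrix_one hU, one_mulVec] at this
  simpa using this.symm

theorem posSemidef_spectralMatrix {f : V → ℝ} (hf : ∀ i, 0 ≤ f i) :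
    (spectralMatrix U f).PosSemidef :=
  (PosSemidef.diagonal hf).mul_mul_conjTranspose_same U

theorem trace_spectralMatrix (hU : Uᵀ * U = 1) (f : V → ℝ) :
    (spectralMatrix U f).trace = ∑ i, f i := by
  rw [spectralMatrix, trace_mul_cycle, hU, one_mul, trace_diagonal]

theorem trace_spectralMatrix_mul (f g : V → ℝ) :
    (spectralMatrix U f * spectralMatrix W g).trace
      = ∑ i, ∑ j, f i * g j * (Uᵀ * W) i j ^ 2 := by
  have : U * diagonal f * Uᵀ * (W * diagonal g * Wᵀ)
      = U * (diagonal f * (Uᵀ * W) * diagonal g * Wᵀ) := by simp only [mul_assoc]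
  rw [spectralMatrix, spectralMatrix, this, trace_mul_comm, mul_assoc _ Wᵀ U,
    show Wᵀ * U = (Uᵀ * W)ᵀ by simp]
  simp only [trace, diag_apply, mul_apply (N := (Uᵀ * W)ᵀ), mul_diagonal, diagonal_mul,
    transpose_apply]
  exact Finset.sum_congr rfl fun i _ => Finset.sum_congr rfl fun j _ => by ring

end

theorem trace_mul_nonneg {P Q : Matrix V V ℝ} (hP : P.PosSemidef) (hQ : Q.PosSemidef) :
    0 ≤ (P * Q).trace := by
  obtain ⟨U, -, -, hU⟩ := exists_spectralMatrix hP.isHermitian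
  obtain ⟨W, -, -, hW⟩ := exists_spectralMatrix hQ.isHermitian
  rw [hU, hW, trace_spectralMatrix_mul]
  exact Finset.sum_nonneg fun i _ => Finset.sum_nonneg fun j _ =>
    mul_nonneg (mul_nonneg (hP.eigenvalues_nonneg i) (hQ.eigenvalues_nonneg j)) (sq_nonneg _)

theorem posSemidef_exp_neg {A : Matrix V V ℝ} (hA : A.IsHermitian) :
    (NormedSpace.exp (-A)).PosSemidef := by
  obtain ⟨U, -, hU, hAU⟩ := exists_spectralMatrix hA
  rw [hAU, exp_neg_spectralMatrix hU]
  exact posSemidef_spectralMatrix fun i => (Real.exp_pos _).le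

/-- If `0 ≤ N ≤ ν` then `Tr (N² Q) ≤ ν Tr (N Q)` for `Q ≥ 0`. -/
theorem trace_sq_mul_le {N Q : Matrix V V ℝ} {ν : ℝ} (hν : 0 < ν) (hN : N.PosSemidef)
    (hNν : (ν • (1 : Matrix V V ℝ) - N).PosSemidef) (hQ : Q.PosSemidef) :
    (N * N * Q).trace ≤ ν * (N * Q).trace := by
  set M := ν • (1 : Matrix V V ℝ) - N with hM
  have h1 : (M * N * M + N * M * N).PosSemidef := by
    refine PosSemidef.add ?_ ?_
    · have := hN.mul_mul_conjTranspose_same M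
      rwa [hNν.isHermitian.eq] at this
    · have := hNν.mul_mul_conjTranspose_same N
      rwa [hN.isHermitian.eq] at this
  have h2 : M * N * M + N * M * N = ν • (ν • N - N * N) := by
    have h3 : M * N = N * M := by simp [hM, sub_mul, mul_sub]
    rw [h3, ← mul_add, hM, sub_add_cancel]
    simp [mul_sub]
  have h4 := trace_mul_nonneg h1 hQ
  rw [h2, smul_mul_assoc, trace_smul, sub_mul, trace_sub, smul_mul_assoc, trace_smul] at h4
  have := nonneg_of_mul_nonneg_right h4 hν
  rw [smul_eq_mul] at this
  linarith

/-- A trapezoidal estimate for `exp`, in the two-variable form that is summed over pairs of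
eigenvalues. -/
theorem exp_neg_trapezoid (a b : ℝ) :
    (b - a) * (Real.exp (-a) + Real.exp (-b)) / 2
      - (b - a) ^ 2 * (Real.exp (-a) + Real.exp (-b)) / 2 ≤ Real.exp (-a) - Real.exp (-b) := by
  have key : ∀ h : ℝ, 1 + h / 2 - h ^ 2 / 2 ≤ Real.exp h * (1 - h / 2 + h ^ 2 / 2) := by
    intro h
    have h0 : 0 < 1 - h / 2 + h ^ 2 / 2 := by nlinarith [sq_nonneg (h - 1)]
    rcases le_or_gt (-1) h with hh | hh
    · have h1 := mul_le_mul_of_nonneg_right (Real.add_one_le_exp h) h0.le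
      nlinarith [mul_nonneg (sq_nonneg h) (by linarith : 0 ≤ 1 + h)]
    · have h1 : 0 < Real.exp h * (1 - h / 2 + h ^ 2 / 2) := mul_pos (Real.exp_pos h) h0
      nlinarith
  have h1 := key (b - a)
  have h2 : Real.exp (-a) = Real.exp (-b) * Real.exp (b - a) := by
    rw [← Real.exp_add]; congr 1; ring
  rw [h2]
  have h3 := mul_le_mul_of_nonneg_left h1 (Real.exp_pos (-b)).le
  nlinarith

/-- The one-step estimate behind the matrix multiplicative weight method. In the joint eigenbasis
of `A` and `A + N`, every trace is a sum over pairs of eigenvalues with the same nonnegative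
weights, so that a scalar inequality suffices. -/
theorem trace_exp_neg_add_le {A N : Matrix V V ℝ} {ν : ℝ} (hν : 0 < ν) (hν1 : ν ≤ 1)
    (hA : A.IsHermitian) (hN : N.PosSemidef) (hNν : (ν • (1 : Matrix V V ℝ) - N).PosSemidef) :
    (NormedSpace.exp (-(A + N))).trace
      ≤ (NormedSpace.exp (-A)).trace - (1 - ν) / 2 * (N * NormedSpace.exp (-A)).trace := by
  have hB : (A + N).IsHermitian := hA.add hN.isHermitian
  have hE := posSemidef_exp_neg hA
  have hF := posSemidef_exp_neg hB
  have hNE := trace_mul_nonneg hN hE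
  have hNF := trace_mul_nonneg hN hF
  have hsE := trace_sq_mul_le hν hN hNν hE
  have hsF := trace_sq_mul_le hν hN hNν hF
  set E := NormedSpace.exp (-A) with hEdef
  set F := NormedSpace.exp (-(A + N)) with hFdef
  set B := A + N with hBdef
  have hNBA : N = B - A := by rw [hBdef]; abel
  obtain ⟨U, hU1, hU2, hAU⟩ := exists_spectralMatrix hA
  obtain ⟨W, hW1, hW2, hBW⟩ := exists_spectralMatrix hB
  set a := hA.eigenvalues
  set b := hB.eigenvalues
  have hEU : E = spectralMatrix U fun i => Real.exp (-a i) := by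
    rw [hEdef, hAU, exp_neg_spectralMatrix hU2]
  have hFW : F = spectralMatrix W fun j => Real.exp (-b j) := by
    rw [hFdef, hBW, exp_neg_spectralMatrix hW2]
  have hAE : A * E = E * A := by
    rw [hEU, hAU, spectralMatrix_mul hU1, spectralMatrix_mul hU1, mul_comm]
  have hBF : B * F = F * B := by
    rw [hFW, hBW, spectralMatrix_mul hW1, spectralMatrix_mul hW1, mul_comm]
  set p : V → V → ℝ := fun i j => (Uᵀ * W) i j ^ 2 with hp
  have tE : E.trace = ∑ i, ∑ j, Real.exp (-a i) * p i j := by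
    rw [← mul_one E, ← spectralMatrix_one hW2, hEU, trace_spectralMatrix_mul]
    simp [hp]
  have tF : F.trace = ∑ i, ∑ j, Real.exp (-b j) * p i j := by
    rw [← one_mul F, ← spectralMatrix_one hU2, hFW, trace_spectralMatrix_mul]
    simp [hp]
  have tNE : (N * E).trace = ∑ i, ∑ j, (b j - a i) * Real.exp (-a i) * p i j := by
    have e1 : (N * E).trace = (E * B).trace - ((E * A) * 1).trace := by
      rw [hNBA, sub_mul, trace_sub, trace_mul_comm B E, hAE, mul_one]
    rw [e1, ← spectralMatrix_one hW2, hEU, hAU, hBW, spectralMatrix_mul hU1,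
      trace_spectralMatrix_mul, trace_spectralMatrix_mul]
    simp only [← Finset.sum_sub_distrib, hp, Pi.mul_apply, Pi.one_apply]
    exact Finset.sum_congr rfl fun i _ => Finset.sum_congr rfl fun j _ => by ring
  have tNF : (N * F).trace = ∑ i, ∑ j, (b j - a i) * Real.exp (-b j) * p i j := by
    have e1 : (N * F).trace = (1 * (B * F)).trace - (A * F).trace := by
      rw [hNBA, sub_mul, trace_sub, one_mul]
    rw [e1, ← spectralMatrix_one hU2, hFW, hAU, hBW, spectralMatrix_mul hW1,
      trace_spectralMatrix_mul, trace_spectralMatrix_mul]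
    simp only [← Finset.sum_sub_distrib, hp, Pi.mul_apply, Pi.one_apply]
    exact Finset.sum_congr rfl fun i _ => Finset.sum_congr rfl fun j _ => by ring
  have tsE : (N * N * E).trace = ∑ i, ∑ j, (b j - a i) ^ 2 * Real.exp (-a i) * p i j := by
    have e1 : (N * N * E).trace = (E * (B * B)).trace - (A * E * B).trace - (E * A * B).trace
        + ((A * E * A) * 1).trace := by
      have e2 : N * N * E = B * B * E - B * (A * E) - A * B * E + A * (A * E) := by
        rw [hNBA]; noncomm_ring
      rw [e2, trace_add, trace_sub, trace_sub, trace_mul_comm (B * B), trace_mul_comm B (A * E),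
        trace_mul_cycle A B E, mul_one, trace_mul_comm A (A * E)]
    rw [e1, ← spectralMatrix_one hW2, hEU, hAU, hBW, spectralMatrix_mul hU1,
      spectralMatrix_mul hU1, spectralMatrix_mul hU1, spectralMatrix_mul hW1,
      trace_spectralMatrix_mul, trace_spectralMatrix_mul, trace_spectralMatrix_mul,
      trace_spectralMatrix_mul]
    simp only [← Finset.sum_sub_distrib, ← Finset.sum_add_distrib, hp, Pi.mul_apply, Pi.one_apply]
    exact Finset.sum_congr rfl fun i _ => Finset.sum_congr rfl fun j _ => by ring
  have tsF : (N * N * F).trace = ∑ i, ∑ j, (b j - a i) ^ 2 * Real.exp (-b j) * p i j := by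
    have e1 : (N * N * F).trace = (1 * (B * F * B)).trace - (A * (F * B)).trace
        - (A * (B * F)).trace + (A * A * F).trace := by
      have e2 : N * N * F = B * (B * F) - B * (A * F) - A * (B * F) + A * A * F := by
        rw [hNBA]; noncomm_ring
      rw [e2, trace_add, trace_sub, trace_sub, one_mul, trace_mul_comm B (B * F),
        trace_mul_comm B (A * F), mul_assoc A F B]
    rw [e1, ← spectralMatrix_one hU2, hFW, hAU, hBW, spectralMatrix_mul hW1,
      spectralMatrix_mul hW1, spectralMatrix_mul hW1, spectralMatrix_mul hU1,
      trace_spectralMatrix_mul, trace_spectralMatrix_mul, trace_spectralMatrix_mul,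
      trace_spectralMatrix_mul]
    simp only [← Finset.sum_sub_distrib, ← Finset.sum_add_distrib, hp, Pi.mul_apply, Pi.one_apply]
    exact Finset.sum_congr rfl fun i _ => Finset.sum_congr rfl fun j _ => by ring
  have key : ((N * E).trace + (N * F).trace) / 2 - ((N * N * E).trace + (N * N * F).trace) / 2
      ≤ E.trace - F.trace := by
    rw [tE, tF, tNE, tNF, tsE, tsF]
    simp only [← Finset.sum_sub_distrib, ← Finset.sum_add_distrib, Finset.sum_div]
    refine Finset.sum_le_sum fun i _ => Finset.sum_le_sum fun j _ => ?_
    have := mul_le_mul_of_nonneg_right (exp_neg_trapezoid (a i) (b j)) (sq_nonneg ((Uᵀ * W) i j))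
    simp only [hp]
    linarith
  have := mul_nonneg (sub_nonneg.2 hν1) hNF
  linarith

/-- Jensen's inequality for a quadratic form of a matrix exponential. -/
theorem exp_neg_quadratic_le {A : Matrix V V ℝ} (hA : A.IsHermitian) (x : V → ℝ) {m : ℝ}
    (hm : x ⬝ᵥ A *ᵥ x = m * (x ⬝ᵥ x)) :
    Real.exp (-m) * (x ⬝ᵥ x) ≤ x ⬝ᵥ NormedSpace.exp (-A) *ᵥ x := by
  obtain ⟨U, -, hU, hAU⟩ := exists_spectralMatrix hA
  set a := hA.eigenvalues
  rw [hAU, dotProduct_spectralMatrix_mulVec] at hm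
  rw [hAU, exp_neg_spectralMatrix hU, dotProduct_spectralMatrix_mulVec]
  have h1 := sum_sq_transpose_mulVec hU x
  have h2 : Real.exp (-m) * (x ⬝ᵥ x)
      = ∑ i, Real.exp (-m) * (1 + m - a i) * (Uᵀ *ᵥ x) i ^ 2 := by
    have : ∀ i, Real.exp (-m) * (1 + m - a i) * (Uᵀ *ᵥ x) i ^ 2 = Real.exp (-m) * (1 + m) *
        (Uᵀ *ᵥ x) i ^ 2 - Real.exp (-m) * (a i * (Uᵀ *ᵥ x) i ^ 2) := fun i => by ring
    simp only [this, Finset.sum_sub_distrib, ← Finset.mul_sum, h1, hm]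
    ring
  rw [h2]
  refine Finset.sum_le_sum fun i _ => mul_le_mul_of_nonneg_right ?_ (sq_nonneg _)
  have h3 : Real.exp (-a i) = Real.exp (-m) * Real.exp (m - a i) := by
    rw [← Real.exp_add]; congr 1; ring
  rw [h3]
  refine mul_le_mul_of_nonneg_left ?_ (Real.exp_pos _).le
  have := Real.add_one_le_exp (m - a i)
  linarith

theorem quadratic_le_trace {M : Matrix V V ℝ} (hM : M.PosSemidef) (x : V → ℝ) :
    x ⬝ᵥ M *ᵥ x ≤ M.trace * (x ⬝ᵥ x) := by
  obtain ⟨U, hU1, hU, hMU⟩ := exists_spectralMatrix hM.isHermitian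
  have h0 := hM.eigenvalues_nonneg
  set a := hM.isHermitian.eigenvalues
  rw [hMU, dotProduct_spectralMatrix_mulVec, trace_spectralMatrix hU1,
    ← sum_sq_transpose_mulVec hU, Finset.mul_sum]
  exact Finset.sum_le_sum fun i _ => mul_le_mul_of_nonneg_right
    (Finset.single_le_sum (fun j _ => h0 j) (Finset.mem_univ i)) (sq_nonneg _)

theorem exp_neg_mul_of_mul_eq_zero {A Z : Matrix V V ℝ} (hA : A.IsHermitian) (h : A * Z = 0) :
    NormedSpace.exp (-A) * Z = Z := by
  obtain ⟨U, hU1, hU, hAU⟩ := exists_spectralMatrix hA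
  set a := hA.eigenvalues
  have h1 : diagonal a * (Uᵀ * Z) = 0 := by
    have : Uᵀ * (A * Z) = (Uᵀ * U) * (diagonal a * (Uᵀ * Z)) := by
      rw [hAU, spectralMatrix]; simp only [mul_assoc]
    rw [h, hU1, one_mul, mul_zero] at this
    exact this.symm
  have h2 : diagonal (fun i => Real.exp (-a i)) * (Uᵀ * Z) = Uᵀ * Z := by
    ext i j
    have h3 := congrFun (congrFun h1 i) j
    rw [diagonal_mul] at h3 ⊢
    rcases mul_eq_zero.1 h3 with h4 | h4
    · simp [h4]
    · simp [h4]
  rw [hAU, exp_neg_spectralMatrix hU, spectralMatrix, mul_assoc, mul_assoc, h2, ← mul_assoc, hU,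
    one_mul]

end Spectral

/-! ### Feedback matrices -/

section Feedback

open Matrix

variable {V : Type u} [Fintype V] [DecidableEq V]

/-- Demand graphs in which the total degree of every vertex is at most three times its weight. This
bounds the feedback matrix by `3`. -/
structure HasBoundedDegree (π : V → ℝ) (D : V → V → ℝ) : Prop where
  nonneg : ∀ i j, 0 ≤ D i j
  degree_le : ∀ i, ∑ j, D i j + ∑ j, D j i ≤ 3 * π i

theorem isHermitian_symLaplacian (D : V → V → ℝ) : (symLaplacian D).IsHermitian := by
  refine IsHermitian.sub (isHermitian_diagonal _) ?_
  ext i j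
  simp [add_comm]

theorem symLaplacian_mulVec (D : V → V → ℝ) (x : V → ℝ) (i : V) :
    (symLaplacian D *ᵥ x) i = ∑ j, (D i j + D j i) / 2 * (x i - x j) := by
  rw [symLaplacian, sub_mulVec, Pi.sub_apply, mulVec_diagonal, Finset.sum_mul]
  simp only [mulVec, dotProduct, of_apply, ← Finset.sum_sub_distrib]
  exact Finset.sum_congr rfl fun j _ => by ring

theorem symLaplacian_quadratic (D : V → V → ℝ) (x : V → ℝ) :
    x ⬝ᵥ symLaplacian D *ᵥ x = (∑ i, ∑ j, D i j * (x i - x j) ^ 2) / 2 := by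
  have h1 : x ⬝ᵥ symLaplacian D *ᵥ x = (∑ i, ∑ j, D i j * (x i * (x i - x j))) / 2 +
      (∑ i, ∑ j, D j i * (x i * (x i - x j))) / 2 := by
    simp only [dotProduct, symLaplacian_mulVec, Finset.mul_sum, Finset.sum_div,
      ← Finset.sum_add_distrib]
    exact Finset.sum_congr rfl fun i _ => Finset.sum_congr rfl fun j _ => by ring
  rw [h1, Finset.sum_comm (f := fun i j => D j i * (x i * (x i - x j)))]
  simp only [Finset.sum_div, ← Finset.sum_add_distrib]
  exact Finset.sum_congr rfl fun i _ => Finset.sum_congr rfl fun j _ => by ring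

theorem feedback_quadratic (π : V → ℝ) (D : V → V → ℝ) (x : V → ℝ) :
    x ⬝ᵥ feedback π D *ᵥ x
      = (invSqrtDiag π *ᵥ x) ⬝ᵥ symLaplacian D *ᵥ (invSqrtDiag π *ᵥ x) := by
  have h : (invSqrtDiag π)ᵀ = invSqrtDiag π := diagonal_transpose _
  rw [feedback, ← mulVec_mulVec, ← mulVec_mulVec, dotProduct_mulVec, ← mulVec_transpose, h]

theorem isHermitian_feedback (π : V → ℝ) (D : V → V → ℝ) : (feedback π D).IsHermitian := by
  have h : (invSqrtDiag π)ᴴ = invSqrtDiag π := isHermitian_diagonal _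
  have := isHermitian_mul_mul_conjTranspose (invSqrtDiag π) (isHermitian_symLaplacian D)
  rwa [h] at this

theorem posSemidef_feedback (π : V → ℝ) {D : V → V → ℝ} (hD : ∀ i j, 0 ≤ D i j) :
    (feedback π D).PosSemidef := by
  refine PosSemidef.of_dotProduct_mulVec_nonneg (isHermitian_feedback π D) fun x => ?_
  rw [star_trivial, feedback_quadratic, symLaplacian_quadratic]
  exact div_nonneg (Finset.sum_nonneg fun i _ => Finset.sum_nonneg fun j _ =>
    mul_nonneg (hD i j) (sq_nonneg _)) two_pos.le

variable {π : V → ℝ}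

theorem sq_inv_sqrt_mul (hπ : ∀ i, 0 < π i) (i : V) : π i * (√(π i))⁻¹ ^ 2 = 1 := by
  rw [inv_pow, Real.sq_sqrt (hπ i).le, mul_inv_cancel₀ (hπ i).ne']

theorem posSemidef_three_sub_feedback (hπ : ∀ i, 0 < π i) {D : V → V → ℝ}
    (hD : HasBoundedDegree π D) : ((3 : ℝ) • (1 : Matrix V V ℝ) - feedback π D).PosSemidef := by
  refine PosSemidef.of_dotProduct_mulVec_nonneg ?_ fun x => ?_
  · refine IsHermitian.sub ?_ (isHermitian_feedback π D)
    simp [IsHermitian]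
  · rw [star_trivial, sub_mulVec, dotProduct_sub, feedback_quadratic, symLaplacian_quadratic,
      smul_mulVec, one_mulVec, dotProduct_smul, smul_eq_mul, sub_nonneg]
    set y := invSqrtDiag π *ᵥ x with hy
    have hyx : ∀ i, π i * y i ^ 2 = x i ^ 2 := fun i => by
      rw [hy, invSqrtDiag, mulVec_diagonal, mul_pow, ← mul_assoc, sq_inv_sqrt_mul hπ, one_mul]
    have h1 : (∑ i, ∑ j, D i j * (y i - y j) ^ 2) / 2
        ≤ ∑ i, ∑ j, D i j * y i ^ 2 + ∑ i, ∑ j, D i j * y j ^ 2 := by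
      simp only [Finset.sum_div, ← Finset.sum_add_distrib]
      refine Finset.sum_le_sum fun i _ => Finset.sum_le_sum fun j _ => ?_
      nlinarith [mul_nonneg (hD.nonneg i j) (sq_nonneg (y i + y j))]
    rw [Finset.sum_comm (f := fun i j => D i j * y j ^ 2)] at h1
    simp only [← Finset.sum_mul, ← Finset.sum_add_distrib, ← add_mul] at h1
    refine h1.trans ?_
    rw [dotProduct, Finset.mul_sum]
    refine Finset.sum_le_sum fun i _ => ?_
    rw [← sq, ← hyx, ← mul_assoc, Finset.sum_add_distrib]
    exact mul_le_mul_of_nonneg_right (hD.degree_le i) (sq_nonneg (y i))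

/-! ### The projection onto the complement of the trivial eigenvector -/

theorem sqrt_dotProduct_sqrt (hπ : ∀ i, 0 < π i) :
    (fun i => √(π i)) ⬝ᵥ (fun i => √(π i)) = vertexWeight π Finset.univ :=
  Finset.sum_congr rfl fun i _ => Real.mul_self_sqrt (hπ i).le

theorem proj_transpose (π : V → ℝ) : (proj π)ᵀ = proj π := by
  ext i j
  simp [proj, vecMulVec, one_apply, eq_comm, mul_comm]

theorem proj_mulVec (π x : V → ℝ) : proj π *ᵥ x
    = x - ((vertexWeight π Finset.univ)⁻¹ * ((fun i => √(π i)) ⬝ᵥ x)) • fun i => √(π i) := by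
  rw [proj, sub_mulVec, one_mulVec, smul_mulVec, vecMulVec_mulVec]
  simp [mul_smul]

theorem proj_mulVec_of_orthogonal {x : V → ℝ} (hx : (fun i => √(π i)) ⬝ᵥ x = 0) :
    proj π *ᵥ x = x := by
  rw [proj_mulVec, hx]
  simp

theorem proj_mulVec_sqrt [Nonempty V] (hπ : ∀ i, 0 < π i) : proj π *ᵥ (fun i => √(π i)) = 0 := by
  rw [proj_mulVec, sqrt_dotProduct_sqrt hπ,
    inv_mul_cancel₀ (vertexWeight_pos hπ Finset.univ_nonempty).ne', one_smul, sub_self]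

theorem invSqrtDiag_mulVec_sqrt (hπ : ∀ i, 0 < π i) :
    invSqrtDiag π *ᵥ (fun i => √(π i)) = 1 := by
  funext i
  rw [invSqrtDiag, mulVec_diagonal, Pi.one_apply]
  exact inv_mul_cancel₀ (Real.sqrt_pos.2 (hπ i)).ne'

theorem feedback_mulVec_sqrt (hπ : ∀ i, 0 < π i) (D : V → V → ℝ) :
    feedback π D *ᵥ (fun i => √(π i)) = 0 := by
  have : symLaplacian D *ᵥ (1 : V → ℝ) = 0 := by
    funext i
    simp [symLaplacian_mulVec]
  rw [feedback, ← mulVec_mulVec, ← mulVec_mulVec, invSqrtDiag_mulVec_sqrt hπ, this, mulVec_zero]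

theorem one_sub_proj (π : V → ℝ) : 1 - proj π = vecMulVec
    ((vertexWeight π Finset.univ)⁻¹ • fun i => √(π i)) (fun i => √(π i)) := by
  rw [proj, sub_sub_cancel, smul_vecMulVec]

theorem mul_one_sub_proj {A : Matrix V V ℝ} (hA : A *ᵥ (fun i => √(π i)) = 0) :
    A * (1 - proj π) = 0 := by
  rw [one_sub_proj, mul_vecMulVec, mulVec_smul, hA, smul_zero, zero_vecMulVec]

theorem mul_proj {A : Matrix V V ℝ} (hA : A *ᵥ (fun i => √(π i)) = 0) : A * proj π = A := by
  have := mul_one_sub_proj hA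
  rw [mul_sub, mul_one, sub_eq_zero] at this
  exact this.symm

theorem proj_mul {A : Matrix V V ℝ} (hAh : A.IsHermitian) (hA : A *ᵥ (fun i => √(π i)) = 0) :
    proj π * A = A := by
  have h1 : Aᵀ = A := hAh
  have := congrArg transpose (mul_proj hA)
  rwa [transpose_mul, h1, proj_transpose] at this

theorem proj_mul_proj [Nonempty V] (hπ : ∀ i, 0 < π i) : proj π * proj π = proj π :=
  mul_proj (proj_mulVec_sqrt hπ)

/-! ### The potential -/

/-- The scaled sum of the feedback matrices. -/
noncomputable def feedbackSum (π : V → ℝ) (hist : List (V → V → ℝ)) : Matrix V V ℝ :=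
  (1 / 4 / 4 : ℝ) • (hist.map (feedback π)).sum

/-- The unnormalized matrix of the multiplicative weight update. -/
noncomputable def expWeight (π : V → ℝ) (hist : List (V → V → ℝ)) : Matrix V V ℝ :=
  proj π * NormedSpace.exp (-feedbackSum π hist) * proj π

/-- The potential: the trace of the unnormalized matrix. -/
noncomputable def potential (π : V → ℝ) (hist : List (V → V → ℝ)) : ℝ := (expWeight π hist).trace

theorem density_eq (π : V → ℝ) (hist : List (V → V → ℝ)) :
    density π (1 / 4) 4 hist = (potential π hist)⁻¹ • expWeight π hist := rfl

theorem feedbackSum_concat (π : V → ℝ) (hist : List (V → V → ℝ)) (D : V → V → ℝ) :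
    feedbackSum π (hist ++ [D]) = feedbackSum π hist + (1 / 4 / 4 : ℝ) • feedback π D := by
  simp [feedbackSum]

theorem isHermitian_list_sum (l : List (Matrix V V ℝ)) (h : ∀ A ∈ l, A.IsHermitian) :
    l.sum.IsHermitian := by
  induction l with
  | nil => simp
  | cons A l ih =>
    rw [List.sum_cons]
    exact (h A (by simp)).add (ih fun B hB => h B (by simp [hB]))

theorem isHermitian_feedbackSum (π : V → ℝ) (hist : List (V → V → ℝ)) :
    (feedbackSum π hist).IsHermitian := by
  refine IsHermitian.smul (isHermitian_list_sum _ fun A hA => ?_) (IsSelfAdjoint.all _)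
  obtain ⟨D, -, rfl⟩ := List.mem_map.1 hA
  exact isHermitian_feedback π D

theorem feedbackSum_mulVec_sqrt (hπ : ∀ i, 0 < π i) (hist : List (V → V → ℝ)) :
    feedbackSum π hist *ᵥ (fun i => √(π i)) = 0 := by
  rw [feedbackSum, smul_mulVec]
  have : (hist.map (feedback π)).sum *ᵥ (fun i => √(π i)) = 0 := by
    induction hist with
    | nil => simp
    | cons D hist ih => rw [List.map_cons, List.sum_cons, add_mulVec, ih,
        feedback_mulVec_sqrt hπ, add_zero]
  rw [this, smul_zero]

theorem posSemidef_expWeight (π : V → ℝ) (hist : List (V → V → ℝ)) :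
    (expWeight π hist).PosSemidef := by
  have := (posSemidef_exp_neg (isHermitian_feedbackSum π hist)).mul_mul_conjTranspose_same (proj π)
  rwa [show (proj π)ᴴ = proj π from proj_transpose π] at this

theorem expWeight_quadratic (π : V → ℝ) (hist : List (V → V → ℝ)) (x : V → ℝ) :
    x ⬝ᵥ expWeight π hist *ᵥ x
      = (proj π *ᵥ x) ⬝ᵥ NormedSpace.exp (-feedbackSum π hist) *ᵥ (proj π *ᵥ x) := by
  rw [expWeight, ← mulVec_mulVec, ← mulVec_mulVec, dotProduct_mulVec, ← mulVec_transpose,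
    proj_transpose]

theorem potential_eq [Nonempty V] (hπ : ∀ i, 0 < π i) (hist : List (V → V → ℝ)) :
    potential π hist = (NormedSpace.exp (-feedbackSum π hist)).trace - (1 - proj π).trace := by
  have h1 := exp_neg_mul_of_mul_eq_zero (isHermitian_feedbackSum π hist)
    (mul_one_sub_proj (feedbackSum_mulVec_sqrt hπ hist))
  rw [potential, expWeight, trace_mul_cycle, proj_mul_proj hπ, trace_mul_comm]
  rw [mul_sub, mul_one] at h1
  have h2 := congrArg trace h1
  rw [trace_sub] at h2
  linarith

theorem potential_nil_le [Nonempty V] (hπ : ∀ i, 0 < π i) : potential π [] ≤ Fintype.card V := by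
  have h1 : (1 - proj π).trace = 1 := by
    rw [one_sub_proj, trace_vecMulVec, smul_dotProduct, sqrt_dotProduct_sqrt hπ, smul_eq_mul,
      inv_mul_cancel₀ (vertexWeight_pos hπ Finset.univ_nonempty).ne']
  rw [potential_eq hπ, h1]
  simp [feedbackSum]

/-- A lower bound for the potential in terms of the Rayleigh quotients of the feedback. -/
theorem exp_neg_le_potential (hist : List (V → V → ℝ)) {x : V → ℝ} {m : ℝ}
    (hx : (fun i => √(π i)) ⬝ᵥ x = 0) (hx0 : 0 < x ⬝ᵥ x)
    (hm : x ⬝ᵥ feedbackSum π hist *ᵥ x = m * (x ⬝ᵥ x)) :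
    Real.exp (-m) ≤ potential π hist := by
  have h1 := exp_neg_quadratic_le (isHermitian_feedbackSum π hist) x hm
  have h2 := quadratic_le_trace (posSemidef_expWeight π hist) x
  rw [expWeight_quadratic, proj_mulVec_of_orthogonal hx] at h2
  exact le_of_mul_le_mul_right (h1.trans h2) hx0

theorem potential_pos [Nontrivial V] (hπ : ∀ i, 0 < π i) (hist : List (V → V → ℝ)) :
    0 < potential π hist := by
  obtain ⟨i, j, hij⟩ := exists_pair_ne V
  set x : V → ℝ := Pi.single i (√(π j)) - Pi.single j (√(π i)) with hx
  have h1 : (fun i => √(π i)) ⬝ᵥ x = 0 := by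
    rw [hx, dotProduct_sub, dotProduct_single, dotProduct_single]
    ring
  have h2 : 0 < x ⬝ᵥ x := by
    refine lt_of_lt_of_le ?_ (Finset.single_le_sum (f := fun k => x k * x k)
      (fun k _ => mul_self_nonneg _) (Finset.mem_univ i))
    have : x i = √(π j) := by simp [hx, hij]
    simp only [this]
    exact mul_self_pos.2 (Real.sqrt_pos.2 (hπ j)).ne'
  exact (Real.exp_pos _).trans_le (exp_neg_le_potential hist h1 h2
    (div_mul_cancel₀ (x ⬝ᵥ feedbackSum π hist *ᵥ x) h2.ne').symm)

/-- The gain of the demand graph `D` against the current density matrix. -/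
noncomputable def gain (π : V → ℝ) (hist : List (V → V → ℝ)) (D : V → V → ℝ) : ℝ :=
  (feedback π D * density π (1 / 4) 4 hist).trace

/-- A round with demand graph `D` shrinks the potential by a factor `1 - gain / 64`. The scaled
feedback is at most `ν = 3 / 16`, and `1 / 64` is below `(1 - ν) / 2 · 1 / 16`. -/
theorem potential_concat_le [Nontrivial V] (hπ : ∀ i, 0 < π i) (hist : List (V → V → ℝ))
    {D : V → V → ℝ} (hD : HasBoundedDegree π D) :
    potential π (hist ++ [D]) ≤ potential π hist * (1 - gain π hist D / 64) := by
  have hpos := potential_pos hπ hist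
  have hF := posSemidef_feedback π hD.nonneg
  set E := NormedSpace.exp (-feedbackSum π hist) with hE
  set F := feedback π D with hFdef
  have hg : (F * E).trace = potential π hist * gain π hist D := by
    have h0 := feedback_mulVec_sqrt hπ D
    rw [gain, density_eq, mul_smul_comm, trace_smul, smul_eq_mul, mul_inv_cancel_left₀ hpos.ne',
      expWeight, ← hFdef, ← hE, ← mul_assoc, ← mul_assoc, mul_proj (A := F) h0,
      trace_mul_cycle, proj_mul (A := F) (isHermitian_feedback π D) h0]
  have h1 := trace_exp_neg_add_le (A := feedbackSum π hist) (N := (1 / 4 / 4 : ℝ) • F)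
    (ν := 3 / 16) (by norm_num) (by norm_num) (isHermitian_feedbackSum π hist)
    (hF.smul (by norm_num)) (by
      have := (posSemidef_three_sub_feedback hπ hD).smul (a := (1 / 4 / 4 : ℝ)) (by norm_num)
      rw [smul_sub, smul_smul] at this
      convert this using 3
      norm_num)
  have h2 := trace_mul_nonneg hF (posSemidef_exp_neg (isHermitian_feedbackSum π hist))
  rw [smul_mul_assoc, trace_smul, smul_eq_mul, ← hE] at h1
  rw [← hE] at h2
  rw [potential_eq hπ (hist ++ [D]), feedbackSum_concat]
  have h3 := potential_eq hπ hist
  rw [← hE] at h3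
  nlinarith

/-! ### Gram vectors of the density matrix -/

/-- The matrix whose Gram vectors the cut player projects. -/
noncomputable def gramTarget (π : V → ℝ) (hist : List (V → V → ℝ)) : Matrix V V ℝ :=
  invSqrtDiag π * density π (1 / 4) 4 hist * invSqrtDiag π

theorem gramTarget_apply (π : V → ℝ) (hist : List (V → V → ℝ)) (i j : V) :
    gramTarget π hist i j
      = (√(π i))⁻¹ * ((potential π hist)⁻¹ * expWeight π hist i j) * (√(π j))⁻¹ := by
  rw [gramTarget, invSqrtDiag, mul_diagonal, diagonal_mul, density_eq]
  rfl

theorem exists_isGram {Y : Matrix V V ℝ} (hY : Y.PosSemidef) : ∃ x, IsGram Y x := by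
  obtain ⟨U, -, -, hU⟩ := exists_spectralMatrix hY.isHermitian
  have h0 := hY.eigenvalues_nonneg
  set a := hY.isHermitian.eigenvalues
  refine ⟨fun i k => U i k * √(a k), fun i j => ?_⟩
  rw [hU, spectralMatrix]
  simp only [mul_apply (N := Uᵀ), mul_diagonal, transpose_apply, dotProduct]
  refine Finset.sum_congr rfl fun k _ => ?_
  have := Real.mul_self_sqrt (h0 k)
  calc U i k * √(a k) * (U j k * √(a k)) = U i k * (√(a k) * √(a k)) * U j k := by ring
    _ = _ := by rw [this]

theorem posSemidef_gramTarget [Nontrivial V] (hπ : ∀ i, 0 < π i) (hist : List (V → V → ℝ)) :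
    (gramTarget π hist).PosSemidef := by
  have := ((posSemidef_expWeight π hist).smul
    (inv_nonneg.2 (potential_pos hπ hist).le)).mul_mul_conjTranspose_same (invSqrtDiag π)
  rwa [show (invSqrtDiag π)ᴴ = invSqrtDiag π from isHermitian_diagonal _] at this

/-- Vector configurations of weight one and centre of mass zero whose members are distinct. -/
structure IsCutEmbedding (π : V → ℝ) (v : V → V → ℝ) : Prop where
  weight : ∑ i, π i * (v i ⬝ᵥ v i) = 1
  centred : ∑ i, π i • v i = 0
  injective : ∀ i j, i ≠ j → v i ≠ v j

theorem isGram_quadratic {Y : Matrix V V ℝ} {v : V → V → ℝ} (h : IsGram Y v) (c : V → ℝ) :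
    (∑ i, c i • v i) ⬝ᵥ (∑ i, c i • v i) = c ⬝ᵥ Y *ᵥ c := by
  simp only [sum_dotProduct, dotProduct_sum, smul_dotProduct, dotProduct_smul, h _ _, smul_eq_mul]
  simp only [dotProduct, mulVec, Finset.mul_sum]
  refine Finset.sum_congr rfl fun i _ => Finset.sum_congr rfl fun j _ => ?_
  rw [← h i j, ← h j i, dotProduct_comm (v j)]
  ring

theorem gramTarget_quadratic (π : V → ℝ) (hist : List (V → V → ℝ)) (c : V → ℝ) :
    c ⬝ᵥ gramTarget π hist *ᵥ c = (potential π hist)⁻¹ *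
      ((invSqrtDiag π *ᵥ c) ⬝ᵥ expWeight π hist *ᵥ (invSqrtDiag π *ᵥ c)) := by
  have h : (invSqrtDiag π)ᵀ = invSqrtDiag π := diagonal_transpose _
  rw [gramTarget, ← mulVec_mulVec, ← mulVec_mulVec, dotProduct_mulVec, ← mulVec_transpose, h,
    density_eq, smul_mulVec, dotProduct_smul, smul_eq_mul]

theorem isCutEmbedding_of_isGram [Nontrivial V] (hπ : ∀ i, 0 < π i) {hist : List (V → V → ℝ)}
    {v : V → V → ℝ} (hv : IsGram (gramTarget π hist) v) : IsCutEmbedding π v := by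
  have hpos := potential_pos hπ hist
  refine ⟨?_, ?_, fun i j hij hvij => ?_⟩
  · have h1 : ∀ i, π i * (v i ⬝ᵥ v i) = (potential π hist)⁻¹ * expWeight π hist i i := fun i => by
      rw [hv, gramTarget_apply]
      have := sq_inv_sqrt_mul hπ i
      calc _ = (π i * (√(π i))⁻¹ ^ 2) * ((potential π hist)⁻¹ * expWeight π hist i i) := by ring
        _ = _ := by rw [this, one_mul]
    rw [Finset.sum_congr rfl fun i _ => h1 i, ← Finset.mul_sum]
    exact inv_mul_cancel₀ hpos.ne'
  · have h1 : invSqrtDiag π *ᵥ π = fun i => √(π i) := by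
      funext i
      rw [invSqrtDiag, mulVec_diagonal]
      have := Real.sqrt_pos.2 (hπ i)
      rw [inv_mul_eq_iff_eq_mul₀ this.ne', Real.mul_self_sqrt (hπ i).le]
    refine dotProduct_self_eq_zero.1 ?_
    rw [isGram_quadratic hv, gramTarget_quadratic, h1, expWeight_quadratic, proj_mulVec_sqrt hπ]
    simp
  · -- the quadratic form of the weight matrix is definite on the complement of `√π`, so that
    -- `v i = v j` would make `e i - e j` a multiple of `π`
    set c : V → ℝ := Pi.single i 1 - Pi.single j 1 with hc
    have h1 : ∑ k, c k • v k = 0 := by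
      simp [hc, sub_smul, Finset.sum_sub_distrib, Pi.single_apply, hvij]
    have h2 := isGram_quadratic hv c
    rw [h1, zero_dotProduct, gramTarget_quadratic, expWeight_quadratic] at h2
    set y := proj π *ᵥ (invSqrtDiag π *ᵥ c) with hy
    have h3 : y ⬝ᵥ NormedSpace.exp (-feedbackSum π hist) *ᵥ y = 0 :=
      (mul_eq_zero.1 h2.symm).resolve_left (inv_ne_zero hpos.ne')
    have hy0 : y = 0 := by
      by_contra hne
      have h4 : 0 < y ⬝ᵥ y := lt_of_le_of_ne
        (Finset.sum_nonneg fun k _ => mul_self_nonneg _)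
        (fun h => hne (dotProduct_self_eq_zero.1 h.symm))
      have h5 := exp_neg_quadratic_le (isHermitian_feedbackSum π hist) y
        (div_mul_cancel₀ (y ⬝ᵥ feedbackSum π hist *ᵥ y) h4.ne').symm
      rw [h3] at h5
      exact absurd h5 (not_le.2 (mul_pos (Real.exp_pos _) h4))
    rw [hy, proj_mulVec, sub_eq_zero] at hy0
    set t := (vertexWeight π Finset.univ)⁻¹ * ((fun i => √(π i)) ⬝ᵥ invSqrtDiag π *ᵥ c)
    have h6 : ∀ k, c k = t * π k := fun k => by
      have h7 := congrFun hy0 k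
      rw [invSqrtDiag, mulVec_diagonal, Pi.smul_apply, smul_eq_mul] at h7
      have h8 := Real.sqrt_pos.2 (hπ k)
      rw [inv_mul_eq_iff_eq_mul₀ h8.ne'] at h7
      rw [h7, ← mul_assoc, mul_comm (√(π k)) t, mul_assoc, Real.mul_self_sqrt (hπ k).le]
    have h9 := h6 i
    have h10 := h6 j
    simp only [hc, Pi.sub_apply, Pi.single_eq_same, Pi.single_eq_of_ne hij,
      Pi.single_eq_of_ne hij.symm] at h9 h10
    nlinarith [hπ i, hπ j, mul_pos (hπ i) (hπ j)]

/-- The gain of a demand graph, in terms of the Gram vectors. -/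
theorem gain_eq {hist : List (V → V → ℝ)} {v : V → V → ℝ}
    (hv : IsGram (gramTarget π hist) v) (D : V → V → ℝ) :
    gain π hist D = (∑ i, ∑ j, D i j * ((v i - v j) ⬝ᵥ (v i - v j))) / 2 := by
  have h1 : gain π hist D = (symLaplacian D * gramTarget π hist).trace := by
    rw [gain, feedback, gramTarget, mul_assoc, mul_assoc, trace_mul_comm]
    simp only [mul_assoc]
  -- coordinate by coordinate, the trace is the quadratic form of the Laplacian
  have h2 : (symLaplacian D * gramTarget π hist).trace
      = ∑ k, (fun i => v i k) ⬝ᵥ symLaplacian D *ᵥ (fun i => v i k) := by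
    simp only [trace, diag_apply, mul_apply, ← hv _ _, dotProduct, mulVec, Finset.mul_sum]
    conv_rhs => rw [Finset.sum_comm]
    refine Finset.sum_congr rfl fun i _ => ?_
    conv_rhs => rw [Finset.sum_comm]
    refine Finset.sum_congr rfl fun j _ => Finset.sum_congr rfl fun k _ => by ring
  rw [h1, h2]
  simp only [symLaplacian_quadratic, ← Finset.sum_div]
  congr 1
  rw [Finset.sum_comm]
  refine Finset.sum_congr rfl fun i _ => ?_
  rw [Finset.sum_comm]
  refine Finset.sum_congr rfl fun j _ => ?_
  simp only [dotProduct, Pi.sub_apply, Finset.mul_sum]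
  exact Finset.sum_congr rfl fun k _ => by ring

end Feedback

/-! ### Gaussian projections -/

section Gaussian

open Matrix MeasureTheory ProbabilityTheory

variable {V : Type u} [Fintype V] [DecidableEq V]

/-- The law of a standard Gaussian vector indexed by `V`. -/
noncomputable def gaussianVector (V : Type u) [Fintype V] : Measure (V → ℝ) :=
  Measure.pi fun _ => gaussianReal 0 1

instance : IsProbabilityMeasure (gaussianVector V) := by
  unfold gaussianVector; infer_instance

theorem measurable_dotProduct_const (w : V → ℝ) : Measurable fun u : V → ℝ => u ⬝ᵥ w :=
  Finset.measurable_sum _ fun i _ => (measurable_pi_apply i).mul_const _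

theorem map_dotProduct_gaussianVector (w : V → ℝ) :
    (gaussianVector V).map (fun u => u ⬝ᵥ w) = gaussianReal 0 (w ⬝ᵥ w).toNNReal := by
  have h1 : (fun u : V → ℝ => u ⬝ᵥ w) = (innerSL ℝ (WithLp.toLp 2 w)) ∘ (WithLp.toLp 2) := by
    funext u
    simp [PiLp.inner_apply, dotProduct]
  rw [h1, ← Measure.map_map (by fun_prop) (by fun_prop), gaussianVector, map_pi_eq_stdGaussian,
    IsGaussian.map_eq_gaussianReal, integral_strongDual_stdGaussian, variance_dual_stdGaussian,
    innerSL_apply_norm, EuclideanSpace.norm_sq_eq]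
  simp [dotProduct, sq]

theorem integral_exp_mul_sq_gaussianReal {b : ℝ} (hb : b < 1 / 2) :
    ∫ z, Real.exp (b * z ^ 2) ∂gaussianReal 0 1 = (√(1 - 2 * b))⁻¹ := by
  rw [integral_gaussianReal_eq_integral_smul one_ne_zero]
  have h1 : ∀ z : ℝ, gaussianPDFReal 0 1 z • Real.exp (b * z ^ 2)
      = (√(2 * Real.pi))⁻¹ * Real.exp (-(1 / 2 - b) * z ^ 2) := fun z => by
    rw [gaussianPDFReal, smul_eq_mul, mul_assoc, ← Real.exp_add]
    simp only [NNReal.coe_one, mul_one]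
    congr 2
    ring
  simp only [h1, integral_const_mul, integral_gaussian]
  have h2 : 0 < 1 - 2 * b := by linarith
  rw [show Real.pi / (1 / 2 - b) = (2 * Real.pi) * (1 - 2 * b)⁻¹ by
      have : 1 / 2 - b ≠ 0 := by linarith
      field_simp,
    Real.sqrt_mul (x := 2 * Real.pi) (by positivity), Real.sqrt_inv,
    inv_mul_cancel_left₀ (by positivity)]

theorem integrable_exp_mul_sq_gaussianReal {b : ℝ} (hb : b < 1 / 2) :
    Integrable (fun z => Real.exp (b * z ^ 2)) (gaussianReal 0 1) := by
  by_contra h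
  have h1 := integral_exp_mul_sq_gaussianReal hb
  rw [integral_undef h] at h1
  have : 0 < (√(1 - 2 * b))⁻¹ := inv_pos.2 (Real.sqrt_pos.2 (by linarith))
  linarith

/-- The squared projection of a Gaussian vector `u` onto the direction of `w`. For `w = 0` it is
zero, by the convention for division. -/
noncomputable def sqProj (w u : V → ℝ) : ℝ := (u ⬝ᵥ w) ^ 2 / (w ⬝ᵥ w)

theorem sqProj_nonneg (w u : V → ℝ) : 0 ≤ sqProj w u :=
  div_nonneg (sq_nonneg _) (Finset.sum_nonneg fun _ _ => mul_self_nonneg _)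

theorem dotProduct_self_pos {w : V → ℝ} (hw : w ≠ 0) : 0 < w ⬝ᵥ w :=
  lt_of_le_of_ne (Finset.sum_nonneg fun _ _ => mul_self_nonneg _)
    fun h => hw (dotProduct_self_eq_zero.1 h.symm)

theorem sqProj_mul (w u : V → ℝ) : sqProj w u * (w ⬝ᵥ w) = (u ⬝ᵥ w) ^ 2 := by
  by_cases hw : w = 0
  · simp [hw]
  · exact div_mul_cancel₀ _ (dotProduct_self_pos hw).ne'

theorem sqProj_zero (u : V → ℝ) : sqProj 0 u = 0 := by simp [sqProj]

theorem exp_mul_sqProj {w : V → ℝ} (hw : w ≠ 0) {b : ℝ} (hb : b < 1 / 2) :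
    Integrable (fun u => Real.exp (b * sqProj w u)) (gaussianVector V) ∧
    ∫ u, Real.exp (b * sqProj w u) ∂gaussianVector V = (√(1 - 2 * b))⁻¹ := by
  have hpos := dotProduct_self_pos hw
  set w' : V → ℝ := (√(w ⬝ᵥ w))⁻¹ • w with hw'
  have h1 : w' ⬝ᵥ w' = 1 := by
    rw [hw', smul_dotProduct, dotProduct_smul, smul_eq_mul, smul_eq_mul, ← mul_assoc, ← sq,
      inv_pow, Real.sq_sqrt hpos.le, inv_mul_cancel₀ hpos.ne']
  have h2 : (fun u => Real.exp (b * sqProj w u))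
      = (fun z => Real.exp (b * z ^ 2)) ∘ fun u => u ⬝ᵥ w' := by
    funext u
    simp only [Function.comp, sqProj, hw', dotProduct_smul, smul_eq_mul, mul_pow, inv_pow,
      Real.sq_sqrt hpos.le, div_eq_inv_mul]
  have h3 := map_dotProduct_gaussianVector w'
  rw [h1, Real.toNNReal_one] at h3
  have hm := measurable_dotProduct_const w'
  have hi := integrable_exp_mul_sq_gaussianReal hb
  rw [← h3] at hi
  refine ⟨?_, ?_⟩
  · rw [h2]
    exact hi.comp_measurable hm
  · have h4 := integral_exp_mul_sq_gaussianReal hb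
    rw [← h3, integral_map hm.aemeasurable hi.aestronglyMeasurable] at h4
    rw [h2]
    exact h4

theorem exp_sqProj_div_four (w : V → ℝ) :
    Integrable (fun u => Real.exp (sqProj w u / 4)) (gaussianVector V) ∧
    ∫ u, Real.exp (sqProj w u / 4) ∂gaussianVector V ≤ 3 / 2 := by
  by_cases hw : w = 0
  · subst hw
    simp only [sqProj_zero, zero_div, Real.exp_zero]
    refine ⟨integrable_const _, ?_⟩
    norm_num
  · obtain ⟨h1, h2⟩ := exp_mul_sqProj hw (b := 1 / 4) (by norm_num)
    simp only [div_eq_inv_mul, mul_one] at h1 h2 ⊢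
    refine ⟨h1, ?_⟩
    rw [h2, inv_le_comm₀ (by norm_num) (by norm_num)]
    refine Real.le_sqrt_of_sq_le ?_
    norm_num

theorem exp_neg_sqProj_div_two {w : V → ℝ} (hw : w ≠ 0) :
    Integrable (fun u => Real.exp (-(sqProj w u / 2))) (gaussianVector V) ∧
    ∫ u, Real.exp (-(sqProj w u / 2)) ∂gaussianVector V ≤ 3 / 4 := by
  obtain ⟨h1, h2⟩ := exp_mul_sqProj hw (b := -(1 / 2)) (by norm_num)
  simp only [div_eq_inv_mul, mul_one, neg_mul] at h1 h2 ⊢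
  refine ⟨h1, ?_⟩
  rw [h2, inv_le_comm₀ (by norm_num) (by norm_num)]
  refine Real.le_sqrt_of_sq_le ?_
  norm_num

theorem ae_dotProduct_ne {v w : V → ℝ} (h : v ≠ w) :
    ∀ᵐ u ∂gaussianVector V, u ⬝ᵥ v ≠ u ⬝ᵥ w := by
  have hpos := dotProduct_self_pos (sub_ne_zero.2 h)
  have h1 := map_dotProduct_gaussianVector (v - w)
  have hne : ((v - w) ⬝ᵥ (v - w)).toNNReal ≠ 0 := (Real.toNNReal_pos.2 hpos).ne'
  have h2 : ∀ᵐ z ∂(gaussianVector V).map (fun u => u ⬝ᵥ (v - w)), z ≠ 0 := by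
    rw [h1]
    have := nullSingletonClass_gaussianReal (μ := 0) hne
    exact Measure.ae_ne _ 0
  have h3 := ae_of_ae_map (measurable_dotProduct_const (v - w)).aemeasurable h2
  filter_upwards [h3] with u hu
  rw [dotProduct_sub] at hu
  exact sub_ne_zero.1 hu

/-! ### The gain of a random median cut -/

variable {π : V → ℝ} {v : V → V → ℝ}

/-- A bound for all ratios `⟨u, v i - v j⟩² / ‖v i - v j‖²` at once that has a small expectation: a
linear upper bound for the logarithm of a sum of exponentials. -/
noncomputable def stretch (v : V → V → ℝ) (u : V → ℝ) : ℝ :=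
  4 * (2 * Real.log (Fintype.card V) - 1
    + (∑ i, ∑ j, Real.exp (sqProj (v i - v j) u / 4)) / (Fintype.card V : ℝ) ^ 2)

theorem sqProj_le_stretch (v : V → V → ℝ) (u : V → ℝ) (i j : V) :
    sqProj (v i - v j) u ≤ stretch v u := by
  have hn : (0 : ℝ) < Fintype.card V := by
    exact_mod_cast Fintype.card_pos_iff.2 ⟨i⟩
  set t := sqProj (v i - v j) u with ht
  have h1 : Real.exp (t / 4) ≤ ∑ i, ∑ j, Real.exp (sqProj (v i - v j) u / 4) :=
    (Finset.single_le_sum (f := fun j => Real.exp (sqProj (v i - v j) u / 4))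
      (fun _ _ => (Real.exp_pos _).le) (Finset.mem_univ j)).trans
    (Finset.single_le_sum (f := fun i => ∑ j, Real.exp (sqProj (v i - v j) u / 4))
      (fun _ _ => Finset.sum_nonneg fun _ _ => (Real.exp_pos _).le) (Finset.mem_univ i))
  have h2 : t / 4 - 2 * Real.log (Fintype.card V) + 1
      ≤ Real.exp (t / 4) / (Fintype.card V : ℝ) ^ 2 := by
    have h3 := Real.add_one_le_exp (t / 4 - 2 * Real.log (Fintype.card V))
    rwa [Real.exp_sub, show 2 * Real.log (Fintype.card V : ℝ) = Real.log ((Fintype.card V : ℝ) ^ 2)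
      by rw [Real.log_pow]; norm_num, Real.exp_log (by positivity),
      show Real.log ((Fintype.card V : ℝ) ^ 2) = 2 * Real.log (Fintype.card V : ℝ)
      by rw [Real.log_pow]; norm_num] at h3
  have h4 := div_le_div_of_nonneg_right h1 (by positivity : 0 ≤ (Fintype.card V : ℝ) ^ 2)
  unfold stretch
  linarith

theorem integrable_stretch (v : V → V → ℝ) : Integrable (stretch v) (gaussianVector V) := by
  unfold stretch
  refine Integrable.const_mul (Integrable.add (integrable_const _) (Integrable.div_const ?_ _)) _
  exact integrable_finsetSum _ fun i _ => integrable_finsetSum _ fun j _ =>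
    (exp_sqProj_div_four _).1

theorem integral_stretch_le [Nonempty V] (v : V → V → ℝ) :
    ∫ u, stretch v u ∂gaussianVector V ≤ 8 * Real.log (Fintype.card V) + 2 := by
  have hn : (0 : ℝ) < Fintype.card V := by exact_mod_cast Fintype.card_pos
  have hint : Integrable (fun u => ∑ i, ∑ j, Real.exp (sqProj (v i - v j) u / 4))
      (gaussianVector V) :=
    integrable_finsetSum _ fun i _ => integrable_finsetSum _ fun j _ => (exp_sqProj_div_four _).1
  have h1 : ∫ u, ∑ i, ∑ j, Real.exp (sqProj (v i - v j) u / 4) ∂gaussianVector V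
      ≤ 3 / 2 * (Fintype.card V : ℝ) ^ 2 := by
    rw [integral_finsetSum _ fun i _ => integrable_finsetSum _ fun j _ => (exp_sqProj_div_four _).1]
    have : ∀ i ∈ Finset.univ, ∫ u, ∑ j, Real.exp (sqProj (v i - v j) u / 4) ∂gaussianVector V
        ≤ 3 / 2 * (Fintype.card V : ℝ) := fun i _ => by
      rw [integral_finsetSum _ fun j _ => (exp_sqProj_div_four _).1]
      refine (Finset.sum_le_card_nsmul _ _ _ fun j _ => (exp_sqProj_div_four _).2).trans_eq ?_
      rw [nsmul_eq_mul, Finset.card_univ, mul_comm]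
    refine (Finset.sum_le_card_nsmul _ _ _ this).trans_eq ?_
    rw [nsmul_eq_mul, Finset.card_univ]
    ring
  unfold stretch
  rw [integral_const_mul, integral_add (integrable_const _) (hint.div_const _), integral_div]
  simp only [integral_const, probReal_univ, one_smul]
  have h2 := div_le_div_of_nonneg_right h1 (by positivity : 0 ≤ (Fintype.card V : ℝ) ^ 2)
  rw [mul_div_assoc, div_self (by positivity)] at h2
  linarith

/-- A bounded lower bound for the standard deviation of the projected vectors: the factor
`1 - exp (-t / 2)` is below `1`, and at most the square root of `t`. -/
noncomputable def spread (π : V → ℝ) (v : V → V → ℝ) (u : V → ℝ) : ℝ :=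
  ∑ i, π i * (v i ⬝ᵥ v i) * (1 - Real.exp (-(sqProj (v i) u / 2)))

theorem spread_bounds (hπ : ∀ i, 0 < π i) (hv : IsCutEmbedding π v) (u : V → ℝ) :
    0 ≤ spread π v u ∧ spread π v u ≤ 1 := by
  have h0 : ∀ i, 0 ≤ π i * (v i ⬝ᵥ v i) := fun i =>
    mul_nonneg (hπ i).le (Finset.sum_nonneg fun _ _ => mul_self_nonneg _)
  constructor
  · refine Finset.sum_nonneg fun i _ => mul_nonneg (h0 i) (sub_nonneg.2 ?_)
    exact Real.exp_le_one_iff.2 (by have := sqProj_nonneg (v i) u; linarith)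
  · rw [← hv.weight]
    refine Finset.sum_le_sum fun i _ => mul_le_of_le_one_right (h0 i) ?_
    have := Real.exp_pos (-(sqProj (v i) u / 2))
    linarith

theorem sq_one_sub_exp_le {t : ℝ} (ht : 0 ≤ t) : (1 - Real.exp (-(t / 2))) ^ 2 ≤ t := by
  have h1 := Real.add_one_le_exp (-(t / 2))
  have h2 := Real.exp_pos (-(t / 2))
  have h3 : Real.exp (-(t / 2)) ≤ 1 := Real.exp_le_one_iff.2 (by linarith)
  nlinarith

theorem sq_spread_le (hπ : ∀ i, 0 < π i) (hv : IsCutEmbedding π v) (u : V → ℝ) :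
    spread π v u ^ 2 ≤ ∑ i, π i * (u ⬝ᵥ v i) ^ 2 := by
  have h0 : ∀ i, 0 ≤ π i * (v i ⬝ᵥ v i) := fun i =>
    mul_nonneg (hπ i).le (Finset.sum_nonneg fun _ _ => mul_self_nonneg _)
  have h2 : spread π v u ^ 2
      ≤ (∑ i, π i * (v i ⬝ᵥ v i)) *
        ∑ i, π i * (v i ⬝ᵥ v i) * (1 - Real.exp (-(sqProj (v i) u / 2))) ^ 2 :=
    Finset.sum_sq_le_sum_mul_sum_of_sq_le_mul _ (fun i _ => h0 i)
      (fun i _ => mul_nonneg (h0 i) (sq_nonneg _)) fun i _ => le_of_eq (by ring)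
  rw [hv.weight, one_mul] at h2
  refine h2.trans (Finset.sum_le_sum fun i _ => ?_)
  rw [← sqProj_mul]
  have := mul_le_mul_of_nonneg_left (sq_one_sub_exp_le (sqProj_nonneg (v i) u)) (h0 i)
  linarith

theorem integrable_spread (π : V → ℝ) (v : V → V → ℝ) :
    Integrable (spread π v) (gaussianVector V) := by
  unfold spread
  refine integrable_finsetSum _ fun i _ => ?_
  by_cases hw : v i = 0
  · simp [hw]
  · exact ((integrable_const _).sub (exp_neg_sqProj_div_two hw).1).const_mul _

theorem integral_spread_ge (hπ : ∀ i, 0 < π i) (hv : IsCutEmbedding π v) :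
    1 / 4 ≤ ∫ u, spread π v u ∂gaussianVector V := by
  have hint : ∀ i, Integrable
      (fun u => π i * (v i ⬝ᵥ v i) * (1 - Real.exp (-(sqProj (v i) u / 2))))
      (gaussianVector V) := by
    intro i
    by_cases hw : v i = 0
    · simp [hw]
    · exact ((integrable_const _).sub (exp_neg_sqProj_div_two hw).1).const_mul _
  unfold spread
  rw [integral_finsetSum _ fun i _ => hint i]
  have h1 : (1 / 4 : ℝ) = ∑ i, π i * (v i ⬝ᵥ v i) * (1 / 4) := by
    rw [← Finset.sum_mul, hv.weight, one_mul]
  rw [h1]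
  refine Finset.sum_le_sum fun i _ => ?_
  by_cases hw : v i = 0
  · simp [hw]
  · obtain ⟨h2, h3⟩ := exp_neg_sqProj_div_two hw
    rw [integral_const_mul, integral_sub (integrable_const _) h2]
    simp only [integral_const, probReal_univ, one_smul]
    refine mul_le_mul_of_nonneg_left ?_ (mul_nonneg (hπ i).le (dotProduct_self_pos hw).le)
    linarith

theorem matchDegree_ge {L : Finset V} (hπ : ∀ i, 0 < π i) (hL : L.Nonempty)
    (hR : vertexWeight π L ≤ 3 * vertexWeight π Lᶜ) (i : V) : π i / 3 ≤ matchDegree π L i := by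
  have := hπ i
  unfold matchDegree
  split_ifs
  · have h1 : 1 / 3 ≤ vertexWeight π Lᶜ / vertexWeight π L := by
      rw [le_div_iff₀ (vertexWeight_pos hπ hL)]
      linarith
    have := mul_le_mul_of_nonneg_right h1 this.le
    linarith
  · linarith

/-- The stretch factor times the gain controls the variance of the projected vectors: across a
median cut, `(x i - x j)² ≥ (x i - y)² + (x j - y)²` for the median `y`. -/
theorem variance_le_stretch_mul [Nonempty V] (hπ : ∀ i, 0 < π i) (hv : IsCutEmbedding π v)
    (u : V → ℝ) (hinj : ∀ i j, i ≠ j → u ⬝ᵥ v i ≠ u ⬝ᵥ v j)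
    (hlight : ∀ i, π i < vertexWeight π Finset.univ / 4) {D : V → V → ℝ}
    (hD : IsMatchingDemand π (Finset.univ.filter fun i =>
      u ⬝ᵥ v i ≤ weightedMedian π fun i => u ⬝ᵥ v i) D) :
    ∑ i, π i * (u ⬝ᵥ v i) ^ 2
      ≤ 6 * (stretch v u * ((∑ i, ∑ j, D i j * ((v i - v j) ⬝ᵥ (v i - v j))) / 2)) := by
  set x : V → ℝ := fun i => u ⬝ᵥ v i with hx
  set y := weightedMedian π x with hy
  set L := Finset.univ.filter fun i => x i ≤ y with hL
  obtain ⟨⟨i₀, hi₀⟩, -⟩ := weightedMedian_mem hπ x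
  have hlt := vertexWeight_lt_weightedMedian hπ x
  have hmem : ∀ i, i ∈ L ↔ x i ≤ y := fun i => by simp [hL]
  have hbal : vertexWeight π L ≤ 3 * vertexWeight π Lᶜ := by
    have h1 : L ⊆ insert i₀ (Finset.univ.filter fun j => x j < weightedMedian π x) := by
      intro i hi
      rw [Finset.mem_insert]
      by_cases h : i = i₀
      · exact Or.inl h
      · refine Or.inr (Finset.mem_filter.2 ⟨Finset.mem_univ i, ?_⟩)
        refine lt_of_le_of_ne ((hmem i).1 hi) ?_
        rw [← hi₀]
        exact hinj i i₀ h
    have h2 : vertexWeight π L ≤ π i₀ +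
        vertexWeight π (Finset.univ.filter fun j => x j < weightedMedian π x) := by
      refine (Finset.sum_le_sum_of_subset_of_nonneg h1 fun j _ _ => (hπ j).le).trans ?_
      rw [Finset.sum_insert (by simp [hi₀])]
      rfl
    have h3 := vertexWeight_add_compl π L
    have h4 := hlight i₀
    linarith
  have hdeg := matchDegree_ge hπ ⟨i₀, (hmem i₀).2 hi₀.le⟩ hbal
  have hmean : ∑ i, π i * x i = 0 := by
    have h1 : u ⬝ᵥ (∑ i, π i • v i) = ∑ i, π i * x i := by
      simp only [dotProduct_sum, dotProduct_smul, smul_eq_mul, hx]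
    rw [← h1, hv.centred, dotProduct_zero]
  have h1 : ∑ i, π i * x i ^ 2 ≤ ∑ i, π i * (x i - y) ^ 2 := by
    have h2 : ∑ i, π i * (x i - y) ^ 2
        = ∑ i, π i * x i ^ 2 - 2 * y * ∑ i, π i * x i + y ^ 2 * ∑ i, π i := by
      simp only [Finset.mul_sum, ← Finset.sum_sub_distrib, ← Finset.sum_add_distrib]
      exact Finset.sum_congr rfl fun i _ => by ring
    rw [h2, hmean]
    have := mul_nonneg (sq_nonneg y) (Finset.sum_nonneg fun i (_ : i ∈ Finset.univ) => (hπ i).le)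
    linarith
  have h2 : ∑ i, matchDegree π L i * (x i - y) ^ 2
      ≤ ∑ i, ∑ j, D i j * (x i - x j) ^ 2 := by
    have h3 : ∑ i, matchDegree π L i * (x i - y) ^ 2
        = ∑ i, ∑ j, D i j * (x i - y) ^ 2 + ∑ i, ∑ j, D i j * (x j - y) ^ 2 := by
      rw [Finset.sum_comm (f := fun i j => D i j * (x j - y) ^ 2)]
      simp only [← Finset.sum_mul, ← Finset.sum_add_distrib, ← add_mul, hD.sum_out, hD.sum_in,
        add_halves]
    rw [h3]
    simp only [← Finset.sum_add_distrib]
    refine Finset.sum_le_sum fun i _ => Finset.sum_le_sum fun j _ => ?_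
    by_cases h0 : D i j = 0
    · simp [h0]
    · have hc := hD.crossing i j h0
      rw [hmem, hmem, not_le] at hc
      rw [← mul_add]
      refine mul_le_mul_of_nonneg_left ?_ (hD.nonneg i j)
      rcases le_or_gt (x i) y with hi | hi
      · nlinarith [mul_nonneg (sub_nonneg.2 hi) (sub_nonneg.2 (hc.1 hi).le)]
      · have hj : x j ≤ y := by
          by_contra hj
          exact absurd (hc.2 (not_le.1 hj)) (not_le.2 hi)
        nlinarith [mul_nonneg (sub_nonneg.2 hi.le) (sub_nonneg.2 hj)]
  have h3 : ∑ i, ∑ j, D i j * (x i - x j) ^ 2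
      ≤ stretch v u * ∑ i, ∑ j, D i j * ((v i - v j) ⬝ᵥ (v i - v j)) := by
    simp only [Finset.mul_sum]
    refine Finset.sum_le_sum fun i _ => Finset.sum_le_sum fun j _ => ?_
    have h4 : (x i - x j) ^ 2 = sqProj (v i - v j) u * ((v i - v j) ⬝ᵥ (v i - v j)) := by
      rw [sqProj_mul, dotProduct_sub]
    have h5 := mul_le_mul_of_nonneg_right (sqProj_le_stretch v u i j)
      (Finset.sum_nonneg fun k (_ : k ∈ Finset.univ) => mul_self_nonneg ((v i - v j) k))
    rw [h4, mul_left_comm (stretch v u)]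
    exact mul_le_mul_of_nonneg_left h5 (hD.nonneg i j)
  have h4 : ∑ i, π i * (x i - y) ^ 2 ≤ 3 * ∑ i, matchDegree π L i * (x i - y) ^ 2 := by
    rw [Finset.mul_sum]
    refine Finset.sum_le_sum fun i _ => ?_
    have := mul_le_mul_of_nonneg_right (hdeg i) (sq_nonneg (x i - y))
    linarith
  linarith

/-- The gain of a demand graph for the bipartition that isolates one vertex. -/
theorem gain_ge_of_singleton (hπ : ∀ i, 0 < π i) (hv : IsCutEmbedding π v) {i₀ : V}
    {D : V → V → ℝ} (hD : IsMatchingDemand π {i₀} D) :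
    1 / 2 ≤ (∑ i, ∑ j, D i j * ((v i - v j) ⬝ᵥ (v i - v j))) / 2 := by
  have hnn : ∀ w : V → ℝ, 0 ≤ w ⬝ᵥ w := fun w => Finset.sum_nonneg fun _ _ => mul_self_nonneg _
  have h1 : ∑ i, π i * (v i ⬝ᵥ v i) ≤ ∑ i, π i * ((v i - v i₀) ⬝ᵥ (v i - v i₀)) := by
    have h2 : ∑ i, π i * ((v i - v i₀) ⬝ᵥ (v i - v i₀)) = ∑ i, π i * (v i ⬝ᵥ v i)
        - 2 * ((∑ i, π i • v i) ⬝ᵥ v i₀) + (∑ i, π i) * (v i₀ ⬝ᵥ v i₀) := by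
      simp only [sum_dotProduct, smul_dotProduct, smul_eq_mul, Finset.mul_sum, Finset.sum_mul,
        ← Finset.sum_sub_distrib, ← Finset.sum_add_distrib]
      refine Finset.sum_congr rfl fun i _ => ?_
      rw [sub_dotProduct, dotProduct_sub, dotProduct_sub, dotProduct_comm (v i₀) (v i)]
      ring
    rw [h2, hv.centred, zero_dotProduct]
    have := mul_nonneg (Finset.sum_nonneg fun i (_ : i ∈ Finset.univ) => (hπ i).le) (hnn (v i₀))
    linarith
  have h2 : ∑ i, π i * ((v i - v i₀) ⬝ᵥ (v i - v i₀))
      ≤ ∑ i, matchDegree π {i₀} i * ((v i - v i₀) ⬝ᵥ (v i - v i₀)) := by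
    refine Finset.sum_le_sum fun i _ => ?_
    by_cases h : i = i₀
    · simp [h]
    · simp [matchDegree, h]
  have h3 : ∑ i, matchDegree π {i₀} i * ((v i - v i₀) ⬝ᵥ (v i - v i₀))
      = ∑ i, ∑ j, D i j * ((v i - v j) ⬝ᵥ (v i - v j)) := by
    have h4 : ∑ i, matchDegree π {i₀} i * ((v i - v i₀) ⬝ᵥ (v i - v i₀))
        = ∑ i, ∑ j, D i j * ((v i - v i₀) ⬝ᵥ (v i - v i₀))
          + ∑ i, ∑ j, D i j * ((v j - v i₀) ⬝ᵥ (v j - v i₀)) := by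
      rw [Finset.sum_comm (f := fun i j => D i j * ((v j - v i₀) ⬝ᵥ (v j - v i₀)))]
      simp only [← Finset.sum_mul, ← Finset.sum_add_distrib, ← add_mul, hD.sum_out, hD.sum_in,
        add_halves]
    rw [h4]
    simp only [← Finset.sum_add_distrib]
    refine Finset.sum_congr rfl fun i _ => Finset.sum_congr rfl fun j _ => ?_
    by_cases h0 : D i j = 0
    · simp [h0]
    · have hc := hD.crossing i j h0
      rw [Finset.mem_singleton, Finset.mem_singleton] at hc
      rw [← mul_add]
      congr 1
      by_cases hi : i = i₀
      · rw [hi, sub_self, zero_dotProduct, zero_add, ← neg_sub (v i₀) (v j), neg_dotProduct,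
          dotProduct_neg, neg_neg]
      · have hj : j = i₀ := by
          by_contra hj
          exact hi (hc.2 hj)
        rw [hj, sub_self, zero_dotProduct, add_zero]
  rw [hv.weight] at h1
  linarith

theorem two_thirds_lt_log_card [Nontrivial V] : 2 / 3 < Real.log (Fintype.card V) := by
  have h1 : (2 : ℝ) ≤ Fintype.card V := by exact_mod_cast Fintype.one_lt_card
  have h2 := Real.log_le_log two_pos h1
  have := Real.log_two_gt_d9
  linarith

/-- One round of the game in expectation. The function `h` stands for the relative potential after
the round; it vanishes if the round ends with a cut. The expected gain is at least
`1 / (1056 log n)`, and `67584 = 64 · 1056`. -/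
theorem lintegral_round_le [Nontrivial V] (hπ : ∀ i, 0 < π i)
    {gram : Matrix V V ℝ → V → V → ℝ} (hgram : ∀ Y x, IsGram Y x → IsGram Y (gram Y))
    (hist : List (V → V → ℝ)) (h : (V → ℝ) → ENNReal)
    (hh : ∀ u, h u = 0 ∨ ∃ D, IsMatchingDemand π (cutPlayer π (1 / 4) 4 gram hist u) D ∧
      h u ≤ ENNReal.ofReal (1 - gain π hist D / 64)) :
    ∫⁻ u, h u ∂gaussianVector V
      ≤ ENNReal.ofReal (1 - 1 / (67584 * Real.log (Fintype.card V))) := by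
  obtain ⟨y, hy⟩ := exists_isGram (posSemidef_gramTarget hπ hist)
  have hv := hgram _ _ hy
  set v := gram (gramTarget π hist) with hvdef
  have hemb := isCutEmbedding_of_isGram hπ hv
  set ℓ := Real.log (Fintype.card V) with hℓ
  have hℓ2 : 2 / 3 < ℓ := two_thirds_lt_log_card
  by_cases hheavy : ∃ i, vertexWeight π Finset.univ / 4 ≤ π i
  · have hle : ∀ u, h u ≤ ENNReal.ofReal (1 - 1 / (67584 * ℓ)) := fun u => by
      rcases hh u with h0 | ⟨D, hD, hDle⟩
      · rw [h0]; exact zero_le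
      · refine hDle.trans (ENNReal.ofReal_le_ofReal ?_)
        rcases cutPlayer_cases (π := π) gram (1 / 4) 4 hist u with ⟨i, -, he⟩ | ⟨hl, -⟩
        · rw [he] at hD
          have h1 := gain_ge_of_singleton hπ hemb hD
          rw [← gain_eq hv] at h1
          have h2 : 1 / (67584 * ℓ) ≤ 1 / 128 :=
            one_div_le_one_div_of_le (by norm_num) (by linarith)
          linarith
        · obtain ⟨i, hi⟩ := hheavy
          exact absurd hi (not_le.2 (hl i))
    refine (lintegral_mono hle).trans ?_
    simp
  · -- the expectation of `2 s a - s² M` is optimized, up to constants, by `s = 1 / (44 log n)`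
    set s := 1 / (44 * ℓ) with hs
    have hs0 : 0 < s := by positivity
    have hsℓ : s * ℓ = 1 / 44 := by rw [hs]; field_simp
    set F : (V → ℝ) → ℝ := fun u => (2 * s * spread π v u - s ^ 2 * stretch v u) / 6 with hF
    have hFi : Integrable F (gaussianVector V) :=
      (((integrable_spread π v).const_mul _).sub ((integrable_stretch v).const_mul _)).div_const _
    have hM0 : ∀ u, 0 < stretch v u := fun u => by
      have h1 : 0 ≤ (∑ i, ∑ j, Real.exp (sqProj (v i - v j) u / 4)) / (Fintype.card V : ℝ) ^ 2 :=
        div_nonneg (Finset.sum_nonneg fun _ _ => Finset.sum_nonneg fun _ _ => (Real.exp_pos _).le)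
          (sq_nonneg _)
      unfold stretch
      linarith
    have hF64 : ∀ u, 0 ≤ 1 - F u / 64 := fun u => by
      have h1 := (spread_bounds hπ hemb u).2
      have h2 := (spread_bounds hπ hemb u).1
      have h3 : s ≤ 1 := by
        rw [hs, div_le_one (by positivity)]; linarith
      have h4 := mul_nonneg (sq_nonneg s) (hM0 u).le
      have h5 : s * spread π v u ≤ 1 := mul_le_one₀ h3 h2 h1
      simp only [hF]
      linarith
    have hEF : 1 / (1056 * ℓ) ≤ ∫ u, F u ∂gaussianVector V := by
      have h1 := integral_spread_ge hπ hemb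
      have h2 := integral_stretch_le v
      rw [← hℓ] at h2
      simp only [hF]
      rw [integral_div, integral_sub ((integrable_spread π v).const_mul _)
        ((integrable_stretch v).const_mul _), integral_const_mul, integral_const_mul]
      have h3 := mul_le_mul_of_nonneg_left h1 hs0.le
      have h4 := mul_le_mul_of_nonneg_left h2 (sq_nonneg s)
      have h5 : s ^ 2 * (8 * ℓ + 2) ≤ s / 4 := by
        have : s ^ 2 * (8 * ℓ + 2) ≤ s ^ 2 * (11 * ℓ) :=
          mul_le_mul_of_nonneg_left (by linarith) (sq_nonneg s)
        have h6 : s ^ 2 * (11 * ℓ) = s * (11 * (s * ℓ)) := by ring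
        rw [h6, hsℓ] at this
        linarith
      have h6 : 1 / (1056 * ℓ) = s / 24 := by rw [hs]; field_simp; norm_num
      rw [h6]
      linarith
    have hae : ∀ᵐ u ∂gaussianVector V, h u ≤ ENNReal.ofReal (1 - F u / 64) := by
      have hinj : ∀ᵐ u ∂gaussianVector V, ∀ i j, i ≠ j → u ⬝ᵥ v i ≠ u ⬝ᵥ v j := by
        simp only [ae_all_iff]
        exact fun i j hij => ae_dotProduct_ne (hemb.injective i j hij)
      filter_upwards [hinj] with u hu
      rcases hh u with h0 | ⟨D, hD, hDle⟩
      · rw [h0]; exact zero_le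
      · refine hDle.trans (ENNReal.ofReal_le_ofReal ?_)
        rcases cutPlayer_cases (π := π) gram (1 / 4) 4 hist u with ⟨i, hi, -⟩ | ⟨hl, he⟩
        · exact absurd ⟨i, hi⟩ hheavy
        · rw [he (fun i => u ⬝ᵥ v i) rfl] at hD
          have h1 := variance_le_stretch_mul hπ hemb u hu hl hD
          rw [← gain_eq hv] at h1
          have h2 := (sq_spread_le hπ hemb u).trans h1
          have h3 : 2 * s * spread π v u - s ^ 2 * stretch v u ≤ 6 * gain π hist D := by
            by_contra hcon
            have h4 := mul_lt_mul_of_pos_right (not_le.1 hcon) (hM0 u)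
            nlinarith [sq_nonneg (spread π v u - s * stretch v u)]
          simp only [hF]
          linarith
    refine (lintegral_mono_ae hae).trans ?_
    rw [← ofReal_integral_eq_lintegral_ofReal (f := fun u => 1 - F u / 64)
      ((integrable_const _).sub (hFi.div_const _)) (Filter.Eventually.of_forall hF64),
      integral_sub (integrable_const _) (hFi.div_const _),
      integral_div]
    refine ENNReal.ofReal_le_ofReal ?_
    simp only [integral_const, probReal_univ, one_smul]
    have h1 : 1 / (67584 * ℓ) = 1 / (1056 * ℓ) / 64 := by field_simp; norm_num
    rw [h1]
    linarith

end Gaussian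

/-! ### The game -/

namespace FlowProg

variable {V : Type u} {β : Type v} {γ : Type w}

theorem eval_bind (solve : FlowNetwork (NetNode V) → NetNode V → NetNode V → ℝ)
    (p : FlowProg V β) (g : β → FlowProg V γ) :
    (p.bind g).eval solve = (g (p.eval solve)).eval solve := by
  induction p with
  | ret x => rfl
  | maxFlow N k ih => exact ih _

theorem flowCount_bind (solve : FlowNetwork (NetNode V) → NetNode V → NetNode V → ℝ)
    (p : FlowProg V β) (g : β → FlowProg V γ) :
    (p.bind g).flowCount solve = p.flowCount solve + (g (p.eval solve)).flowCount solve := by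
  induction p with
  | ret x => exact (zero_add _).symm
  | maxFlow N k ih =>
    change (((k (solve N)).bind g).flowCount solve + 1) = ((k (solve N)).flowCount solve + 1) + _
    rw [ih]
    exact add_right_comm _ _ _

end FlowProg

section Game

open MeasureTheory

variable {V : Type u} [Fintype V] [DecidableEq V] (sub : Subroutines V) (G : CapDigraph V)
  (π : V → ℝ) (κ : ℝ)

theorem flowCount_cmRound (hist : List (V → V → ℝ)) (v : V → ℝ) :
    (cmRound sub G π κ hist v).flowCount sub.solve = 2 := by
  rw [cmRound_eq, matchingRound, FlowProg.flowCount_bind]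
  simp only [bidirectionalMaxFlow, FlowProg.flowCount, FlowProg.eval]
  split_ifs <;> rfl

theorem flowCount_cmLoop_le (us : List (V → ℝ)) (hist : List (V → V → ℝ)) :
    (cmLoop sub G π κ us hist).flowCount sub.solve ≤ 2 * us.length := by
  induction us generalizing hist with
  | nil => exact Nat.zero_le _
  | cons u us ih =>
    rw [cmLoop, FlowProg.flowCount_bind, flowCount_cmRound, List.length_cons]
    cases h : (cmRound sub G π κ hist u).eval sub.solve with
    | cut S =>
      change 2 + 0 ≤ _
      omega
    | demand D =>
      have := ih (hist ++ [D])
      change 2 + (cmLoop sub G π κ us (hist ++ [D])).flowCount sub.solve ≤ _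
      omega

theorem flowCount_cutMatching_le {T : ℕ} (u : Fin T → V → ℝ) :
    (cutMatching sub G π κ u).flowCount sub.solve ≤ 2 * T := by
  have h := flowCount_cmLoop_le sub G π κ (List.ofFn u) []
  rwa [List.length_ofFn] at h

theorem flowCount_cutMatchingSearch_le {T : ℕ} (u : Fin T → V → ℝ) (K : ℕ) :
    (cutMatchingSearch sub G π u κ K).flowCount sub.solve ≤ 2 * T * K := by
  induction K generalizing κ with
  | zero => exact Nat.zero_le _
  | succ K ih =>
    rw [cutMatchingSearch, FlowProg.flowCount_bind, FlowProg.flowCount_bind]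
    have h1 := flowCount_cutMatching_le sub G π κ u
    have h2 := ih (2 * κ)
    simp only [FlowProg.flowCount]
    rw [Nat.mul_succ]
    omega

/-- The result of a round in which the cut player chooses `L`. -/
noncomputable def roundOutput (L : Finset V) : CMOutput V :=
  (matchingRound sub G π κ L).eval sub.solve

/-- The output of the game if the bipartition of the next round is `L` and the later rounds use the
vectors `us`. -/
noncomputable def gameOutput (us : List (V → ℝ)) (hist : List (V → V → ℝ)) (L : Finset V) :
    CMOutput V :=
  match roundOutput sub G π κ L with
  | .cut S => .cut S
  | .demand D => (cmLoop sub G π κ us (hist ++ [D])).eval sub.solve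

variable {sub G π κ} in
theorem gameOutput_of_cut {us : List (V → ℝ)} {hist : List (V → V → ℝ)} {L S : Finset V}
    (h : roundOutput sub G π κ L = .cut S) : gameOutput sub G π κ us hist L = .cut S := by
  rw [gameOutput, h]

variable {sub G π κ} in
theorem gameOutput_of_demand {us : List (V → ℝ)} {hist : List (V → V → ℝ)} {L : Finset V}
    {D : V → V → ℝ} (h : roundOutput sub G π κ L = .demand D) :
    gameOutput sub G π κ us hist L
      = (cmLoop sub G π κ us (hist ++ [D])).eval sub.solve := by
  rw [gameOutput, h]

theorem eval_cmLoop_cons (u : V → ℝ) (us : List (V → ℝ)) (hist : List (V → V → ℝ)) :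
    (cmLoop sub G π κ (u :: us) hist).eval sub.solve
      = gameOutput sub G π κ us hist (cutPlayer π (1 / 4) 4 sub.gram hist u) := by
  rw [cmLoop, FlowProg.eval_bind, cmRound_eq, gameOutput, roundOutput]
  cases (matchingRound sub G π κ (cutPlayer π (1 / 4) 4 sub.gram hist u)).eval sub.solve <;> rfl

/-- The properties of the demand graphs of all rounds. -/
structure IsPlayable (D : V → V → ℝ) : Prop where
  boundedDegree : HasBoundedDegree π D
  isEulerian : IsEulerian D
  routes : ∃ f, Routes G κ f D

variable {sub G π κ}

theorem roundOutput_spec [Nonempty V] (hκ : 0 < κ) (hπ : ∀ i, 0 < π i)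
    (gram : Matrix V V ℝ → V → V → ℝ) (hist : List (V → V → ℝ)) (u : V → ℝ) {L : Finset V}
    (hL : L = cutPlayer π (1 / 4) 4 gram hist u) :
    (∀ S, roundOutput sub G π κ L = .cut S →
      S.Nonempty ∧ S ≠ Finset.univ ∧ setExpansion G.cap π S ≤ 3 / κ) ∧
    (∀ D, roundOutput sub G π κ L = .demand D → IsMatchingDemand π L D ∧ IsPlayable G π κ D) := by
  subst hL
  obtain ⟨h1, h2⟩ := cutPlayer_spec hπ gram (1 / 4) 4 hist u
  obtain ⟨h3, h4⟩ := matchingRound_spec (sub := sub) (G := G) hκ hπ h1 h2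
  refine ⟨h3, fun D hD => ?_⟩
  obtain ⟨h5, h6⟩ := h4 D hD
  refine ⟨h5, ⟨h5.nonneg, fun i => ?_⟩, h5.isEulerian, h6⟩
  rw [h5.sum_out, h5.sum_in, add_halves]
  exact matchDegree_le hπ h1 h2 i

theorem eval_cmLoop_spec [Nonempty V] (hκ : 0 < κ) (hπ : ∀ i, 0 < π i) (us : List (V → ℝ))
    (hist : List (V → V → ℝ)) (hh : ∀ D ∈ hist, IsPlayable G π κ D) :
    (∀ S, (cmLoop sub G π κ us hist).eval sub.solve = .cut S →
      S.Nonempty ∧ S ≠ Finset.univ ∧ setExpansion G.cap π S ≤ 3 / κ) ∧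
    (∀ D, (cmLoop sub G π κ us hist).eval sub.solve = .demand D →
      ∃ hist' : List (V → V → ℝ), hist'.length = hist.length + us.length ∧
        (∀ D ∈ hist', IsPlayable G π κ D) ∧ D = (hist'.length : ℝ)⁻¹ • hist'.sum) := by
  induction us generalizing hist with
  | nil =>
    refine ⟨fun S hS => by simp [cmLoop, FlowProg.eval] at hS, fun D hD => ?_⟩
    simp only [cmLoop, FlowProg.eval, CMOutput.demand.injEq] at hD
    exact ⟨hist, rfl, hh, hD.symm⟩
  | cons u us ih =>
    rw [eval_cmLoop_cons, gameOutput]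
    obtain ⟨h1, h2⟩ := roundOutput_spec (sub := sub) (G := G) hκ hπ sub.gram hist u rfl
    cases h : roundOutput sub G π κ (cutPlayer π (1 / 4) 4 sub.gram hist u) with
    | cut S =>
      exact ⟨fun S' hS' => h1 S' (h.trans hS'), fun D hD => by simp at hD⟩
    | demand D =>
      obtain ⟨h3, h4⟩ := ih (hist ++ [D]) fun D' hD' => by
        rcases List.mem_append.1 hD' with h' | h'
        · exact hh D' h'
        · rw [List.mem_singleton.1 h']
          exact (h2 D h).2
      refine ⟨h3, fun D' hD' => ?_⟩
      obtain ⟨hist', h5, h6⟩ := h4 D' hD'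
      refine ⟨hist', ?_, h6⟩
      rw [h5, List.length_append, List.length_singleton, List.length_cons]
      ring

theorem isEulerian_sum (hist : List (V → V → ℝ)) (h : ∀ D ∈ hist, IsEulerian D) :
    IsEulerian hist.sum := by
  induction hist with
  | nil => simp [IsEulerian]
  | cons D hist ih =>
    obtain ⟨h1, h2⟩ := h D (by simp)
    obtain ⟨h3, h4⟩ := ih fun D' hD' => h D' (by simp [hD'])
    rw [List.sum_cons]
    refine ⟨fun i j => add_nonneg (h1 i j) (h3 i j), fun i => ?_⟩
    simp only [Pi.add_apply, Finset.sum_add_distrib, h2 i, h4 i]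

theorem eval_cutMatching_demand [Nonempty V] (hκ : 0 < κ) (hπ : ∀ i, 0 < π i) {T : ℕ} (hT : 0 < T)
    (u : Fin T → V → ℝ) {D : V → V → ℝ}
    (hD : (cutMatching sub G π κ u).eval sub.solve = .demand D) :
    IsEulerian D ∧ ∃ f, Routes G κ f D ∧ IsEulerian (pathLoad f) := by
  obtain ⟨hist, h1, h2, rfl⟩ := (eval_cmLoop_spec hκ hπ (List.ofFn u) [] (by simp)).2 D hD
  have hlen : hist.length = T := by simpa using h1
  have hE := isEulerian_sum hist fun D hD => (h2 D hD).isEulerian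
  have hE' : IsEulerian ((hist.length : ℝ)⁻¹ • hist.sum) := by
    refine ⟨fun i j => mul_nonneg (by positivity) (hE.1 i j), fun i => ?_⟩
    simp only [Pi.smul_apply, smul_eq_mul, ← Finset.mul_sum, hE.2 i]
  obtain ⟨f, hf⟩ := exists_routes_sum hist fun D hD => (h2 D hD).routes
  have hf' := hf.smul (c := (hist.length : ℝ)⁻¹) (by positivity)
  have hne : (hist.length : ℝ) ≠ 0 := by
    rw [hlen]; exact_mod_cast hT.ne'
  rw [inv_mul_cancel_left₀ hne] at hf'
  exact ⟨hE', _, hf', hf'.isEulerian_pathLoad hE'⟩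

/-! ### Measurability of the output -/

/-- The lower median cut in terms of finitely many comparisons. -/
theorem le_weightedMedian_iff [Nonempty V] (hπ : ∀ i, 0 < π i) (x : V → ℝ) (i : V) :
    x i ≤ weightedMedian π x ↔
      (∑ j, if x j < x i then π j else 0) < vertexWeight π Finset.univ / 2 := by
  rw [← Finset.sum_filter]
  constructor
  · intro h
    refine lt_of_le_of_lt ?_ (vertexWeight_lt_weightedMedian hπ x)
    refine Finset.sum_le_sum_of_subset_of_nonneg (fun j hj => ?_) fun j _ _ => (hπ j).le
    simp only [Finset.mem_filter, Finset.mem_univ, true_and] at hj ⊢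
    exact hj.trans_le h
  · intro h
    by_contra hcon
    push Not at hcon
    refine absurd ((weightedMedian_mem hπ x).2.trans ?_) (not_le.2 h)
    refine Finset.sum_le_sum_of_subset_of_nonneg (fun j hj => ?_) fun j _ _ => (hπ j).le
    simp only [Finset.mem_filter, Finset.mem_univ, true_and] at hj ⊢
    exact hj.trans_lt hcon

theorem measurableSet_cutPlayer [Nonempty V] (hπ : ∀ i, 0 < π i)
    (gram : Matrix V V ℝ → V → V → ℝ) (η ρ : ℝ) (hist : List (V → V → ℝ)) (L : Finset V) :
    MeasurableSet {u | cutPlayer π η ρ gram hist u = L} := by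
  by_cases h : ∃ i, vertexWeight π Finset.univ / 4 ≤ π i
  · simp only [cutPlayer, dif_pos h]
    exact MeasurableSet.const _
  · simp only [cutPlayer, dif_neg h, Finset.ext_iff, Finset.mem_filter, Finset.mem_univ, true_and]
    set w := gram (invSqrtDiag π * density π η ρ hist * invSqrtDiag π)
    have hset : {u : V → ℝ | ∀ i, dotProduct u (w i) ≤ weightedMedian π
        (fun i => dotProduct u (w i)) ↔ i ∈ L} = ⋂ i, {u | (∑ j, if dotProduct u (w j)
          < dotProduct u (w i) then π j else 0) < vertexWeight π Finset.univ / 2 ↔ i ∈ L} := by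
      ext u
      simp only [Set.mem_ofPred_eq, Set.mem_iInter]
      exact forall_congr' fun i => iff_congr
        (le_weightedMedian_iff hπ (fun i => dotProduct u (w i)) i) Iff.rfl
    rw [hset]
    refine MeasurableSet.iInter fun i => ?_
    have hm : MeasurableSet {u : V → ℝ | (∑ j, if dotProduct u (w j) < dotProduct u (w i)
        then π j else 0) < vertexWeight π Finset.univ / 2} := by
      refine measurableSet_lt (Finset.measurable_sum _ fun j _ => ?_) measurable_const
      exact Measurable.ite (measurableSet_lt (measurable_dotProduct_const _)
        (measurable_dotProduct_const _)) measurable_const measurable_const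
    by_cases hi : i ∈ L
    · simpa only [hi, iff_true] using hm
    · simp only [hi, iff_false]
      exact hm.compl

/-- A function of the first bipartition and of the remaining vectors is measurable if it is
measurable for each of the finitely many bipartitions. -/
theorem measurable_comp_cutPlayer [Nonempty V] (hπ : ∀ i, 0 < π i)
    (gram : Matrix V V ℝ → V → V → ℝ) (η ρ : ℝ) (hist : List (V → V → ℝ)) {α : Type v}
    [MeasurableSpace α] (F : Finset V → α → ENNReal) (hF : ∀ L, Measurable (F L)) :
    Measurable fun z : (V → ℝ) × α => F (cutPlayer π η ρ gram hist z.1) z.2 := by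
  let _ : MeasurableSpace (Finset V) := ⊤
  have h1 : Measurable fun u => cutPlayer π η ρ gram hist u :=
    measurable_to_countable' fun L => measurableSet_cutPlayer hπ gram η ρ hist L
  have h2 : Measurable fun z : Finset V × α => F z.1 z.2 :=
    measurable_from_prod_countable_right fun L => hF L
  exact h2.comp ((h1.comp measurable_fst).prodMk measurable_snd)

theorem gaussianSeeds_eq (T : ℕ) :
    gaussianSeeds V T = Measure.pi fun _ => gaussianVector V := rfl

instance (T : ℕ) : IsProbabilityMeasure (gaussianSeeds V T) := by
  rw [gaussianSeeds_eq]; infer_instance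

theorem measurable_cmLoop [Nonempty V] (hπ : ∀ i, 0 < π i) (g : CMOutput V → ENNReal) (k : ℕ)
    (hist : List (V → V → ℝ)) :
    Measurable fun u : Fin k → V → ℝ =>
      g ((cmLoop sub G π κ (List.ofFn u) hist).eval sub.solve) := by
  induction k generalizing hist with
  | zero => simp only [List.ofFn_zero]; exact measurable_const
  | succ k ih =>
    simp only [List.ofFn_succ, eval_cmLoop_cons]
    let F : Finset V → (Fin k → V → ℝ) → ENNReal := fun L b =>
      g (gameOutput sub G π κ (List.ofFn b) hist L)
    have hF : ∀ L, Measurable (F L) := fun L => by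
      cases h : roundOutput sub G π κ L with
      | cut S =>
        simp only [F, gameOutput_of_cut h]
        exact measurable_const
      | demand D =>
        simp only [F, gameOutput_of_demand h]
        exact ih (hist ++ [D])
    have h2 : Measurable fun u : Fin (k + 1) → V → ℝ => (u 0, fun i : Fin k => u i.succ) :=
      (measurable_pi_apply 0).prodMk (measurable_pi_lambda _ fun i => measurable_pi_apply i.succ)
    have h3 := measurable_comp_cutPlayer hπ sub.gram (1 / 4) 4 hist F hF
    have h4 := h3.comp h2
    simp only [Function.comp_def, F] at h4
    exact h4

theorem lintegral_gaussianSeeds_succ {k : ℕ} (F : (V → ℝ) × (Fin k → V → ℝ) → ENNReal)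
    (hF : Measurable F) :
    ∫⁻ u, F (u 0, fun i => u i.succ) ∂gaussianSeeds V (k + 1)
      = ∫⁻ a, ∫⁻ b, F (a, b) ∂gaussianSeeds V k ∂gaussianVector V := by
  have h1 := (measurePreserving_piFinSuccAbove
    (fun _ : Fin (k + 1) => gaussianVector V) 0).lintegral_comp hF
  rw [lintegral_prod _ hF.aemeasurable] at h1
  exact h1

/-! ### The potential at the end of the game -/

/-- The potential of an output after `T` rounds. It is zero for cuts, so that only runs without a
cut contribute to its expectation. -/
noncomputable def outputPotential (π : V → ℝ) (T : ℕ) : CMOutput V → ENNReal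
  | .cut _ => 0
  | .demand D => ENNReal.ofReal (potential π [(T : ℝ) • D])

theorem symLaplacian_add (D D' : V → V → ℝ) :
    symLaplacian (D + D') = symLaplacian D + symLaplacian D' := by
  ext i j
  by_cases h : i = j
  · subst h
    simp only [symLaplacian, Matrix.sub_apply, Matrix.diagonal_apply_eq, Matrix.of_apply,
      Pi.add_apply, Matrix.add_apply]
    rw [← sub_eq_zero]
    have : ∑ k, (D i k + D' i k + (D k i + D' k i)) / 2
        = ∑ k, (D i k + D k i) / 2 + ∑ k, (D' i k + D' k i) / 2 := by
      rw [← Finset.sum_add_distrib]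
      exact Finset.sum_congr rfl fun k _ => by ring
    rw [this]
    ring
  · simp only [symLaplacian, Matrix.sub_apply, Matrix.diagonal_apply_ne _ h, Matrix.of_apply,
      Pi.add_apply, Matrix.add_apply]
    ring

theorem symLaplacian_smul (c : ℝ) (D : V → V → ℝ) :
    symLaplacian (c • D) = c • symLaplacian D := by
  ext i j
  by_cases h : i = j
  · subst h
    simp only [symLaplacian, Matrix.sub_apply, Matrix.diagonal_apply_eq, Matrix.of_apply,
      Pi.smul_apply, Matrix.smul_apply, smul_eq_mul, mul_sub, Finset.mul_sum]
    congr 1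
    · exact Finset.sum_congr rfl fun k _ => by ring
    · ring
  · simp only [symLaplacian, Matrix.sub_apply, Matrix.diagonal_apply_ne _ h, Matrix.of_apply,
      Pi.smul_apply, Matrix.smul_apply, smul_eq_mul]
    ring

theorem feedback_sum (hist : List (V → V → ℝ)) :
    (hist.map (feedback π)).sum = feedback π hist.sum := by
  induction hist with
  | nil =>
    have h0 : symLaplacian (0 : V → V → ℝ) = 0 := by
      have := symLaplacian_smul 0 (0 : V → V → ℝ)
      rwa [zero_smul, zero_smul] at this
    simp [feedback, h0]
  | cons D hist ih =>
    rw [List.map_cons, List.sum_cons, List.sum_cons, ih, feedback, feedback, feedback,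
      symLaplacian_add, mul_add, add_mul]

theorem potential_singleton_sum (hist : List (V → V → ℝ)) :
    potential π [hist.sum] = potential π hist := by
  simp only [potential, expWeight, feedbackSum, feedback_sum, List.sum_singleton]

theorem lintegral_outputPotential_le [Nontrivial V] (hκ : 0 < κ) (hπ : ∀ i, 0 < π i) {T : ℕ}
    (hT : 0 < T) (k : ℕ) (hist : List (V → V → ℝ)) (hk : hist.length + k = T) :
    ∫⁻ u, outputPotential π T ((cmLoop sub G π κ (List.ofFn u) hist).eval sub.solve)
        ∂gaussianSeeds V k
      ≤ ENNReal.ofReal ((1 - 1 / (67584 * Real.log (Fintype.card V))) ^ k * potential π hist) := by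
  have hq : 0 ≤ 1 - 1 / (67584 * Real.log (Fintype.card V)) := by
    have := two_thirds_lt_log_card (V := V)
    rw [sub_nonneg, div_le_one (by positivity)]
    linarith
  set q := 1 - 1 / (67584 * Real.log (Fintype.card V)) with hqdef
  induction k generalizing hist with
  | zero =>
    simp only [List.ofFn_zero, lintegral_const, measure_univ, mul_one, pow_zero, one_mul]
    rw [add_zero] at hk
    simp only [cmLoop, FlowProg.eval, outputPotential, hk]
    rw [smul_inv_smul₀ (by exact_mod_cast hT.ne'), potential_singleton_sum]
  | succ k ih =>
    simp only [List.ofFn_succ, eval_cmLoop_cons]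
    let F : Finset V → (Fin k → V → ℝ) → ENNReal := fun L b =>
      outputPotential π T (gameOutput sub G π κ (List.ofFn b) hist L)
    have hF : ∀ L, Measurable (F L) := fun L => by
      cases h : roundOutput sub G π κ L with
      | cut S =>
        simp only [F, gameOutput_of_cut h]
        exact measurable_const
      | demand D =>
        simp only [F, gameOutput_of_demand h]
        exact measurable_cmLoop hπ _ _ _
    refine (lintegral_gaussianSeeds_succ _
      (measurable_comp_cutPlayer hπ sub.gram (1 / 4) 4 hist F hF)).trans_le ?_
    have hpos := potential_pos hπ hist
    set h : (V → ℝ) → ENNReal := fun a =>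
      match roundOutput sub G π κ (cutPlayer π (1 / 4) 4 sub.gram hist a) with
      | .cut _ => 0
      | .demand D => ENNReal.ofReal (1 - gain π hist D / 64) with hh
    have h1 : ∀ a, ∫⁻ b, F (cutPlayer π (1 / 4) 4 sub.gram hist a) b ∂gaussianSeeds V k
        ≤ ENNReal.ofReal (q ^ k * potential π hist) * h a := fun a => by
      obtain ⟨-, hspec⟩ := roundOutput_spec (sub := sub) (G := G) hκ hπ sub.gram hist a rfl
      simp only [hh, F]
      cases hr : roundOutput sub G π κ (cutPlayer π (1 / 4) 4 sub.gram hist a) with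
      | cut S =>
        simp only [gameOutput_of_cut hr, outputPotential]
        simp
      | demand D =>
        simp only [gameOutput_of_demand hr]
        refine (ih (hist ++ [D]) (by simp; omega)).trans ?_
        rw [← ENNReal.ofReal_mul (by positivity)]
        refine ENNReal.ofReal_le_ofReal ?_
        rw [mul_assoc]
        exact mul_le_mul_of_nonneg_left
          (potential_concat_le hπ hist (hspec D hr).2.boundedDegree) (by positivity)
    refine (lintegral_mono h1).trans ?_
    rw [lintegral_const_mul' _ _ ENNReal.ofReal_ne_top]
    have h2 := lintegral_round_le hπ sub.gram_spec hist h fun a => by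
      obtain ⟨-, hspec⟩ := roundOutput_spec (sub := sub) (G := G) hκ hπ sub.gram hist a rfl
      simp only [hh]
      cases hr : roundOutput sub G π κ (cutPlayer π (1 / 4) 4 sub.gram hist a) with
      | cut S => exact Or.inl rfl
      | demand D => exact Or.inr ⟨D, (hspec D hr).1, le_rfl⟩
    refine (mul_le_mul_right h2 _).trans ?_
    rw [← ENNReal.ofReal_mul (by positivity), ← hqdef]
    exact ENNReal.ofReal_le_ofReal (le_of_eq (by ring))

end Game

/-! ### From the spectral gap to expansion -/

section Expansion

open Matrix

variable {V : Type u} [Fintype V] [DecidableEq V] {π : V → ℝ}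

theorem IsEulerian.outWeight_compl {D : V → V → ℝ} (hD : IsEulerian D) (S : Finset V) :
    outWeight D Sᶜ = outWeight D S := by
  have h1 := FlowNetwork.sum_netOut D S
  have h2 : ∑ v ∈ S, FlowNetwork.netOut D v = 0 :=
    Finset.sum_eq_zero fun v _ => sub_eq_zero.2 (hD.2 v)
  rw [h2, Finset.sum_comm (s := S) (t := Sᶜ) (f := fun a b => D b a)] at h1
  simp only [outWeight, compl_compl]
  linarith

/-- The easy direction of Cheeger's inequality for Eulerian graphs. -/
theorem le_setExpansion_of_spectralGapGE (hπ : ∀ i, 0 < π i) {D : V → V → ℝ} (hD : IsEulerian D)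
    {c : ℝ} (hc : 0 ≤ c) (hgap : SpectralGapGE D π (2 * c)) {S : Finset V} (hS : S.Nonempty)
    (hSu : S ≠ Finset.univ) : c ≤ setExpansion D π S := by
  have hSc : Sᶜ.Nonempty := by
    rwa [Finset.nonempty_iff_ne_empty, Ne, Finset.compl_eq_empty_iff]
  have ha := vertexWeight_pos hπ hS
  have hb := vertexWeight_pos hπ hSc
  set a := vertexWeight π S with hadef
  set b := vertexWeight π Sᶜ with hbdef
  -- the test vector is the indicator function of `S`, shifted to have mean zero
  set x : V → ℝ := fun i => if i ∈ S then b else -a with hx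
  have hsplit : ∀ f : V → ℝ, ∑ i, f i = ∑ i ∈ S, f i + ∑ i ∈ Sᶜ, f i := fun f =>
    (Finset.sum_add_sum_compl S f).symm
  have hxS : ∀ i ∈ S, x i = b := fun i hi => if_pos hi
  have hxSc : ∀ i ∈ Sᶜ, x i = -a := fun i hi => if_neg (Finset.mem_compl.1 hi)
  have hmean : ∑ i, π i * x i = 0 := by
    rw [hsplit, Finset.sum_congr rfl fun i hi => by rw [hxS i hi],
      Finset.sum_congr (s₁ := Sᶜ) rfl fun i hi => by rw [hxSc i hi], ← Finset.sum_mul,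
      ← Finset.sum_mul]
    change a * b + b * -a = 0
    ring
  have hnorm : ∑ i, π i * x i ^ 2 = a * b * (a + b) := by
    rw [hsplit, Finset.sum_congr rfl fun i hi => by rw [hxS i hi],
      Finset.sum_congr (s₁ := Sᶜ) rfl fun i hi => by rw [hxSc i hi], ← Finset.sum_mul,
      ← Finset.sum_mul]
    change a * b ^ 2 + b * (-a) ^ 2 = _
    ring
  have hquad : ∑ i, ∑ j, D i j * (x i - x j) ^ 2
      = (outWeight D S + outWeight D Sᶜ) * (a + b) ^ 2 := by
    rw [hsplit, add_mul, outWeight, outWeight, Finset.sum_mul, Finset.sum_mul]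
    congr 1
    · refine Finset.sum_congr rfl fun i hi => ?_
      rw [hsplit, Finset.sum_eq_zero fun j hj => by rw [hxS i hi, hxS j hj]; ring, zero_add,
        Finset.sum_mul]
      exact Finset.sum_congr rfl fun j hj => by rw [hxS i hi, hxSc j hj]; ring
    · refine Finset.sum_congr rfl fun i hi => ?_
      rw [hsplit, Finset.sum_eq_zero (s := Sᶜ) fun j hj => by rw [hxSc i hi, hxSc j hj]; ring,
        add_zero, Finset.sum_mul, compl_compl]
      exact Finset.sum_congr rfl fun j hj => by rw [hxSc i hi, hxS j hj]; ring
  have h1 := hgap x hmean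
  rw [symLaplacian_quadratic, hnorm, hquad, hD.outWeight_compl] at h1
  rw [setExpansion, hD.outWeight_compl, min_self, le_div_iff₀ (lt_min ha hb)]
  have h2 : 2 * c * (a * b) ≤ outWeight D S * (a + b) := by
    have hab : 0 < a + b := by linarith
    refine le_of_mul_le_mul_right ?_ hab
    linarith
  refine le_of_mul_le_mul_right (h2.trans' ?_) (by linarith : 0 < a + b)
  rcases min_cases a b with ⟨hm, hle⟩ | ⟨hm, hle⟩ <;> rw [hm]
  · nlinarith [mul_nonneg hc ha.le]
  · nlinarith [mul_nonneg hc hb.le]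

/-- Every path that leaves `S` uses an arc that leaves `S`. -/
theorem Routes.outWeight_le {G : CapDigraph V} {κ : ℝ} {f : List V →₀ ℝ} {D : V → V → ℝ}
    (h : Routes G κ f D) (S : Finset V) : outWeight D S ≤ κ * outWeight G.cap S := by
  have h1 : outWeight D S ≤ outWeight (pathLoad f) S := by
    simp only [outWeight, ← h.2.2.2, pathLoad_eq_sum, pathDemand, Finsupp.sum]
    have hswap : ∀ F : V → V → List V → ℝ, ∑ i ∈ S, ∑ j ∈ Sᶜ, ∑ l ∈ f.support, F i j l
        = ∑ l ∈ f.support, ∑ i ∈ S, ∑ j ∈ Sᶜ, F i j l := fun F => by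
      rw [Finset.sum_comm]
      rw [Finset.sum_congr rfl fun j _ => Finset.sum_comm, Finset.sum_comm]
      exact Finset.sum_congr rfl fun l _ => Finset.sum_comm
    rw [hswap, hswap]
    refine Finset.sum_le_sum fun l hl => ?_
    obtain ⟨a, b, hp⟩ := h.2.1 l hl
    simp only [hp.2.2.1, hp.2.2.2, Option.some.injEq, ← Finset.mul_sum]
    have h2 : ∑ v ∈ S, FlowNetwork.netOut (arcLoad l) v
        = (if a ∈ S then 1 else 0) - (if b ∈ S then 1 else 0) := by
      simp only [hp.netOut_arcLoad, Finset.sum_sub_distrib, Finset.sum_ite_eq']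
    rw [FlowNetwork.sum_netOut] at h2
    have h3 : 0 ≤ ∑ i ∈ S, ∑ j ∈ Sᶜ, arcLoad l j i :=
      Finset.sum_nonneg fun i _ => Finset.sum_nonneg fun j _ => arcLoad_nonneg l j i
    have h4 : 0 ≤ ∑ i ∈ S, ∑ j ∈ Sᶜ, arcLoad l i j :=
      Finset.sum_nonneg fun i _ => Finset.sum_nonneg fun j _ => arcLoad_nonneg l i j
    have h5 : ∑ i ∈ S, ∑ j ∈ Sᶜ, (if a = i ∧ b = j then f l else 0)
        = if a ∈ S ∧ b ∉ S then f l else 0 := by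
      have e : ∀ i ∈ S, (∑ j ∈ Sᶜ, if a = i ∧ b = j then f l else 0)
          = if a = i then (if b ∈ Sᶜ then f l else 0) else 0 := fun i _ => by
        by_cases hi : a = i <;> simp [hi]
      rw [Finset.sum_congr rfl e, Finset.sum_ite_eq]
      by_cases ha : a ∈ S <;> by_cases hb : b ∈ S <;> simp [ha, hb]
    rw [h5]
    split_ifs with hab
    · rw [if_pos hab.1, if_neg hab.2] at h2
      exact le_mul_of_one_le_right (h.1 l) (by linarith)
    · exact mul_nonneg (h.1 l) h4
  refine h1.trans ?_
  simp only [outWeight, Finset.mul_sum]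
  exact Finset.sum_le_sum fun i _ => Finset.sum_le_sum fun j _ => h.2.2.1 i j

theorem Routes.setExpansion_le {G : CapDigraph V} {κ : ℝ} (hκ : 0 ≤ κ) {f : List V →₀ ℝ}
    {D : V → V → ℝ} (h : Routes G κ f D) (hπ : ∀ i, 0 < π i) (S : Finset V) :
    setExpansion D π S ≤ κ * setExpansion G.cap π S := by
  rw [setExpansion, setExpansion, ← mul_div_assoc, mul_min_of_nonneg _ _ hκ]
  exact div_le_div_of_nonneg_right (min_le_min (h.outWeight_le S) (h.outWeight_le Sᶜ))
    (le_min (vertexWeight_nonneg hπ _) (vertexWeight_nonneg hπ _))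

theorem le_expansion [Nontrivial V] {c : V → V → ℝ} {lam : ℝ}
    (h : ∀ S : Finset V, S.Nonempty → S ≠ Finset.univ → lam ≤ setExpansion c π S) :
    lam ≤ expansion c π := by
  obtain ⟨i, j, hij⟩ := exists_pair_ne V
  have : Nonempty {S : Finset V // S.Nonempty ∧ S ≠ Finset.univ} :=
    ⟨{i}, by simp, fun he => hij (by
      have : j ∈ ({i} : Finset V) := he ▸ Finset.mem_univ j
      exact (Finset.mem_singleton.1 this).symm)⟩
  exact le_ciInf fun S => h S.1 S.2.1 S.2.2

/-- A small potential forces a spectral gap. -/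
theorem spectralGapGE_of_potential_lt (hπ : ∀ i, 0 < π i) {D : V → V → ℝ}
    (hD : ∀ i j, 0 ≤ D i j) {T : ℕ} (hT : 0 < T) {m : ℝ}
    (hpot : potential π [(T : ℝ) • D] < Real.exp (-m)) : SpectralGapGE D π (16 * m / T) := by
  intro x hx
  have hT' : (0 : ℝ) < T := by exact_mod_cast hT
  set w : V → ℝ := fun i => √(π i) * x i with hw
  have hsq : ∀ i, √(π i) * √(π i) = π i := fun i => Real.mul_self_sqrt (hπ i).le
  have hww : w ⬝ᵥ w = ∑ i, π i * x i ^ 2 :=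
    Finset.sum_congr rfl fun i _ => by
      rw [hw, ← hsq i]
      ring
  have hqw : (fun i => √(π i)) ⬝ᵥ w = 0 := by
    rw [← hx]
    exact Finset.sum_congr rfl fun i _ => by
      simp only [hw]
      rw [← mul_assoc, hsq]
  have hinv : invSqrtDiag π *ᵥ w = x := by
    funext i
    rw [invSqrtDiag, mulVec_diagonal]
    exact inv_mul_cancel_left₀ (Real.sqrt_pos.2 (hπ i)).ne' _
  rw [← hww]
  have hnn : 0 ≤ w ⬝ᵥ w := Finset.sum_nonneg fun i _ => mul_self_nonneg (w i)
  rcases hnn.eq_or_lt with h0 | h0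
  · rw [← h0, mul_zero, symLaplacian_quadratic]
    exact div_nonneg (Finset.sum_nonneg fun i _ => Finset.sum_nonneg fun j _ =>
      mul_nonneg (hD i j) (sq_nonneg _)) two_pos.le
  · have h1 := exp_neg_le_potential [(T : ℝ) • D] hqw h0
      (div_mul_cancel₀ (w ⬝ᵥ feedbackSum π [(T : ℝ) • D] *ᵥ w) h0.ne').symm
    have h2 := Real.exp_lt_exp.1 (h1.trans_lt hpot)
    have h3 : w ⬝ᵥ feedbackSum π [(T : ℝ) • D] *ᵥ w
        = T / 16 * (x ⬝ᵥ symLaplacian D *ᵥ x) := by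
      rw [feedbackSum, List.map_singleton, List.sum_singleton, smul_mulVec, dotProduct_smul,
        feedback_quadratic, hinv, symLaplacian_smul, smul_mulVec, dotProduct_smul, smul_eq_mul,
        smul_eq_mul]
      ring
    rw [neg_lt_neg_iff, lt_div_iff₀ h0, h3] at h2
    rw [div_mul_eq_mul_div, div_le_iff₀ hT']
    linarith

end Expansion

/-! ### The success probability of the game and of the search -/

section Final

open MeasureTheory

variable {V : Type u} [Fintype V] [DecidableEq V] {sub : Subroutines V} {G : CapDigraph V}
  {π : V → ℝ} {κ : ℝ}

/-- Markov's inequality for the final potential. -/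
theorem measure_outputPotential_ge_le [Nontrivial V] (hκ : 0 < κ) (hπ : ∀ i, 0 < π i) {T : ℕ}
    (hT : 270336 * Real.log (Fintype.card V) ^ 2 ≤ T) :
    gaussianSeeds V T {u | ENNReal.ofReal (Real.exp (-Real.log (Fintype.card V)))
      ≤ outputPotential π T ((cutMatching sub G π κ u).eval sub.solve)} ≤ 1 / 3 := by
  have hℓ := two_thirds_lt_log_card (V := V)
  have hn : (2 : ℝ) ≤ Fintype.card V := by exact_mod_cast Fintype.one_lt_card
  have hlogn : Real.exp (Real.log (Fintype.card V)) = Fintype.card V := Real.exp_log (by linarith)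
  set ℓ := Real.log (Fintype.card V) with hℓdef
  have hT0 : 0 < T := by
    have : (0 : ℝ) < T := lt_of_lt_of_le (by positivity) hT
    exact_mod_cast this
  have hm : Measurable fun u : Fin T → V → ℝ =>
      outputPotential π T ((cutMatching sub G π κ u).eval sub.solve) :=
    measurable_cmLoop hπ _ _ _
  have h1 := mul_meas_ge_le_lintegral (μ := gaussianSeeds V T) hm (ENNReal.ofReal (Real.exp (-ℓ)))
  have h2 := h1.trans (lintegral_outputPotential_le (sub := sub) (G := G) hκ hπ hT0 T [] (by simp))
  rw [← hℓdef] at h2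
  -- `T` rounds reduce the potential from at most `n` to at most `n⁻³ ≤ n⁻¹ / 3`
  have h3 : (1 - 1 / (67584 * ℓ)) ^ T * potential π [] ≤ Real.exp (-ℓ) * (1 / 3) := by
    have h4 : (1 - 1 / (67584 * ℓ)) ^ T ≤ Real.exp (-(4 * ℓ)) := by
      have h5 : 1 - 1 / (67584 * ℓ) ≤ Real.exp (-(1 / (67584 * ℓ))) := by
        have := Real.add_one_le_exp (-(1 / (67584 * ℓ)))
        linarith
      have h6 : 0 ≤ 1 - 1 / (67584 * ℓ) := by
        rw [sub_nonneg, div_le_one (by positivity)]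
        linarith
      refine (pow_le_pow_left₀ h6 h5 T).trans ?_
      rw [← Real.exp_nat_mul, Real.exp_le_exp, mul_neg, neg_le_neg_iff, mul_one_div,
        le_div_iff₀ (by positivity)]
      linarith
    have h5 : potential π [] ≤ Real.exp ℓ := (potential_nil_le hπ).trans_eq hlogn.symm
    have h6 : 3 * Real.exp (-(2 * ℓ)) ≤ 1 := by
      rw [show -(2 * ℓ) = -ℓ + -ℓ by ring, Real.exp_add, Real.exp_neg, hlogn]
      have : (Fintype.card V : ℝ)⁻¹ ≤ 2⁻¹ := inv_anti₀ two_pos hn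
      have h0 : 0 ≤ (Fintype.card V : ℝ)⁻¹ := by positivity
      nlinarith
    calc (1 - 1 / (67584 * ℓ)) ^ T * potential π [] ≤ Real.exp (-(4 * ℓ)) * Real.exp ℓ :=
          mul_le_mul h4 h5 (potential_pos hπ _).le (Real.exp_pos _).le
      _ = Real.exp (-ℓ) * Real.exp (-(2 * ℓ)) := by
          rw [← Real.exp_add, ← Real.exp_add]; congr 1; ring
      _ ≤ Real.exp (-ℓ) * (1 / 3) :=
          mul_le_mul_of_nonneg_left (by linarith) (Real.exp_pos _).le
  have h4 := h2.trans (ENNReal.ofReal_le_ofReal h3)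
  rw [ENNReal.ofReal_mul (Real.exp_pos _).le] at h4
  have h5 := (ENNReal.mul_le_mul_iff_right
    (ENNReal.ofReal_pos.2 (Real.exp_pos (-ℓ))).ne' ENNReal.ofReal_ne_top).1 h4
  refine h5.trans_eq ?_
  rw [ENNReal.ofReal_div_of_pos (by norm_num)]
  simp

/-- Outside of an event of probability at most `1/3`, the game outputs a cut or a demand graph with
a large spectral gap, which certifies that `G` has large expansion. -/
theorem measure_failure_le [Nontrivial V] (hκ : 0 < κ) (hπ : ∀ i, 0 < π i) {T : ℕ}
    (hT : T = ⌈270336 * Real.log (Fintype.card V) ^ 2⌉₊) :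
    gaussianSeeds V T {u | ∃ D, (cutMatching sub G π κ u).eval sub.solve = .demand D ∧
      ¬ (SpectralGapGE D π (8 / 270339 / Real.log (Fintype.card V)) ∧
        8 / 270339 / Real.log (Fintype.card V) ≤ expansion D π ∧
        8 / 270339 / (κ * Real.log (Fintype.card V)) ≤ expansion G.cap π)} ≤ 1 / 3 := by
  have hℓ := two_thirds_lt_log_card (V := V)
  have hT1 : 270336 * Real.log (Fintype.card V) ^ 2 ≤ T := hT ▸ Nat.le_ceil _
  have hTu : (T : ℝ) < 270336 * Real.log (Fintype.card V) ^ 2 + 1 := by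
    rw [hT]; exact Nat.ceil_lt_add_one (by positivity)
  refine (measure_mono ?_).trans (measure_outputPotential_ge_le (sub := sub) (G := G) hκ hπ hT1)
  set ℓ := Real.log (Fintype.card V) with hℓdef
  have hTpos : (0 : ℝ) < T := lt_of_lt_of_le (by positivity) hT1
  have hT0 : 0 < T := by exact_mod_cast hTpos
  rintro u ⟨D, hD, hfail⟩
  obtain ⟨hE, f, hf, -⟩ := eval_cutMatching_demand hκ hπ hT0 u hD
  by_contra hcon
  rw [Set.mem_ofPred_eq, not_le, hD, outputPotential] at hcon
  have hpot := (ENNReal.ofReal_lt_ofReal_iff (Real.exp_pos _)).1 hcon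
  have hgap := spectralGapGE_of_potential_lt hπ hE.1 hT0 hpot
  have hc : 0 ≤ 8 / 270339 / ℓ := by positivity
  have hle : 2 * (8 / 270339 / ℓ) ≤ 16 * ℓ / T := by
    have h1 : (T : ℝ) ≤ 270339 * ℓ ^ 2 := by nlinarith
    rw [le_div_iff₀ hTpos]
    calc 2 * (8 / 270339 / ℓ) * T ≤ 2 * (8 / 270339 / ℓ) * (270339 * ℓ ^ 2) :=
          mul_le_mul_of_nonneg_left h1 (by positivity)
      _ = 16 * ℓ := by field_simp; norm_num
  have hmono : ∀ lam, lam ≤ 16 * ℓ / T → SpectralGapGE D π lam := fun lam hlam x hx =>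
    (mul_le_mul_of_nonneg_right hlam (Finset.sum_nonneg fun i _ =>
      mul_nonneg (hπ i).le (sq_nonneg _))).trans (hgap x hx)
  have hset : ∀ S : Finset V, S.Nonempty → S ≠ Finset.univ →
      8 / 270339 / ℓ ≤ setExpansion D π S := fun S hS hSu =>
    le_setExpansion_of_spectralGapGE hπ hE hc (hmono _ hle) hS hSu
  refine hfail ⟨hmono _ (by linarith), le_expansion hset, le_expansion fun S hS hSu => ?_⟩
  have h1 := (hset S hS hSu).trans (hf.setExpansion_le hκ.le hπ S)
  rw [mul_comm κ, ← div_div, div_le_iff₀ hκ]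
  linarith

theorem cutMatchingSearch_spec {T : ℕ} (u : Fin T → V → ℝ)
    (hcut : ∀ κ : ℝ, 0 < κ → ∀ S, (cutMatching sub G π κ u).eval sub.solve = .cut S →
      S.Nonempty ∧ S ≠ Finset.univ) (K : ℕ) {κ₀ : ℝ} (hκ₀ : 0 < κ₀) :
    (∀ S, (cutMatchingSearch sub G π u κ₀ K).eval sub.solve = some S →
      S.Nonempty ∧ S ≠ Finset.univ) ∧
    ∀ k < K, ∀ S, (cutMatching sub G π (2 ^ k * κ₀) u).eval sub.solve = .cut S →
      ∃ S', (cutMatchingSearch sub G π u κ₀ K).eval sub.solve = some S' ∧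
        setExpansion G.cap π S' ≤ setExpansion G.cap π S := by
  induction K generalizing κ₀ with
  | zero => exact ⟨fun S hS => by simp [cutMatchingSearch, FlowProg.eval] at hS, by simp⟩
  | succ K ih =>
    obtain ⟨ih1, ih2⟩ := ih (κ₀ := 2 * κ₀) (by positivity)
    have heval : (cutMatchingSearch sub G π u κ₀ (K + 1)).eval sub.solve
        = betterCut G π ((cutMatching sub G π κ₀ u).eval sub.solve)
          ((cutMatchingSearch sub G π u (2 * κ₀) K).eval sub.solve) := by
      rw [cutMatchingSearch, FlowProg.eval_bind, FlowProg.eval_bind]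
      rfl
    have hpow : ∀ k, (2 : ℝ) ^ (k + 1) * κ₀ = 2 ^ k * (2 * κ₀) := fun k => by ring
    rw [heval]
    cases h1 : (cutMatching sub G π κ₀ u).eval sub.solve with
    | demand D =>
      refine ⟨ih1, fun k hk S hS => ?_⟩
      cases k with
      | zero => rw [pow_zero, one_mul, h1] at hS; simp at hS
      | succ k => exact ih2 k (by omega) S (by rw [← hpow]; exact hS)
    | cut S₀ =>
      have h0 := hcut κ₀ hκ₀ S₀ h1
      cases h2 : (cutMatchingSearch sub G π u (2 * κ₀) K).eval sub.solve with
      | none =>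
        refine ⟨fun S hS => ?_, fun k hk S hS => ⟨S₀, rfl, ?_⟩⟩
        · simp only [betterCut, Option.some.injEq] at hS
          exact hS ▸ h0
        · cases k with
          | zero =>
            rw [pow_zero, one_mul, h1] at hS
            rw [CMOutput.cut.inj hS]
          | succ k =>
            obtain ⟨S', hS', -⟩ := ih2 k (by omega) S (by rw [← hpow]; exact hS)
            rw [h2] at hS'
            simp at hS'
      | some S₁ =>
        have h3 := ih1 S₁ h2
        have hbest : ∃ S', betterCut G π (.cut S₀) (some S₁) = some S' ∧
            (S' = S₀ ∨ S' = S₁) ∧ setExpansion G.cap π S' ≤ setExpansion G.cap π S₀ ∧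
            setExpansion G.cap π S' ≤ setExpansion G.cap π S₁ := by
          simp only [betterCut]
          split_ifs with hle
          · exact ⟨S₀, rfl, Or.inl rfl, le_rfl, hle⟩
          · exact ⟨S₁, rfl, Or.inr rfl, (not_le.1 hle).le, le_rfl⟩
        obtain ⟨S', hS', hor, hle0, hle1⟩ := hbest
        rw [hS']
        refine ⟨fun S hS => ?_, fun k hk S hS => ⟨S', rfl, ?_⟩⟩
        · rw [← Option.some.inj hS]
          rcases hor with rfl | rfl
          exacts [h0, h3]
        · cases k with
          | zero =>
            rw [pow_zero, one_mul, h1] at hS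
            rw [← CMOutput.cut.inj hS]
            exact hle0
          | succ k =>
            obtain ⟨S'', hS'', hle⟩ := ih2 k (by omega) S (by rw [← hpow]; exact hS)
            rw [h2] at hS''
            rw [← Option.some.inj hS''] at hle
            exact hle1.trans hle

/-- The doubling search contains a parameter within a factor of two of the critical one. -/
theorem exists_scale {a b φ : ℝ} (ha : 0 < a) (haφ : a ≤ φ) (hφb : φ ≤ b) :
    ∃ k < ⌈Real.logb 2 (b / a)⌉₊ + 1, 2 ^ k * φ < 2 * b ∧ b ≤ 2 ^ k * φ := by
  have hφ : 0 < φ := ha.trans_le haφ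
  have hb : 0 < b := hφ.trans_le hφb
  have hex : b ≤ 2 ^ ⌈Real.logb 2 (b / a)⌉₊ * φ := by
    have h1 : b / a ≤ 2 ^ ⌈Real.logb 2 (b / a)⌉₊ := by
      have h2 : (2 : ℝ) ^ Real.logb 2 (b / a) = b / a :=
        Real.rpow_logb two_pos (by norm_num) (by positivity)
      rw [← h2, ← Real.rpow_natCast, h2]
      exact h2.symm.trans_le (Real.rpow_le_rpow_of_exponent_le one_le_two (Nat.le_ceil _))
    rw [div_le_iff₀ ha] at h1
    exact h1.trans (mul_le_mul_of_nonneg_left haφ (by positivity))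
  classical
  have hne : ∃ k : ℕ, b ≤ 2 ^ k * φ := ⟨_, hex⟩
  refine ⟨Nat.find hne, Nat.lt_succ_of_le (Nat.find_min' hne hex), ?_, Nat.find_spec hne⟩
  cases hk : Nat.find hne with
  | zero => rw [pow_zero, one_mul]; linarith
  | succ k =>
    have := Nat.find_min hne (m := k) (by omega)
    rw [not_le] at this
    rw [pow_succ]
    linarith

end Final

theorem mainTheorem6 :
    ∃ C c₁ c₂ c₃ : ℝ, 0 < C ∧ 0 < c₁ ∧ 0 < c₂ ∧ 0 < c₃ ∧
    ∀ (V : Type u) [Fintype V] [DecidableEq V] (G : CapDigraph V) (π : V → ℝ)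
      (sub : Subroutines V) (n T : ℕ),
      n = Fintype.card V → 2 ≤ n → (∀ i, 0 < π i) → T = ⌈C * Real.log n ^ 2⌉₊ →
      -- each round computes at most two single-commodity flows
      (∀ (κ : ℝ) (hist : List (V → V → ℝ)) (v : V → ℝ),
        (cmRound sub G π κ hist v).flowCount sub.solve ≤ 2) ∧
      -- the two possible outcomes of the algorithm
      (∀ κ : ℝ, 0 < κ →
        (∀ u : Fin T → V → ℝ,
          (cutMatching sub G π κ u).flowCount sub.solve ≤ 2 * T ∧
          (∀ S, (cutMatching sub G π κ u).eval sub.solve = .cut S →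
            S.Nonempty ∧ S ≠ Finset.univ ∧ setExpansion G.cap π S ≤ c₂ / κ) ∧
          (∀ D, (cutMatching sub G π κ u).eval sub.solve = .demand D →
            IsEulerian D ∧ ∃ f, Routes G κ f D ∧ IsEulerian (pathLoad f))) ∧
        gaussianSeeds V T {u | ∃ D, (cutMatching sub G π κ u).eval sub.solve = .demand D ∧
          ¬ (SpectralGapGE D π (c₁ / Real.log n) ∧
             c₁ / Real.log n ≤ expansion D π ∧
             c₁ / (κ * Real.log n) ≤ expansion G.cap π)} ≤ 1 / 3) ∧
      -- the resulting approximation algorithm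
      (∀ (a b : ℝ) (K : ℕ), 0 < a → a ≤ expansion G.cap π → expansion G.cap π ≤ b →
        K = ⌈Real.logb 2 (b / a)⌉₊ + 1 →
        (∀ u : Fin T → V → ℝ,
          (cutMatchingSearch sub G π u (c₁ / (2 * b * Real.log n)) K).flowCount sub.solve
            ≤ 2 * T * K) ∧
        gaussianSeeds V T {u | ¬ ∃ S,
          (cutMatchingSearch sub G π u (c₁ / (2 * b * Real.log n)) K).eval sub.solve = some S ∧
          S.Nonempty ∧ S ≠ Finset.univ ∧
          setExpansion G.cap π S ≤ c₃ * Real.log n * expansion G.cap π} ≤ 1 / 3) := by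
  -- `C = 4 · 67584` makes the potential drop by a factor `n⁴`; then `T ≤ 270339 log² n`, and a
  -- potential below `1 / n` gives a gap of `16 log n / T ≥ 2 c₁ / log n` with `c₁ = 8 / 270339`
  refine ⟨270336, 8 / 270339, 3, 6 / (8 / 270339), by norm_num, by norm_num, by norm_num,
    by norm_num, ?_⟩
  intro V _ _ G π sub n T hn hn2 hπ hT
  subst hn
  have hnt : Nontrivial V := Fintype.one_lt_card_iff_nontrivial.1 hn2
  have hℓ := two_thirds_lt_log_card (V := V)
  have hT0 : 0 < T := by
    rw [hT]
    exact Nat.ceil_pos.2 (by positivity)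
  have hcut : ∀ κ : ℝ, 0 < κ → ∀ (u : Fin T → V → ℝ) S,
      (cutMatching sub G π κ u).eval sub.solve = .cut S →
      S.Nonempty ∧ S ≠ Finset.univ ∧ setExpansion G.cap π S ≤ 3 / κ := fun κ hκ u S hS =>
    (eval_cmLoop_spec hκ hπ (List.ofFn u) [] (by simp)).1 S hS
  refine ⟨fun κ hist v => (flowCount_cmRound sub G π κ hist v).le, fun κ hκ => ⟨fun u =>
    ⟨flowCount_cutMatching_le sub G π κ u, hcut κ hκ u, fun D hD =>
      eval_cutMatching_demand hκ hπ hT0 u hD⟩, measure_failure_le hκ hπ hT⟩, ?_⟩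
  intro a b K ha haφ hφb hK
  refine ⟨fun u => flowCount_cutMatchingSearch_le sub G π _ u K, ?_⟩
  obtain ⟨k, hk, hk1, hk2⟩ := exists_scale ha haφ hφb
  rw [← hK] at hk
  set ℓ := Real.log (Fintype.card V) with hℓdef
  set φ := expansion G.cap π with hφdef
  have hφ : 0 < φ := ha.trans_le haφ
  have hb : 0 < b := hφ.trans_le hφb
  set κ₀ := 8 / 270339 / (2 * b * ℓ) with hκ₀
  have hκ₀pos : 0 < κ₀ := by positivity
  have hκpos : 0 < 2 ^ k * κ₀ := by positivity
  refine (MeasureTheory.measure_mono ?_).trans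
    (measure_failure_le (sub := sub) (G := G) hκpos hπ hT)
  intro u hu
  cases he : (cutMatching sub G π (2 ^ k * κ₀) u).eval sub.solve with
  | demand D =>
    -- at this scale the certified lower bound would exceed the expansion of `G`
    refine ⟨D, he, fun hcon => ?_⟩
    have h1 := hcon.2.2
    rw [← hℓdef, ← hφdef, div_le_iff₀ (by positivity)] at h1
    have h2 : φ * (2 ^ k * κ₀ * ℓ) = 8 / 270339 * (2 ^ k * φ / (2 * b)) := by
      rw [hκ₀]; field_simp
    have h3 : 2 ^ k * φ / (2 * b) < 1 := (div_lt_one (by positivity)).2 hk1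
    rw [h2] at h1
    linarith
  | cut S =>
    exfalso
    obtain ⟨h1, h2⟩ := cutMatchingSearch_spec (sub := sub) (G := G) (π := π) u
      (fun κ hκ S hS => ⟨(hcut κ hκ u S hS).1, (hcut κ hκ u S hS).2.1⟩) K hκ₀pos
    obtain ⟨S', hS', hle⟩ := h2 k hk S he
    refine hu ⟨S', hS', (h1 S' hS').1, (h1 S' hS').2, hle.trans ?_⟩
    refine (hcut _ hκpos u S he).2.2.trans ?_
    rw [div_le_iff₀ hκpos]
    have h4 : 6 / (8 / 270339) * ℓ * φ * (2 ^ k * κ₀) = 3 * (2 ^ k * φ / b) := by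
      rw [hκ₀]; field_simp; norm_num
    have h5 : 1 ≤ 2 ^ k * φ / b := (one_le_div hb).2 hk2
    rw [h4]
    linarith
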